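/- Let $f(x)=\sum_{i=1}^{k} f_i x^{e_i}\in\mathbb R[x]$ be an $(n,k,\tau)$-nomial, that is, $0\le e_1<e_2<\dots<e_k\le n$ are integers and $2^{-\tau}\le |f_i|\le 2^{\tau}$ for all $i$; assume $k\ge 2$ and $e_1=0$. The first fractional derivative $p^{[1]}$ of a polynomial $p$ is $p'$ divided by the highest power of $x$ that divides $p'$; put $f^{[0]}=f$ and $f^{[i]}=(f^{[i-1]})^{[1]}$. Let $\mathcal D_f=(f,f^{[1]},\dots,f^{[k-1]})$ and $M_{\mathcal D_f}(x)=\min_{0\le i<k}|f^{[i]}(x)|$. For $m\in\mathbb R$, $\delta>0$ and $t\in\mathbb N$ let $m[t;\delta]=\{m_i=m+(i-t)\delta : i=0,1,\dots,2t\}$. A point $m^*\in m[t;\delta]$ is called $(M_{\mathcal D_f},m[t;\delta])$-admissible if $M_{\mathcal D_f}(m^*)\ge \frac18\max_{x\in m[t;\delta]}M_{\mathcal D_f}(x)$. There is an algorithm that, for every such $f$ and every multipoint $m[t;\delta]$ with $t\ge k^2$, computes (the index $i$ of) an $(M_{\mathcal D_f},m[t;\delta])$-admissible point $m^*=m_i$,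 and for every real $\alpha$ with $m[t;\delta]\subset(0,\alpha)$ it uses $$\tilde O\Bigl(t\,k^2\,(k+\log n)\bigl(k\log n+\tau+\log\max(1,1/\delta)+n\log\max(1,\alpha)\bigr)\Bigr)$$ bit operations. Here $\log=\log_2$, and $\tilde O(B)$ means at most $C\cdot B\cdot(\log(2+B))^{p}$ with constants $C,p$ that do not depend on the input. The input consists of $n,k,t$ and the exponents $e_i$ as integers, and of oracles for the real numbers $f_1,\dots,f_k,m,\delta$: asked for a number $v$ with precision $\kappa\in\mathbb N_{>0}$, the oracle returns some $a\in\mathbb Z$ with $|v-a/2^{\kappa+1}|<2^{-\kappa}$. The numbers $\tau$ and $\alpha$ are not given. The algorithm is one fixed program of an integer random access machine (addition, subtraction, multiplication, shifts, comparisons, indirect addressing, oracle queries), and bit operations are counted by the logarithmic cost criterion: each instruction is charged, up to a constant, the total bit length of the operands, addresses and result; in addition a multiplication of operands of total length $s$ is charged $s\cdot\ell(s)^2$, where $\ell(s)$ is the bit length of $s$ (which exceeds, up to a constant, the bit complexity of fast integer multiplication), and an oracle query with precision $\kappa$ is charged $\kappa$. -/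

import Mathlib

/-! ## Sparse polynomials and fractional derivatives -/

/-- The polynomial with terms `c i * x ^ e i`, `i < k`. -/
noncomputable def sparsePoly {k : ℕ} (e : Fin k → ℕ) (c : Fin k → ℝ) : Polynomial ℝ :=
  ∑ i, Polynomial.C (c i) * Polynomial.X ^ e i

/-- The data `e`, `c` present an `(n, k, τ)`-nomial: strictly increasing exponents bounded by `n`,
coefficients of absolute value between `2 ^ (-τ)` and `2 ^ τ`. -/
structure IsNomial (n k : ℕ) (τ : ℝ) (e : Fin k → ℕ) (c : Fin k → ℝ) : Prop where
  strictMono : StrictMono e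
  exp_le : ∀ i, e i ≤ n
  le_abs : ∀ i, (2 : ℝ) ^ (-τ) ≤ |c i|
  abs_le : ∀ i, |c i| ≤ (2 : ℝ) ^ τ

/-- The first fractional derivative: `p'` divided by the highest power of `x` dividing `p'`
(and `0` if `p' = 0`). -/
noncomputable def fracDeriv (p : Polynomial ℝ) : Polynomial ℝ :=
  p.derivative /ₘ Polynomial.X ^ p.derivative.natTrailingDegree

/-- The tuple `(f, f^[1], …, f^[k-1])` of the first `k` iterated fractional derivatives,
as functions on the reals. -/
noncomputable def fracDerivs (k : ℕ) (f : Polynomial ℝ) (i : Fin k) (x : ℝ) : ℝ :=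
  (fracDeriv^[(i : ℕ)] f).eval x

/-- `minAbs G x = min (|g_1 x|, …, |g_k x|)`, used for nonempty tuples only. -/
noncomputable def minAbs {k : ℕ} (G : Fin k → ℝ → ℝ) (x : ℝ) : ℝ := ⨅ i, |G i x|

/-! ## Multipoints and admissible points -/

/-- The `i`-th point `m + (i - t) δ` of the multipoint `m[t; δ]`. -/
noncomputable def multiPt (m : ℝ) (t : ℕ) (δ : ℝ) (i : ℕ) : ℝ := m + ((i : ℝ) - (t : ℝ)) * δ

/-- The multipoint `m[t; δ]`, a set of `2 t + 1` equidistant points centred at `m`. -/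
noncomputable def multipoint (m : ℝ) (t : ℕ) (δ : ℝ) : Set ℝ := {x | ∃ i ≤ 2 * t, x = multiPt m t δ i}

/-- `x` is a `(g, S)`-admissible point: `x ∈ S` and `|g x|` is at least one eighth of the maximum
of `|g|` on the finite set `S`. -/
def IsAdmissible (g : ℝ → ℝ) (S : Set ℝ) (x : ℝ) : Prop :=
  x ∈ S ∧ ∀ y ∈ S, 1 / 8 * |g y| ≤ |g x|

/-! ## Random access machines with bit costs and oracles for real numbers

The model is the textbook random access machine with integer registers under the logarithmic cost
criterion: every instruction is charged the lengths of all register contents and all addresses that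
it touches. A multiplication of numbers of total length `s` is charged `s (log s) ^ 2` on top, which
exceeds the bit complexity `O(s log s log log s)` of fast integer multiplication. -/

/-- Length of an integer in bits, including the sign. -/
def bitLen (z : ℤ) : ℕ := z.natAbs.size + 1

/-- The contents of the registers. -/
abbrev Mem := ℕ → ℤ

/-- Operands: a constant, a register, or a register addressed by the contents of another one. -/
inductive Operand
  | const (z : ℤ)
  | reg (a : ℕ)
  | ind (a : ℕ)

def Operand.val (M : Mem) : Operand → ℤ
  | .const z => z
  | .reg a => M a
  | .ind a => M (M a).toNat

def Operand.cost (M : Mem) : Operand → ℕ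
  | .const z => bitLen z
  | .reg a => bitLen a + bitLen (M a)
  | .ind a => bitLen a + bitLen (M a) + bitLen (M (M a).toNat)

/-- Destinations: a register, or a register addressed by the contents of another one. -/
inductive Dest
  | reg (a : ℕ)
  | ind (a : ℕ)

def Dest.addr (M : Mem) : Dest → ℕ
  | .reg a => a
  | .ind a => (M a).toNat

def Dest.cost (M : Mem) : Dest → ℕ
  | .reg a => bitLen a
  | .ind a => bitLen a + bitLen (M a)

/-- Operations: addition, subtraction, multiplication, left shift and right shift. -/
inductive ArithOp
  | add
  | sub
  | mul
  | shl
  | shr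

/-- The right shift is division by a power of two, rounded towards `-∞`. -/
def ArithOp.eval : ArithOp → ℤ → ℤ → ℤ
  | .add, x, y => x + y
  | .sub, x, y => x - y
  | .mul, x, y => x * y
  | .shl, x, y => x * 2 ^ y.toNat
  | .shr, x, y => x / 2 ^ y.toNat

/-- The charge for an operation in addition to the lengths of its operands and of its result. -/
def ArithOp.extraCost : ArithOp → ℤ → ℤ → ℕ
  | .mul, x, y => (bitLen x + bitLen y) * (bitLen x + bitLen y).size ^ 2
  | _, _, _ => 0

/-- Programs. The command `ask d j κ` queries the oracle for real number `j` with precision `κ` and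
stores the answer in `d`; `ite x y p q` runs `p` if `x ≤ y` and `q` otherwise; `loop x y p` repeats
`p` as long as `x < y`. -/
inductive Prog
  | skip
  | arith (o : ArithOp) (d : Dest) (x y : Operand)
  | ask (d : Dest) (j κ : Operand)
  | seq (p q : Prog)
  | ite (x y : Operand) (p q : Prog)
  | loop (x y : Operand) (p : Prog)

/-- `Exec O P M M' T`: with oracle answers `O j κ`, the program `P` started on the registers `M`
halts with registers `M'` after bit cost `T`. A query with precision `κ` is charged `κ` and
the length of the answer, besides its operands. -/
inductive Exec (O : ℕ → ℕ → ℤ) : Prog → Mem → Mem → ℕ → Prop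
  | skip (M : Mem) : Exec O .skip M M 1
  | arith (M : Mem) (o : ArithOp) (d : Dest) (x y : Operand) :
      Exec O (.arith o d x y) M
        (Function.update M (d.addr M) (o.eval (x.val M) (y.val M)))
        (1 + d.cost M + x.cost M + y.cost M + bitLen (o.eval (x.val M) (y.val M))
          + o.extraCost (x.val M) (y.val M))
  | ask (M : Mem) (d : Dest) (j κ : Operand) :
      Exec O (.ask d j κ) M
        (Function.update M (d.addr M) (O (j.val M).toNat (κ.val M).toNat))
        (1 + d.cost M + j.cost M + κ.cost M + (κ.val M).toNat
          + bitLen (O (j.val M).toNat (κ.val M).toNat))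
  | seq {p q : Prog} {M₁ M₂ M₃ : Mem} {T₁ T₂ : ℕ} :
      Exec O p M₁ M₂ T₁ → Exec O q M₂ M₃ T₂ → Exec O (.seq p q) M₁ M₃ (T₁ + T₂)
  | ite_true {x y : Operand} {p q : Prog} {M M' : Mem} {T : ℕ} :
      x.val M ≤ y.val M → Exec O p M M' T →
        Exec O (.ite x y p q) M M' (1 + x.cost M + y.cost M + T)
  | ite_false {x y : Operand} {p q : Prog} {M M' : Mem} {T : ℕ} :
      ¬ x.val M ≤ y.val M → Exec O q M M' T →
        Exec O (.ite x y p q) M M' (1 + x.cost M + y.cost M + T)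
  | loop_done {x y : Operand} {p : Prog} {M : Mem} :
      ¬ x.val M < y.val M → Exec O (.loop x y p) M M (1 + x.cost M + y.cost M)
  | loop_step {x y : Operand} {p : Prog} {M M' M'' : Mem} {T T' : ℕ} :
      x.val M < y.val M → Exec O p M M' T → Exec O (.loop x y p) M' M'' T' →
        Exec O (.loop x y p) M M'' (1 + x.cost M + y.cost M + T + T')

/-- `a` provides dyadic approximations of the real number `v`: for every positive integer `κ`,
the number `a κ / 2 ^ (κ + 1)` approximates `v` with error less than `2 ^ (-κ)`. -/
def IsApproxOracle (v : ℝ) (a : ℕ → ℤ) : Prop :=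
  ∀ κ : ℕ, 0 < κ → |v - (a κ : ℝ) / 2 ^ (κ + 1)| < 1 / 2 ^ κ

/-- Oracle `0` provides `m`, oracle `1` provides `δ`, and oracle `i + 2` provides the `i`-th
coefficient. -/
structure IsInputOracle {k : ℕ} (c : Fin k → ℝ) (m δ : ℝ) (O : ℕ → ℕ → ℤ) : Prop where
  center : IsApproxOracle m (O 0)
  step : IsApproxOracle δ (O 1)
  coeff : ∀ i : Fin k, IsApproxOracle (c i) (O ((i : ℕ) + 2))

/-- The initial registers hold `n`, `k`, `t`, the exponents, and zeros from then on. -/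
def initMem (n k t : ℕ) (e : Fin k → ℕ) : Mem
  | 0 => n
  | 1 => k
  | 2 => t
  | a + 3 => if h : a < k then (e ⟨a, h⟩ : ℤ) else 0

/-! ## Uniform cost accounting for programs -/

/-- All registers have absolute value at most `2 ^ b`. -/
def Bdd (b : ℕ) (M : Mem) : Prop := ∀ a, |M a| ≤ 2 ^ b

/-- Upper bound for the cost of one instruction on registers bounded by `2 ^ b`. -/
def unitCost (b : ℕ) : ℕ := 1 + 10 * (b + 2) + 2 * (b + 2) * (2 * (b + 2)).size ^ 2

/-- `Runs O b P M M' N`: started on `M` with registers bounded by `2 ^ b`, the program `P` halts on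
`M'`, with registers still bounded by `2 ^ b`, at the cost of at most `N` instructions. -/
def Runs (O : ℕ → ℕ → ℤ) (b : ℕ) (P : Prog) (M M' : Mem) (N : ℕ) : Prop :=
  6 ≤ b → Bdd b M → Bdd b M' ∧ ∃ T ≤ N * unitCost b, Exec O P M M' T

theorem bitLen_le {z : ℤ} {b : ℕ} (h : |z| ≤ 2 ^ b) : bitLen z ≤ b + 2 := by
  unfold bitLen
  have h1 : z.natAbs < 2 ^ (b + 1) := by
    have h2 : (z.natAbs : ℤ) ≤ 2 ^ b := by rwa [Int.natCast_natAbs]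
    have h3 : z.natAbs ≤ 2 ^ b := by exact_mod_cast h2
    rw [pow_succ]
    have := Nat.pos_of_ne_zero (pow_ne_zero b (two_ne_zero : (2 : ℕ) ≠ 0))
    omega
  have := Nat.size_le.2 h1
  omega

def Operand.lit : Operand → ℕ
  | .const z => z.natAbs
  | .reg a => a
  | .ind a => a

def Dest.lit : Dest → ℕ
  | .reg a => a
  | .ind a => a

theorem sixtyFour_le {b a : ℕ} (hb : 6 ≤ b) (ha : a ≤ 64) : |(a : ℤ)| ≤ 2 ^ b := by
  rw [abs_of_nonneg (by positivity)]
  calc (a : ℤ) ≤ 64 := by exact_mod_cast ha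
    _ = 2 ^ 6 := by norm_num
    _ ≤ 2 ^ b := pow_le_pow_right₀ (by norm_num) hb

theorem Operand.cost_le {b : ℕ} {M : Mem} (hb : 6 ≤ b) (hM : Bdd b M) (x : Operand)
    (hx : x.lit ≤ 64) : x.cost M ≤ 3 * (b + 2) := by
  cases x with
  | const z =>
    have : bitLen z ≤ b + 2 := bitLen_le (by
      have := sixtyFour_le hb hx
      simpa [Operand.lit] using this)
    simp only [Operand.cost]; omega
  | reg a =>
    have h1 := bitLen_le (sixtyFour_le hb hx)
    have h2 := bitLen_le (hM a)
    simp only [Operand.cost, Operand.lit] at *; omega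
  | ind a =>
    have h1 := bitLen_le (sixtyFour_le hb hx)
    have h2 := bitLen_le (hM a)
    have h3 := bitLen_le (hM (M a).toNat)
    simp only [Operand.cost, Operand.lit] at *; omega

theorem Operand.val_le {b : ℕ} {M : Mem} (hb : 6 ≤ b) (hM : Bdd b M) (x : Operand)
    (hx : x.lit ≤ 64) : |x.val M| ≤ 2 ^ b := by
  cases x with
  | const z => simpa [Operand.lit, Operand.val] using sixtyFour_le hb hx
  | reg a => exact hM _
  | ind a => exact hM _

theorem Dest.cost_le {b : ℕ} {M : Mem} (hb : 6 ≤ b) (hM : Bdd b M) (d : Dest)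
    (hd : d.lit ≤ 64) : d.cost M ≤ 2 * (b + 2) := by
  cases d with
  | reg a =>
    have h1 := bitLen_le (sixtyFour_le hb hd)
    simp only [Dest.cost, Dest.lit] at *; omega
  | ind a =>
    have h1 := bitLen_le (sixtyFour_le hb hd)
    have h2 := bitLen_le (hM a)
    simp only [Dest.cost, Dest.lit] at *; omega

theorem ArithOp.extraCost_le {b : ℕ} {x y : ℤ} (hx : |x| ≤ 2 ^ b) (hy : |y| ≤ 2 ^ b)
    (o : ArithOp) : o.extraCost x y ≤ 2 * (b + 2) * (2 * (b + 2)).size ^ 2 := by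
  have h1 := bitLen_le hx
  have h2 := bitLen_le hy
  cases o with
  | mul =>
    have h3 : bitLen x + bitLen y ≤ 2 * (b + 2) := by omega
    exact Nat.mul_le_mul h3 (Nat.pow_le_pow_left (Nat.size_le_size h3) 2)
  | _ => exact Nat.zero_le _

theorem Bdd.update {b : ℕ} {M : Mem} (hM : Bdd b M) {a : ℕ} {v : ℤ} (hv : |v| ≤ 2 ^ b) :
    Bdd b (Function.update M a v) := by
  intro a'
  by_cases h : a' = a
  · subst h; simpa using hv
  · simpa [Function.update_of_ne h] using hM a'

section Rules

variable {O : ℕ → ℕ → ℤ} {b : ℕ} {M M' M'' : Mem}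

theorem Runs.op {o : ArithOp} {d : Dest} {x y : Operand} {v : ℤ}
    (hv : |v| ≤ 2 ^ b) (hM' : Function.update M (d.addr M) v = M')
    (hval : o.eval (x.val M) (y.val M) = v)
    (hd : d.lit ≤ 64 := by decide) (hx : x.lit ≤ 64 := by decide)
    (hy : y.lit ≤ 64 := by decide) : Runs O b (.arith o d x y) M M' 1 := by
  intro hb hM
  subst hval hM'
  refine ⟨hM.update hv, _, ?_, Exec.arith M o d x y⟩
  have h1 := d.cost_le hb hM hd
  have h2 := x.cost_le hb hM hx
  have h3 := y.cost_le hb hM hy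
  have h4 := o.extraCost_le (x.val_le hb hM hx) (y.val_le hb hM hy)
  have h5 := bitLen_le hv
  simp only [unitCost]
  omega

theorem Runs.query {d : Dest} {j κ : Operand} {v : ℤ} {i q : ℕ}
    (hv : |v| ≤ 2 ^ b) (hq : q ≤ b) (hM' : Function.update M (d.addr M) v = M')
    (hj : j.val M = i) (hκ : κ.val M = q) (hval : O i q = v)
    (hd : d.lit ≤ 64 := by decide) (hx : j.lit ≤ 64 := by decide)
    (hy : κ.lit ≤ 64 := by decide) : Runs O b (.ask d j κ) M M' 1 := by
  intro hb hM
  have e1 : (j.val M).toNat = i := by rw [hj]; simp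
  have e2 : (κ.val M).toNat = q := by rw [hκ]; simp
  have key := Exec.ask (O := O) M d j κ
  rw [e1, e2, hval, hM'] at key
  refine ⟨hM' ▸ hM.update hv, _, ?_, key⟩
  have h1 := d.cost_le hb hM hd
  have h2 := j.cost_le hb hM hx
  have h3 := κ.cost_le hb hM hy
  have h5 := bitLen_le hv
  simp only [unitCost]
  omega

theorem Runs.seq {P Q : Prog} {N N' : ℕ} (h : Runs O b P M M' N) (h' : Runs O b Q M' M'' N') :
    Runs O b (.seq P Q) M M'' (N + N') := by
  intro hb hM
  obtain ⟨h1, T, hT, e⟩ := h hb hM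
  obtain ⟨h2, T', hT', e'⟩ := h' hb h1
  exact ⟨h2, _, by rw [add_mul]; exact add_le_add hT hT', e.seq e'⟩

theorem Runs.mono {P : Prog} {N N' : ℕ} (h : Runs O b P M M' N) (hN : N ≤ N') :
    Runs O b P M M' N' := by
  intro hb hM
  obtain ⟨h1, T, hT, e⟩ := h hb hM
  exact ⟨h1, T, hT.trans (Nat.mul_le_mul_right _ hN), e⟩

theorem Runs.cast {P : Prog} {N N' : ℕ} (h : Runs O b P M M' N) (hN : N ≤ N') (hM : M' = M'') :
    Runs O b P M M'' N' := hM ▸ h.mono hN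

theorem one_le_unitCost (b : ℕ) : 1 ≤ unitCost b := by unfold unitCost; omega

theorem Runs.skip : Runs O b .skip M M 1 := fun _ hM =>
  ⟨hM, 1, by simpa using one_le_unitCost b, Exec.skip M⟩

theorem test_cost_le {x y : Operand} (hb : 6 ≤ b) (hM : Bdd b M) (hx : x.lit ≤ 64)
    (hy : y.lit ≤ 64) : 1 + x.cost M + y.cost M ≤ unitCost b := by
  have h2 := x.cost_le hb hM hx
  have h3 := y.cost_le hb hM hy
  unfold unitCost
  omega

theorem Runs.ite_true {x y : Operand} {P Q : Prog} {N : ℕ} (h : x.val M ≤ y.val M)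
    (hP : Runs O b P M M' N) (hx : x.lit ≤ 64 := by decide) (hy : y.lit ≤ 64 := by decide) :
    Runs O b (.ite x y P Q) M M' (N + 1) := by
  intro hb hM
  obtain ⟨h1, T, hT, e⟩ := hP hb hM
  have := test_cost_le hb hM hx hy
  exact ⟨h1, _, by rw [add_mul, one_mul]; omega, Exec.ite_true h e⟩

theorem Runs.ite_false {x y : Operand} {P Q : Prog} {N : ℕ} (h : ¬ x.val M ≤ y.val M)
    (hQ : Runs O b Q M M' N) (hx : x.lit ≤ 64 := by decide) (hy : y.lit ≤ 64 := by decide) :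
    Runs O b (.ite x y P Q) M M' (N + 1) := by
  intro hb hM
  obtain ⟨h1, T, hT, e⟩ := hQ hb hM
  have := test_cost_le hb hM hx hy
  exact ⟨h1, _, by rw [add_mul, one_mul]; omega, Exec.ite_false h e⟩

theorem Runs.loop_done {x y : Operand} {P : Prog} (h : ¬ x.val M < y.val M)
    (hx : x.lit ≤ 64 := by decide) (hy : y.lit ≤ 64 := by decide) :
    Runs O b (.loop x y P) M M 1 := by
  intro hb hM
  have := test_cost_le hb hM hx hy
  exact ⟨hM, _, by rw [one_mul]; exact this, Exec.loop_done h⟩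

theorem Runs.loop_step {x y : Operand} {P : Prog} {N N' : ℕ} (h : x.val M < y.val M)
    (hP : Runs O b P M M' N) (hL : Runs O b (.loop x y P) M' M'' N')
    (hx : x.lit ≤ 64 := by decide) (hy : y.lit ≤ 64 := by decide) :
    Runs O b (.loop x y P) M M'' (N + 1 + N') := by
  intro hb hM
  obtain ⟨h1, T, hT, e⟩ := hP hb hM
  obtain ⟨h2, T', hT', e'⟩ := hL hb h1
  have := test_cost_le hb hM hx hy
  exact ⟨h2, _, by rw [add_mul, add_mul, one_mul]; omega, Exec.loop_step h e e'⟩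

end Rules

/-! ## Named registers -/

/-- The contents of the named registers, and of a working array `H`. -/
structure St where
  n : ℤ
  k : ℤ
  t : ℤ
  s : ℤ
  q : ℤ
  am : ℤ
  ad : ℤ
  i : ℤ
  x : ℤ
  y : ℤ
  mn : ℤ
  j : ℤ
  w : ℤ
  a : ℤ
  h : ℤ
  p : ℤ
  g : ℤ
  b : ℤ
  u : ℤ
  v : ℤ
  best : ℤ
  bi : ℤ
  S : ℤ
  N : ℤ
  z : ℤ
  flag : ℤ
  H : ℕ → ℤ

/-- Assignment to `n`. -/
@[simp] def St.set_n (st : St) (v : ℤ) : St := {st with n := v}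

/-- Assignment to `s`. -/
@[simp] def St.set_s (st : St) (v : ℤ) : St := {st with s := v}

/-- Assignment to `q`. -/
@[simp] def St.set_q (st : St) (v : ℤ) : St := {st with q := v}

/-- Assignment to `am`. -/
@[simp] def St.set_am (st : St) (v : ℤ) : St := {st with am := v}

/-- Assignment to `ad`. -/
@[simp] def St.set_ad (st : St) (v : ℤ) : St := {st with ad := v}

/-- Assignment to `i`. -/
@[simp] def St.set_i (st : St) (v : ℤ) : St := {st with i := v}

/-- Assignment to `x`. -/
@[simp] def St.set_x (st : St) (v : ℤ) : St := {st with x := v}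

/-- Assignment to `y`. -/
@[simp] def St.set_y (st : St) (v : ℤ) : St := {st with y := v}

/-- Assignment to `mn`. -/
@[simp] def St.set_mn (st : St) (v : ℤ) : St := {st with mn := v}

/-- Assignment to `j`. -/
@[simp] def St.set_j (st : St) (v : ℤ) : St := {st with j := v}

/-- Assignment to `w`. -/
@[simp] def St.set_w (st : St) (v : ℤ) : St := {st with w := v}

/-- Assignment to `a`. -/
@[simp] def St.set_a (st : St) (v : ℤ) : St := {st with a := v}

/-- Assignment to `h`. -/
@[simp] def St.set_h (st : St) (v : ℤ) : St := {st with h := v}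

/-- Assignment to `p`. -/
@[simp] def St.set_p (st : St) (v : ℤ) : St := {st with p := v}

/-- Assignment to `g`. -/
@[simp] def St.set_g (st : St) (v : ℤ) : St := {st with g := v}

/-- Assignment to `b`. -/
@[simp] def St.set_b (st : St) (v : ℤ) : St := {st with b := v}

/-- Assignment to `u`. -/
@[simp] def St.set_u (st : St) (v : ℤ) : St := {st with u := v}

/-- Assignment to `v`. -/
@[simp] def St.set_v (st : St) (v : ℤ) : St := {st with v := v}

/-- Assignment to `best`. -/
@[simp] def St.set_best (st : St) (v : ℤ) : St := {st with best := v}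

/-- Assignment to `bi`. -/
@[simp] def St.set_bi (st : St) (v : ℤ) : St := {st with bi := v}

/-- Assignment to `S`. -/
@[simp] def St.set_S (st : St) (v : ℤ) : St := {st with S := v}

/-- Assignment to `N`. -/
@[simp] def St.set_N (st : St) (v : ℤ) : St := {st with N := v}

/-- Assignment to `z`. -/
@[simp] def St.set_z (st : St) (v : ℤ) : St := {st with z := v}

/-- Assignment to `flag`. -/
@[simp] def St.set_flag (st : St) (v : ℤ) : St := {st with flag := v}

/-- Assignment to `H`. -/
@[simp] def St.set_H (st : St) (v : ℕ → ℤ) : St := {st with H := v}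

/-- The registers of a state: the named ones, a table `E 0, …, E K`, and then `H`. -/
def mem (K : ℕ) (E : ℕ → ℤ) (st : St) : Mem
  | 0 => st.n
  | 1 => st.k
  | 2 => st.t
  | 3 => st.s
  | 4 => st.q
  | 5 => st.am
  | 6 => st.ad
  | 7 => st.i
  | 8 => st.x
  | 9 => st.y
  | 10 => st.mn
  | 11 => st.j
  | 12 => st.w
  | 13 => st.a
  | 14 => st.h
  | 15 => st.p
  | 16 => st.g
  | 17 => st.b
  | 18 => st.u
  | 19 => st.v
  | 20 => st.best
  | 21 => st.bi
  | 22 => st.S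
  | 23 => st.N
  | 24 => st.z
  | 25 => st.flag
  | a + 26 => if a ≤ K then E a else st.H (a - (K + 1))

attribute [simp] Operand.val Dest.addr ArithOp.eval

section Update

variable (K : ℕ) (E : ℕ → ℤ) (st : St) (v : ℤ)

theorem upd_n : Function.update (mem K E st) 0 v = mem K E (st.set_n v) :=
  Function.update_eq_iff.2 ⟨rfl, fun a ha => by
    unfold mem; split <;> first | rfl | exact absurd rfl ha⟩

theorem upd_s : Function.update (mem K E st) 3 v = mem K E (st.set_s v) :=
  Function.update_eq_iff.2 ⟨rfl, fun a ha => by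
    unfold mem; split <;> first | rfl | exact absurd rfl ha⟩

theorem upd_q : Function.update (mem K E st) 4 v = mem K E (st.set_q v) :=
  Function.update_eq_iff.2 ⟨rfl, fun a ha => by
    unfold mem; split <;> first | rfl | exact absurd rfl ha⟩

theorem upd_am : Function.update (mem K E st) 5 v = mem K E (st.set_am v) :=
  Function.update_eq_iff.2 ⟨rfl, fun a ha => by
    unfold mem; split <;> first | rfl | exact absurd rfl ha⟩

theorem upd_ad : Function.update (mem K E st) 6 v = mem K E (st.set_ad v) :=
  Function.update_eq_iff.2 ⟨rfl, fun a ha => by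
    unfold mem; split <;> first | rfl | exact absurd rfl ha⟩

theorem upd_i : Function.update (mem K E st) 7 v = mem K E (st.set_i v) :=
  Function.update_eq_iff.2 ⟨rfl, fun a ha => by
    unfold mem; split <;> first | rfl | exact absurd rfl ha⟩

theorem upd_x : Function.update (mem K E st) 8 v = mem K E (st.set_x v) :=
  Function.update_eq_iff.2 ⟨rfl, fun a ha => by
    unfold mem; split <;> first | rfl | exact absurd rfl ha⟩

theorem upd_y : Function.update (mem K E st) 9 v = mem K E (st.set_y v) :=
  Function.update_eq_iff.2 ⟨rfl, fun a ha => by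
    unfold mem; split <;> first | rfl | exact absurd rfl ha⟩

theorem upd_mn : Function.update (mem K E st) 10 v = mem K E (st.set_mn v) :=
  Function.update_eq_iff.2 ⟨rfl, fun a ha => by
    unfold mem; split <;> first | rfl | exact absurd rfl ha⟩

theorem upd_j : Function.update (mem K E st) 11 v = mem K E (st.set_j v) :=
  Function.update_eq_iff.2 ⟨rfl, fun a ha => by
    unfold mem; split <;> first | rfl | exact absurd rfl ha⟩

theorem upd_w : Function.update (mem K E st) 12 v = mem K E (st.set_w v) :=
  Function.update_eq_iff.2 ⟨rfl, fun a ha => by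
    unfold mem; split <;> first | rfl | exact absurd rfl ha⟩

theorem upd_a : Function.update (mem K E st) 13 v = mem K E (st.set_a v) :=
  Function.update_eq_iff.2 ⟨rfl, fun a ha => by
    unfold mem; split <;> first | rfl | exact absurd rfl ha⟩

theorem upd_h : Function.update (mem K E st) 14 v = mem K E (st.set_h v) :=
  Function.update_eq_iff.2 ⟨rfl, fun a ha => by
    unfold mem; split <;> first | rfl | exact absurd rfl ha⟩

theorem upd_p : Function.update (mem K E st) 15 v = mem K E (st.set_p v) :=
  Function.update_eq_iff.2 ⟨rfl, fun a ha => by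
    unfold mem; split <;> first | rfl | exact absurd rfl ha⟩

theorem upd_g : Function.update (mem K E st) 16 v = mem K E (st.set_g v) :=
  Function.update_eq_iff.2 ⟨rfl, fun a ha => by
    unfold mem; split <;> first | rfl | exact absurd rfl ha⟩

theorem upd_b : Function.update (mem K E st) 17 v = mem K E (st.set_b v) :=
  Function.update_eq_iff.2 ⟨rfl, fun a ha => by
    unfold mem; split <;> first | rfl | exact absurd rfl ha⟩

theorem upd_u : Function.update (mem K E st) 18 v = mem K E (st.set_u v) :=
  Function.update_eq_iff.2 ⟨rfl, fun a ha => by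
    unfold mem; split <;> first | rfl | exact absurd rfl ha⟩

theorem upd_v : Function.update (mem K E st) 19 v = mem K E (st.set_v v) :=
  Function.update_eq_iff.2 ⟨rfl, fun a ha => by
    unfold mem; split <;> first | rfl | exact absurd rfl ha⟩

theorem upd_best : Function.update (mem K E st) 20 v = mem K E (st.set_best v) :=
  Function.update_eq_iff.2 ⟨rfl, fun a ha => by
    unfold mem; split <;> first | rfl | exact absurd rfl ha⟩

theorem upd_bi : Function.update (mem K E st) 21 v = mem K E (st.set_bi v) :=
  Function.update_eq_iff.2 ⟨rfl, fun a ha => by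
    unfold mem; split <;> first | rfl | exact absurd rfl ha⟩

theorem upd_S : Function.update (mem K E st) 22 v = mem K E (st.set_S v) :=
  Function.update_eq_iff.2 ⟨rfl, fun a ha => by
    unfold mem; split <;> first | rfl | exact absurd rfl ha⟩

theorem upd_N : Function.update (mem K E st) 23 v = mem K E (st.set_N v) :=
  Function.update_eq_iff.2 ⟨rfl, fun a ha => by
    unfold mem; split <;> first | rfl | exact absurd rfl ha⟩

theorem upd_z : Function.update (mem K E st) 24 v = mem K E (st.set_z v) :=
  Function.update_eq_iff.2 ⟨rfl, fun a ha => by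
    unfold mem; split <;> first | rfl | exact absurd rfl ha⟩

theorem upd_flag : Function.update (mem K E st) 25 v = mem K E (st.set_flag v) :=
  Function.update_eq_iff.2 ⟨rfl, fun a ha => by
    unfold mem; split <;> first | rfl | exact absurd rfl ha⟩

@[simp] theorem mem_n : mem K E st 0 = st.n := rfl
@[simp] theorem mem_k : mem K E st 1 = st.k := rfl
@[simp] theorem mem_t : mem K E st 2 = st.t := rfl
@[simp] theorem mem_s : mem K E st 3 = st.s := rfl
@[simp] theorem mem_q : mem K E st 4 = st.q := rfl
@[simp] theorem mem_am : mem K E st 5 = st.am := rfl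
@[simp] theorem mem_ad : mem K E st 6 = st.ad := rfl
@[simp] theorem mem_i : mem K E st 7 = st.i := rfl
@[simp] theorem mem_x : mem K E st 8 = st.x := rfl
@[simp] theorem mem_y : mem K E st 9 = st.y := rfl
@[simp] theorem mem_mn : mem K E st 10 = st.mn := rfl
@[simp] theorem mem_j : mem K E st 11 = st.j := rfl
@[simp] theorem mem_w : mem K E st 12 = st.w := rfl
@[simp] theorem mem_a : mem K E st 13 = st.a := rfl
@[simp] theorem mem_h : mem K E st 14 = st.h := rfl
@[simp] theorem mem_p : mem K E st 15 = st.p := rfl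
@[simp] theorem mem_g : mem K E st 16 = st.g := rfl
@[simp] theorem mem_b : mem K E st 17 = st.b := rfl
@[simp] theorem mem_u : mem K E st 18 = st.u := rfl
@[simp] theorem mem_v : mem K E st 19 = st.v := rfl
@[simp] theorem mem_best : mem K E st 20 = st.best := rfl
@[simp] theorem mem_bi : mem K E st 21 = st.bi := rfl
@[simp] theorem mem_S : mem K E st 22 = st.S := rfl
@[simp] theorem mem_N : mem K E st 23 = st.N := rfl
@[simp] theorem mem_z : mem K E st 24 = st.z := rfl
@[simp] theorem mem_flag : mem K E st 25 = st.flag := rfl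

theorem mem_E {a c : ℕ} (ha : a ≤ K) (hc : c = a + 26) : mem K E st c = E a := by
  subst hc
  change (if a ≤ K then E a else _) = E a
  rw [if_pos ha]

theorem mem_H {a c : ℕ} (hc : c = a + K + 27) : mem K E st c = st.H a := by
  subst hc
  change (if a + K + 1 ≤ K then _ else st.H (a + K + 1 - (K + 1))) = st.H a
  rw [if_neg (by omega)]
  congr 1
  omega

theorem upd_H {a c : ℕ} (hc : c = a + K + 27) :
    Function.update (mem K E st) c v = mem K E (st.set_H (Function.update st.H a v)) := by
  refine Function.update_eq_iff.2 ⟨?_, fun a' ha' => ?_⟩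
  · rw [mem_H K E _ hc]; simp [St.set_H]
  · by_cases h : a' < 26
    · unfold mem; split <;> first | rfl | omega
    · obtain ⟨d, rfl⟩ : ∃ d, a' = d + 26 := ⟨a' - 26, by omega⟩
      by_cases hd : d ≤ K
      · rw [mem_E K E _ hd rfl, mem_E K E _ hd rfl]
      · rw [mem_H K E _ (a := d - (K + 1)) (by omega), mem_H K E _ (a := d - (K + 1)) (by omega)]
        exact (Function.update_of_ne (by omega) _ _).symm

end Update

/-! ## Powers in fixed point arithmetic -/

/-- `a / 2 ^ s` approximates `x ^ p` from below with error at most `κ * Z ^ p / 2 ^ s`. -/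
def Apx (s : ℕ) (x Z : ℝ) (p : ℕ) (κ : ℝ) (a : ℤ) : Prop :=
  0 ≤ a ∧ (a : ℝ) ≤ x ^ p * 2 ^ s ∧ x ^ p * 2 ^ s ≤ a + κ * Z ^ p

theorem floor_shift (a : ℤ) (s : ℕ) :
    ((a / 2 ^ s : ℤ) : ℝ) * 2 ^ s ≤ a ∧ (a : ℝ) ≤ ((a / 2 ^ s : ℤ) : ℝ) * 2 ^ s + 2 ^ s := by
  have hp : (0 : ℤ) < 2 ^ s := by positivity
  have h1 := Int.ediv_mul_le a hp.ne'
  have h2 := Int.lt_ediv_add_one_mul_self a hp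
  constructor
  · exact_mod_cast h1
  · have : a ≤ a / 2 ^ s * 2 ^ s + 2 ^ s := by linarith
    exact_mod_cast this

theorem Apx.mul {s p q : ℕ} {x Z κ κ' : ℝ} {a b : ℤ} (hx : 0 ≤ x) (hxZ : x ≤ Z) (hZ : 1 ≤ Z)
    (hκ : 0 ≤ κ) (ha : Apx s x Z p κ a) (hb : Apx s x Z q κ' b) :
    Apx s x Z (p + q) (κ + κ' + 1) (a * b / 2 ^ s) := by
  obtain ⟨a0, a1, a2⟩ := ha
  obtain ⟨b0, b1, b2⟩ := hb
  obtain ⟨f1, f2⟩ := floor_shift (a * b) s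
  have hs : (0 : ℝ) < 2 ^ s := by positivity
  have a0' : (0 : ℝ) ≤ a := by exact_mod_cast a0
  have b0' : (0 : ℝ) ≤ b := by exact_mod_cast b0
  have hxp : 0 ≤ x ^ p := pow_nonneg hx p
  have hxq : 0 ≤ x ^ q := pow_nonneg hx q
  have hpZ : x ^ p ≤ Z ^ p := pow_le_pow_left₀ hx hxZ p
  have hqZ : x ^ q ≤ Z ^ q := pow_le_pow_left₀ hx hxZ q
  have hZp : 1 ≤ Z ^ p := one_le_pow₀ hZ
  have hZq : 1 ≤ Z ^ q := one_le_pow₀ hZ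
  refine ⟨Int.ediv_nonneg (mul_nonneg a0 b0) (by positivity), ?_, ?_⟩
  · refine le_of_mul_le_mul_right (f1.trans ?_) hs
    push_cast
    calc (a : ℝ) * b ≤ (x ^ p * 2 ^ s) * (x ^ q * 2 ^ s) := by gcongr
      _ = _ := by rw [pow_add]; ring
  · refine le_of_mul_le_mul_right (a := (2 : ℝ) ^ s) ?_ hs
    push_cast at f2
    have e1 : (x ^ p * 2 ^ s - a) * (x ^ q * 2 ^ s) ≤ κ * Z ^ p * (Z ^ q * 2 ^ s) := by
      have : x ^ p * 2 ^ s - a ≤ κ * Z ^ p := by linarith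
      exact mul_le_mul this (by gcongr) (by positivity) (by positivity)
    have e2 : (a : ℝ) * (x ^ q * 2 ^ s - b) ≤ (Z ^ p * 2 ^ s) * (κ' * Z ^ q) := by
      refine mul_le_mul (a1.trans (by gcongr)) (by linarith) (by linarith) (by positivity)
    have e3 : (2 : ℝ) ^ s ≤ Z ^ p * Z ^ q * 2 ^ s :=
      le_mul_of_one_le_left hs.le (one_le_mul_of_one_le_of_one_le hZp hZq)
    rw [pow_add, pow_add]
    nlinarith

theorem Apx.le {s p : ℕ} {x Z κ : ℝ} {a : ℤ} (hx : 0 ≤ x) (hxZ : x ≤ Z)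
    (ha : Apx s x Z p κ a) : (a : ℝ) ≤ Z ^ p * 2 ^ s :=
  ha.2.1.trans (by gcongr)

/-- Register operand. -/
abbrev rg (a : ℕ) : Operand := .reg a

/-- Constant operand. -/
abbrev cst (z : ℤ) : Operand := .const z

/-- `d := x`. -/
abbrev setReg (d : ℕ) (x : Operand) : Prog := .arith .add (.reg d) x (cst 0)

/-- One step of binary powering. -/
def powBody : Prog :=
  .seq (.arith .shr (.reg 18) (rg 16) (cst 1)) <|
  .seq (.arith .add (.reg 19) (rg 18) (rg 18)) <|
  .seq (.ite (rg 16) (rg 19) .skip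
    (.seq (.arith .mul (.reg 9) (rg 9) (rg 17)) (.arith .shr (.reg 9) (rg 9) (rg 3)))) <|
  .seq (.arith .mul (.reg 17) (rg 17) (rg 17)) <|
  .seq (.arith .shr (.reg 17) (rg 17) (rg 3)) <|
  setReg 16 (rg 18)

/-- Fixed point powering: `y := b ^ g`. -/
def powProg : Prog :=
  .seq (.arith .shl (.reg 9) (cst 1) (rg 3)) (.loop (cst 0) (rg 16) powBody)

theorem abs_le_pow_of_real {z : ℤ} {b : ℕ} {r : ℝ} (h0 : 0 ≤ z) (h : (z : ℝ) ≤ r)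
    (hr : r ≤ 2 ^ b) : |z| ≤ 2 ^ b := by
  rw [abs_of_nonneg h0]
  exact_mod_cast h.trans hr

section Pow

variable {O : ℕ → ℕ → ℤ} {bd K : ℕ} {E : ℕ → ℤ} {s : ℕ} {x Z : ℝ}

theorem powBody_runs (hx : 0 ≤ x) (hxZ : x ≤ Z) (hZ : 1 ≤ Z) (st : St) (γ p q : ℕ)
    (hγ : 0 < γ) (hs : st.s = s) (hg : st.g = γ) (hγb : (γ : ℤ) ≤ 2 ^ bd) (hq : 1 ≤ q)
    (hy : Apx s x Z p p st.y) (hb : Apx s x Z q (q - 1) st.b)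
    (hbd : Z ^ (2 * (p + q * γ)) * 2 ^ (2 * s) ≤ (2 : ℝ) ^ bd) :
    ∃ y' b' u' v' : ℤ, ∃ p' : ℕ, p' + (q + q) * (γ / 2) = p + q * γ ∧
      Runs O bd powBody (mem K E st)
        (mem K E {st with y := y', b := b', u := u', v := v', g := (γ / 2 : ℕ)}) 8 ∧
      Apx s x Z p' p' y' ∧ Apx s x Z (q + q) ((q + q : ℕ) - 1) b' := by
  have hb2 : Apx s x Z (q + q) ((q + q : ℕ) - 1) (st.b * st.b / 2 ^ s) := by
    have hq' : (1 : ℝ) ≤ q := by exact_mod_cast hq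
    have := hb.mul hx hxZ hZ (by linarith) hb
    convert this using 1
    push_cast; ring
  have hγ1 : q ≤ q * γ := Nat.le_mul_of_pos_right q hγ
  have c1 : |((γ / 2 : ℕ) : ℤ)| ≤ 2 ^ bd := by
    rw [abs_of_nonneg (by positivity)]
    exact le_trans (by exact_mod_cast Nat.div_le_self γ 2) hγb
  have c2 : |((γ / 2 : ℕ) : ℤ) + ((γ / 2 : ℕ) : ℤ)| ≤ 2 ^ bd := by
    rw [abs_of_nonneg (by positivity)]
    refine le_trans ?_ hγb
    exact_mod_cast (by omega : γ / 2 + γ / 2 ≤ γ)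
  have c3 : |st.b * st.b| ≤ 2 ^ bd := by
    refine abs_le_pow_of_real (mul_nonneg hb.1 hb.1) (r := Z ^ (2 * (p + q * γ)) * 2 ^ (2 * s))
      ?_ hbd
    push_cast
    have := hb.le hx hxZ
    have h0 : (0 : ℝ) ≤ st.b := by exact_mod_cast hb.1
    calc (st.b : ℝ) * st.b ≤ (Z ^ q * 2 ^ s) * (Z ^ q * 2 ^ s) := by gcongr
      _ = Z ^ (2 * q) * 2 ^ (2 * s) := by rw [two_mul, two_mul, pow_add, pow_add]; ring
      _ ≤ _ := by
        have : Z ^ (2 * q) ≤ Z ^ (2 * (p + q * γ)) := pow_le_pow_right₀ hZ (by omega)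
        gcongr
  have c4 : |st.b * st.b / 2 ^ s| ≤ 2 ^ bd := by
    rw [abs_of_nonneg hb2.1]
    refine (Int.ediv_le_self _ (mul_nonneg hb.1 hb.1)).trans ((le_abs_self _).trans c3)
  by_cases hpar : γ ≤ γ / 2 + γ / 2
  · refine ⟨st.y, _, (γ / 2 : ℕ), (γ / 2 : ℕ) + (γ / 2 : ℕ), p, ?_, ?_, hy, hb2⟩
    · have : γ = γ / 2 + γ / 2 := by omega
      nth_rw 2 [this]; ring
    · apply Runs.cast
      · apply Runs.seq (Runs.op c1 (upd_u K E _ _) (by simp [hg]))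
        apply Runs.seq (Runs.op c2 (upd_v K E _ _) (by simp))
        apply Runs.seq (Runs.ite_true (by simp [hg]; omega) Runs.skip)
        apply Runs.seq (Runs.op c3 (upd_b K E _ _) (by simp))
        apply Runs.seq (Runs.op c4 (upd_b K E _ _) (by simp [hs]))
        exact Runs.op c1 (upd_g K E _ _) (by simp)
      · norm_num
      · simp
  · have hy2 : Apx s x Z (p + q) ((p + q : ℕ)) (st.y * st.b / 2 ^ s) := by
      have := hy.mul hx hxZ hZ (by positivity) hb
      convert this using 1
      push_cast; ring
    have c5 : |st.y * st.b| ≤ 2 ^ bd := by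
      refine abs_le_pow_of_real (mul_nonneg hy.1 hb.1)
        (r := Z ^ (2 * (p + q * γ)) * 2 ^ (2 * s)) ?_ hbd
      push_cast
      have h1 := hb.le hx hxZ
      have h2 := hy.le hx hxZ
      have h0 : (0 : ℝ) ≤ st.b := by exact_mod_cast hb.1
      calc (st.y : ℝ) * st.b ≤ (Z ^ p * 2 ^ s) * (Z ^ q * 2 ^ s) := by gcongr
        _ = Z ^ (p + q) * 2 ^ (2 * s) := by rw [two_mul, pow_add, pow_add]; ring
        _ ≤ _ := by
          have : Z ^ (p + q) ≤ Z ^ (2 * (p + q * γ)) := pow_le_pow_right₀ hZ (by omega)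
          gcongr
    have c6 : |st.y * st.b / 2 ^ s| ≤ 2 ^ bd := by
      rw [abs_of_nonneg hy2.1]
      exact (Int.ediv_le_self _ (mul_nonneg hy.1 hb.1)).trans ((le_abs_self _).trans c5)
    refine ⟨_, _, (γ / 2 : ℕ), (γ / 2 : ℕ) + (γ / 2 : ℕ), p + q, ?_, ?_, hy2, hb2⟩
    · have : γ = γ / 2 + γ / 2 + 1 := by omega
      nth_rw 2 [this]; ring
    · apply Runs.cast
      · apply Runs.seq (Runs.op c1 (upd_u K E _ _) (by simp [hg]))
        apply Runs.seq (Runs.op c2 (upd_v K E _ _) (by simp))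
        apply Runs.seq (Runs.ite_false (by simp [hg]; omega) ((Runs.op c5 (upd_y K E _ _) (by simp)).seq
          (Runs.op c6 (upd_y K E _ _) (by simp [hs]))))
        apply Runs.seq (Runs.op c3 (upd_b K E _ _) (by simp))
        apply Runs.seq (Runs.op c4 (upd_b K E _ _) (by simp [hs]))
        exact Runs.op c1 (upd_g K E _ _) (by simp)
      · norm_num
      · simp

theorem powLoop_runs (hx : 0 ≤ x) (hxZ : x ≤ Z) (hZ : 1 ≤ Z) (γ : ℕ) :
    ∀ (st : St) (p q : ℕ), st.s = s → st.g = γ → (γ : ℤ) ≤ 2 ^ bd → 1 ≤ q →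
      Apx s x Z p p st.y → Apx s x Z q (q - 1) st.b →
      Z ^ (2 * (p + q * γ)) * 2 ^ (2 * s) ≤ (2 : ℝ) ^ bd →
    ∃ y' b' u' v' : ℤ,
      Runs O bd (.loop (cst 0) (rg 16) powBody) (mem K E st)
        (mem K E {st with y := y', b := b', u := u', v := v', g := 0}) (9 * γ.size + 1) ∧
      Apx s x Z (p + q * γ) ((p + q * γ : ℕ)) y' := by
  induction γ using Nat.strong_induction_on with
  | _ γ ih =>
    intro st p q hs hg hγb hq hy hb hbd
    rcases Nat.eq_zero_or_pos γ with rfl | hγ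
    · refine ⟨st.y, st.b, st.u, st.v, ?_, by simpa using hy⟩
      have h0 : st.g = 0 := by simpa using hg
      have : {st with y := st.y, b := st.b, u := st.u, v := st.v, g := 0} = st := by
        rw [← h0]
      rw [this]
      refine Runs.mono (Runs.loop_done ?_) (by simp)
      change ¬ (0 : ℤ) < st.g
      omega
    · obtain ⟨y1, b1, u1, v1, p1, hp1, r1, hy1, hb1⟩ :=
        powBody_runs (O := O) (K := K) (E := E) hx hxZ hZ st γ p q hγ hs hg hγb hq hy hb hbd
      obtain ⟨y2, b2, u2, v2, r2, hy2⟩ := ih (γ / 2) (by omega)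
        {st with y := y1, b := b1, u := u1, v := v1, g := (γ / 2 : ℕ)} p1 (q + q) hs rfl
        (le_trans (by exact_mod_cast Nat.div_le_self γ 2) hγb) (by omega) hy1 hb1
        (by rw [hp1]; exact hbd)
      rw [hp1] at hy2
      refine ⟨y2, b2, u2, v2, ?_, hy2⟩
      refine Runs.mono (Runs.loop_step ?_ r1 r2) ?_
      · change (0 : ℤ) < st.g
        omega
      · have : γ.size = (γ / 2).size + 1 := by
          rw [← Nat.div2_val]
          conv_lhs => rw [← Nat.bit_bodd_div2 γ]
          rw [Nat.size_bit]
          rw [Nat.bit_bodd_div2]; omega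
        omega

/-- Powering a fixed point number `st.b / 2 ^ s = x`. -/
theorem powProg_runs (hZ : 1 ≤ Z) (γ : ℕ) (st : St) (hs : st.s = s) (hg : st.g = γ)
    (hγb : (γ : ℤ) ≤ 2 ^ bd) (hsb : (2 : ℝ) ^ s ≤ 2 ^ bd) (hb : 0 ≤ st.b)
    (hbx : (st.b : ℝ) = x * 2 ^ s) (hxZ : x ≤ Z)
    (hbd : Z ^ (2 * γ) * 2 ^ (2 * s) ≤ (2 : ℝ) ^ bd) :
    ∃ y' b' u' v' : ℤ,
      Runs O bd powProg (mem K E st)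
        (mem K E {st with y := y', b := b', u := u', v := v', g := 0}) (9 * γ.size + 2) ∧
      Apx s x Z γ γ y' := by
  have hx : 0 ≤ x := by
    have : (0 : ℝ) ≤ x * 2 ^ s := by rw [← hbx]; exact_mod_cast hb
    exact nonneg_of_mul_nonneg_left this (by positivity)
  have h1 : Apx s x Z 0 ((0 : ℕ) : ℝ) (2 ^ s) := ⟨by positivity, by simp, by simp⟩
  have h2 : Apx s x Z 1 ((1 : ℕ) - 1 : ℝ) st.b := ⟨hb, by simp [hbx], by simp [hbx]⟩
  obtain ⟨y', b', u', v', r, hy⟩ := powLoop_runs (O := O) (bd := bd) (K := K) (E := E)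
    hx hxZ hZ γ {st with y := 2 ^ s} 0 1 hs hg hγb le_rfl h1 h2 (by simpa using hbd)
  refine ⟨y', b', u', v', ?_, by simpa using hy⟩
  refine Runs.mono (N := 1 + (9 * γ.size + 1)) (Runs.seq (Runs.op ?_ (upd_y K E _ _) ?_) r)
    (by omega)
  · rw [abs_of_nonneg (by positivity)]; exact_mod_cast hsb
  · change 1 * 2 ^ st.s.toNat = _
    rw [hs, one_mul]; rfl

end Pow

/-! ## Fractional derivatives of sparse polynomials -/

section Frac

open Polynomial Finset

/-- Coefficient of index `l` of the `a`-th fractional derivative. -/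
def fracCoeff (e : ℕ → ℕ) (c : ℕ → ℝ) (a l : ℕ) : ℝ := c l * ∏ i ∈ range a, ((e l : ℝ) - e i)

/-- The `a`-th fractional derivative of `∑ l < k, c l * x ^ e l`. -/
noncomputable def fracPoly (e : ℕ → ℕ) (c : ℕ → ℝ) (k a : ℕ) : ℝ[X] :=
  ∑ l ∈ Ico a k, C (fracCoeff e c a l) * X ^ (e l - e a)

/-- The value of the `a`-th fractional derivative. -/
def fracVal (e : ℕ → ℕ) (c : ℕ → ℝ) (k a : ℕ) (x : ℝ) : ℝ :=
  ∑ l ∈ Ico a k, fracCoeff e c a l * x ^ (e l - e a)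

variable {e : ℕ → ℕ} {c : ℕ → ℝ} {k : ℕ}

theorem eval_fracPoly (a : ℕ) (x : ℝ) : (fracPoly e c k a).eval x = fracVal e c k a x := by
  simp [fracPoly, fracVal, eval_finsetSum]

theorem fracCoeff_succ (a l : ℕ) :
    fracCoeff e c (a + 1) l = fracCoeff e c a l * ((e l : ℝ) - e a) := by
  simp [fracCoeff, prod_range_succ, mul_assoc]

theorem one_le_prod_sub (he : ∀ i j, i < j → j < k → e i < e j) {a l : ℕ} (hal : a ≤ l)
    (hl : l < k) : 1 ≤ ∏ i ∈ range a, ((e l : ℝ) - e i) := by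
  have : ∀ i ∈ range a, (1 : ℝ) ≤ (e l : ℝ) - e i := by
    intro i hi
    have := he i l (by have := mem_range.1 hi; omega) hl
    have : (e i : ℝ) + 1 ≤ e l := by exact_mod_cast this
    linarith
  calc (1 : ℝ) = ∏ i ∈ range a, 1 := by simp
    _ ≤ _ := prod_le_prod (fun _ _ => zero_le_one) this

theorem fracCoeff_ne_zero (he : ∀ i j, i < j → j < k → e i < e j) (hc : ∀ l < k, c l ≠ 0)
    {a l : ℕ} (hal : a ≤ l) (hl : l < k) : fracCoeff e c a l ≠ 0 :=
  mul_ne_zero (hc l hl) (by have := one_le_prod_sub he hal hl; linarith)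

theorem coeff_zero_fracPoly (he : ∀ i j, i < j → j < k → e i < e j) {a : ℕ} (ha : a < k) :
    (fracPoly e c k a).coeff 0 = fracCoeff e c a a := by
  rw [fracPoly, finsetSum_coeff, sum_eq_single a]
  · simp
  · intro l hl hla
    have h1 := mem_Ico.1 hl
    have := he a l (by omega) h1.2
    rw [coeff_C_mul, coeff_X_pow, if_neg (by omega), mul_zero]
  · intro h
    exact absurd (mem_Ico.2 ⟨le_rfl, ha⟩) h

theorem derivative_fracPoly (he : ∀ i j, i < j → j < k → e i < e j) {a : ℕ} (ha : a + 1 < k) :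
    derivative (fracPoly e c k a)
      = X ^ (e (a + 1) - e a - 1) * fracPoly e c k (a + 1) := by
  rw [fracPoly, derivative_sum, sum_eq_sum_Ico_succ_bot (by omega), fracPoly, mul_sum]
  simp only [derivative_C_mul_X_pow, tsub_self]
  rw [Nat.cast_zero, mul_zero, C_0, zero_mul, zero_add]
  refine sum_congr rfl fun l hl => ?_
  have h1 := mem_Ico.1 hl
  have h2 := he a (a + 1) (by omega) ha
  have h3 : e (a + 1) ≤ e l := by
    rcases Nat.eq_or_lt_of_le h1.1 with h | h
    · rw [← h]
    · exact (he _ _ h h1.2).le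
  have h4 : e l - e a - 1 = (e (a + 1) - e a - 1) + (e l - e (a + 1)) := by omega
  rw [h4, pow_add, fracCoeff_succ, Nat.cast_sub (by omega)]
  ring

theorem fracPoly_ne_zero (he : ∀ i j, i < j → j < k → e i < e j) (hc : ∀ l < k, c l ≠ 0)
    {a : ℕ} (ha : a < k) : fracPoly e c k a ≠ 0 := by
  intro h
  have := coeff_zero_fracPoly (c := c) he ha
  rw [h, coeff_zero] at this
  exact fracCoeff_ne_zero he hc le_rfl ha this.symm

theorem fracDeriv_fracPoly (he : ∀ i j, i < j → j < k → e i < e j) (hc : ∀ l < k, c l ≠ 0)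
    {a : ℕ} (ha : a + 1 < k) :
    fracDeriv (fracPoly e c k a) = fracPoly e c k (a + 1) := by
  have h0 := fracPoly_ne_zero he hc ha
  have h1 : (fracPoly e c k (a + 1)).natTrailingDegree = 0 := by
    refine natTrailingDegree_eq_zero.2 (Or.inr ?_)
    rw [coeff_zero_fracPoly he ha]
    exact fracCoeff_ne_zero he hc le_rfl ha
  rw [fracDeriv, derivative_fracPoly he ha]
  have h2 : (X ^ (e (a + 1) - e a - 1) * fracPoly e c k (a + 1)).natTrailingDegree
      = e (a + 1) - e a - 1 := by
    rw [mul_comm, natTrailingDegree_mul_X_pow h0, h1, zero_add]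
  rw [h2]
  exact mul_divByMonic_cancel_left _ (monic_X_pow _)

theorem iterate_fracDeriv (he : ∀ i j, i < j → j < k → e i < e j) (hc : ∀ l < k, c l ≠ 0)
    (a : ℕ) (ha : a < k) :
    fracDeriv^[a] (fracPoly e c k 0) = fracPoly e c k a := by
  induction a with
  | zero => rfl
  | succ a ih =>
    rw [Function.iterate_succ_apply', ih (by omega), fracDeriv_fracPoly he hc ha]

theorem card_roots_fracPoly (he : ∀ i j, i < j → j < k → e i < e j) (hc : ∀ l < k, c l ≠ 0)
    (d : ℕ) : ∀ a, a + d + 1 = k → (fracPoly e c k a).roots.toFinset.card ≤ 2 * d := by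
  induction d with
  | zero =>
    intro a ha
    have : Ico a k = {a} := by rw [← ha]; simp
    simp [fracPoly, this]
  | succ d ih =>
    intro a ha
    have h1 := ih (a + 1) (by omega)
    have h2 := card_roots_toFinset_le_derivative (fracPoly e c k a)
    have h0 : X ^ (e (a + 1) - e a - 1) * fracPoly e c k (a + 1) ≠ 0 :=
      mul_ne_zero (pow_ne_zero _ X_ne_zero) (fracPoly_ne_zero he hc (by omega))
    rw [derivative_fracPoly he (by omega)] at h2
    have h3 : (X ^ (e (a + 1) - e a - 1) * fracPoly e c k (a + 1)).roots.toFinset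
        ⊆ insert 0 (fracPoly e c k (a + 1)).roots.toFinset := by
      intro y hy
      rw [Multiset.mem_toFinset, mem_roots h0, IsRoot.def, eval_mul, eval_pow, eval_X,
        mul_eq_zero] at hy
      rw [mem_insert, Multiset.mem_toFinset, mem_roots (fracPoly_ne_zero he hc (by omega))]
      rcases hy with hy | hy
      · exact Or.inl (eq_zero_of_pow_eq_zero hy)
      · exact Or.inr hy
    have h4 := (card_le_card h3).trans (card_insert_le _ _)
    omega

theorem hasDerivAt_fracVal (he : ∀ i j, i < j → j < k → e i < e j) {a : ℕ} (ha : a + 1 < k)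
    (x : ℝ) : HasDerivAt (fracVal e c k a)
      (x ^ (e (a + 1) - e a - 1) * fracVal e c k (a + 1) x) x := by
  have h := (fracPoly e c k a).hasDerivAt x
  rw [derivative_fracPoly he ha, eval_mul, eval_pow, eval_X, eval_fracPoly] at h
  have h2 : (fun y => (fracPoly e c k a).eval y) = fracVal e c k a := by
    funext y; exact eval_fracPoly a y
  rwa [h2] at h

theorem continuous_fracVal (a : ℕ) : Continuous (fracVal e c k a) := by
  have h2 : (fun y => (fracPoly e c k a).eval y) = fracVal e c k a := by
    funext y; exact eval_fracPoly a y
  rw [← h2]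
  exact (fracPoly e c k a).continuous

/-! ## A point where all fractional derivatives are large -/

theorem pos_of_ne_zero_of_continuousOn {f : ℝ → ℝ} {s : Set ℝ} (hs : IsPreconnected s)
    (hf : ContinuousOn f s) (h0 : ∀ x ∈ s, f x ≠ 0) {y : ℝ} (hy : y ∈ s) (hpos : 0 < f y) :
    ∀ x ∈ s, 0 < f x := by
  intro x hx
  by_contra h
  obtain ⟨z, hz, hz0⟩ := hs.intermediate_value hx hy hf ⟨not_lt.1 h, hpos.le⟩
  exact h0 z hz hz0

theorem le_abs_of_le_abs_deriv {f f' : ℝ → ℝ} {y h m : ℝ} (hh : 0 < h) (hm : 0 < m)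
    (hd : ∀ ξ ∈ Set.Icc (y - h) (y + h), HasDerivAt f (f' ξ) ξ)
    (h0 : ∀ ξ ∈ Set.Icc (y - h) (y + h), f ξ ≠ 0)
    (hc : ContinuousOn f' (Set.Icc (y - h) (y + h)))
    (hf' : ∀ ξ ∈ Set.Icc (y - h) (y + h), m ≤ |f' ξ|) : h * m ≤ |f y| := by
  wlog hpos : 0 < f y generalizing f f'
  · have hy0 := h0 y ⟨by linarith, by linarith⟩
    have := this (f := fun x => -f x) (f' := fun x => -f' x) (fun ξ hξ => (hd ξ hξ).neg)
      (fun ξ hξ => neg_ne_zero.2 (h0 ξ hξ)) hc.neg (fun ξ hξ => by rw [abs_neg]; exact hf' ξ hξ)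
      (by have := lt_of_le_of_ne (not_lt.1 hpos) hy0; linarith)
    rwa [abs_neg] at this
  have hcf : ContinuousOn f (Set.Icc (y - h) (y + h)) :=
    fun ξ hξ => (hd ξ hξ).continuousAt.continuousWithinAt
  have hy : y ∈ Set.Icc (y - h) (y + h) := ⟨by linarith, by linarith⟩
  have hp := pos_of_ne_zero_of_continuousOn isPreconnected_Icc hcf h0 hy hpos
  have hf'0 : ∀ ξ ∈ Set.Icc (y - h) (y + h), f' ξ ≠ 0 := by
    intro ξ hξ h
    have := hf' ξ hξ
    rw [h, abs_zero] at this
    linarith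
  rw [abs_of_pos hpos]
  rcases lt_or_gt_of_ne (hf'0 y hy) with hneg | hneg
  · have hn := pos_of_ne_zero_of_continuousOn (f := fun x => -f' x) isPreconnected_Icc hc.neg
      (fun ξ hξ => neg_ne_zero.2 (hf'0 ξ hξ)) hy (by linarith)
    obtain ⟨ξ, hξ, hs⟩ := exists_hasDerivAt_eq_slope f f' (by linarith : y < y + h)
      (hcf.mono (Set.Icc_subset_Icc_left (by linarith)))
      (fun ξ hξ => hd ξ ⟨by linarith [hξ.1], hξ.2.le⟩)
    have hξ' : ξ ∈ Set.Icc (y - h) (y + h) := ⟨by linarith [hξ.1], hξ.2.le⟩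
    have h1 := hf' ξ hξ'
    have h2 := hn ξ hξ'
    rw [abs_of_neg (by linarith)] at h1
    have h3 := hp (y + h) ⟨by linarith, le_rfl⟩
    rw [eq_div_iff (by linarith)] at hs
    nlinarith
  · have hn := pos_of_ne_zero_of_continuousOn isPreconnected_Icc hc hf'0 hy hneg
    obtain ⟨ξ, hξ, hs⟩ := exists_hasDerivAt_eq_slope f f' (by linarith : y - h < y)
      (hcf.mono (Set.Icc_subset_Icc_right (by linarith)))
      (fun ξ hξ => hd ξ ⟨hξ.1.le, by linarith [hξ.2]⟩)
    have hξ' : ξ ∈ Set.Icc (y - h) (y + h) := ⟨hξ.1.le, by linarith [hξ.2]⟩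
    have h1 := hf' ξ hξ'
    have h2 := hn ξ hξ'
    rw [abs_of_pos h2] at h1
    have h3 := hp (y - h) ⟨le_rfl, by linarith⟩
    rw [eq_div_iff (by linarith)] at hs
    nlinarith

theorem exists_rootFree (he : ∀ i j, i < j → j < k → e i < e j) (hc : ∀ l < k, c l ≠ 0)
    (hk : 1 ≤ k) {t : ℕ} (ht : k ^ 2 ≤ t) {x₀ δ : ℝ} (hδ : 0 < δ) :
    ∃ i, 1 ≤ i ∧ i ≤ 2 * t ∧ ∀ a < k, ∀ y, |y - (x₀ + i * δ)| < δ / 2 →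
      fracVal e c k a y ≠ 0 := by
  by_contra! hcon
  have hcon' : ∀ i : ℕ, ∃ y, i ∈ Icc 1 (2 * t) →
      (∃ a < k, fracVal e c k a y = 0) ∧ |y - (x₀ + i * δ)| < δ / 2 := by
    intro i
    by_cases hi : i ∈ Icc 1 (2 * t)
    · obtain ⟨a, ha, y, hy, h0⟩ := hcon i (mem_Icc.1 hi).1 (mem_Icc.1 hi).2
      exact ⟨y, fun _ => ⟨⟨a, ha, h0⟩, hy⟩⟩
    · exact ⟨0, fun h => absurd h hi⟩
  choose r hr using hcon'
  have hmap : Set.MapsTo r (Icc 1 (2 * t) : Finset ℕ)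
      ((range k).biUnion fun a => (fracPoly e c k a).roots.toFinset : Finset ℝ) := by
    intro i hi
    obtain ⟨⟨a, ha, h0⟩, -⟩ := hr i hi
    rw [mem_coe, mem_biUnion]
    refine ⟨a, mem_range.2 ha, ?_⟩
    rw [Multiset.mem_toFinset, mem_roots (fracPoly_ne_zero he hc ha), IsRoot.def, eval_fracPoly]
    exact h0
  have hinj : Set.InjOn r (Icc 1 (2 * t) : Finset ℕ) := by
    intro i hi j hj hij
    have h1 := abs_lt.1 (hr i hi).2
    have h2 := abs_lt.1 (hr j hj).2
    rw [hij] at h1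
    by_contra hne
    rcases lt_or_gt_of_ne hne with h | h
    · have : (i : ℝ) + 1 ≤ j := by exact_mod_cast h
      nlinarith
    · have : (j : ℝ) + 1 ≤ i := by exact_mod_cast h
      nlinarith
  have h1 := card_le_card_of_injOn r hmap hinj
  have h2 := card_biUnion_le_card_mul (range k) (fun a => (fracPoly e c k a).roots.toFinset)
    (2 * (k - 1)) (fun a ha => by
      have ha := mem_range.1 ha
      exact (card_roots_fracPoly he hc (k - 1 - a) a (by omega)).trans (by omega))
  rw [Nat.card_Icc, card_range] at *
  have : k * (2 * (k - 1)) < 2 * k ^ 2 := by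
    obtain ⟨m, rfl⟩ : ∃ m, k = m + 1 := ⟨k - 1, by omega⟩
    simp only [Nat.add_sub_cancel]
    nlinarith
  omega

end Frac

section LowerBound

open Finset

/-- Size assumptions on a sparse polynomial, in terms of one natural number `lam`. -/
structure Sized (n k lam : ℕ) (e : ℕ → ℕ) (c : ℕ → ℝ) : Prop where
  two_le : 2 ≤ k
  lt : ∀ i j, i < j → j < k → e i < e j
  exp_le : ∀ l < k, e l ≤ n
  one_le : 1 ≤ n
  pow_le : (n : ℝ) ^ k ≤ 2 ^ lam
  le_abs : ∀ l < k, ((2 : ℝ) ^ lam)⁻¹ ≤ |c l|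
  abs_le : ∀ l < k, |c l| ≤ 2 ^ lam
  k_le : (k : ℝ) ≤ 2 ^ lam

variable {n k lam : ℕ} {e : ℕ → ℕ} {c : ℕ → ℝ}

theorem Sized.ne_zero (h : Sized n k lam e c) : ∀ l < k, c l ≠ 0 := by
  intro l hl h0
  have := h.le_abs l hl
  rw [h0, abs_zero] at this
  have : (0 : ℝ) < ((2 : ℝ) ^ lam)⁻¹ := by positivity
  linarith

theorem Sized.mono (h : Sized n k lam e c) {i j : ℕ} (hij : i ≤ j) (hj : j < k) : e i ≤ e j := by
  rcases Nat.eq_or_lt_of_le hij with h' | h'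
  · rw [h']
  · exact (h.lt _ _ h' hj).le

theorem Sized.prod_le (h : Sized n k lam e c) {a l : ℕ} (hal : a ≤ l) (hl : l < k) :
    ∏ i ∈ range a, ((e l : ℝ) - e i) ≤ (n : ℝ) ^ k := by
  have h1 : ∏ i ∈ range a, ((e l : ℝ) - e i) ≤ ∏ i ∈ range a, (n : ℝ) := by
    refine prod_le_prod ?_ ?_
    · intro i hi
      have := h.mono (by have := mem_range.1 hi; omega : i ≤ l) hl
      have : (e i : ℝ) ≤ e l := by exact_mod_cast this
      linarith
    · intro i hi
      have : (e l : ℝ) ≤ n := by exact_mod_cast h.exp_le l hl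
      have : (0 : ℝ) ≤ e i := by positivity
      linarith
  rw [prod_const, card_range] at h1
  exact h1.trans (pow_le_pow_right₀ (by exact_mod_cast h.one_le) (by omega))

theorem Sized.coeff_le (h : Sized n k lam e c) {a l : ℕ} (hal : a ≤ l) (hl : l < k) :
    |fracCoeff e c a l| ≤ 2 ^ (2 * lam) := by
  have h1 := one_le_prod_sub h.lt hal hl
  rw [fracCoeff, abs_mul, abs_of_nonneg (a := ∏ i ∈ range a, ((e l : ℝ) - e i)) (by linarith),
    two_mul, pow_add]
  exact mul_le_mul (h.abs_le l hl) ((h.prod_le hal hl).trans h.pow_le) (by linarith)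
    (by positivity)

theorem Sized.le_coeff (h : Sized n k lam e c) {a l : ℕ} (hal : a ≤ l) (hl : l < k) :
    ((2 : ℝ) ^ lam)⁻¹ ≤ |fracCoeff e c a l| := by
  have h1 := one_le_prod_sub h.lt hal hl
  rw [fracCoeff, abs_mul, abs_of_nonneg (a := ∏ i ∈ range a, ((e l : ℝ) - e i)) (by linarith)]
  exact (h.le_abs l hl).trans (le_mul_of_one_le_right (abs_nonneg _) h1)

theorem Sized.le_abs_of_small (h : Sized n k lam e c) {a : ℕ} (ha : a + 1 < k) {y : ℝ}
    (hy0 : 0 < y) (hy1 : y ≤ 1) (hy : y ^ (e (a + 1) - e a) ≤ ((2 : ℝ) ^ (4 * lam + 1))⁻¹) :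
    ((2 : ℝ) ^ (lam + 1))⁻¹ ≤ |fracVal e c k a y| := by
  have h1 : fracVal e c k a y = fracCoeff e c a a
      + ∑ l ∈ Ico (a + 1) k, fracCoeff e c a l * y ^ (e l - e a) := by
    rw [fracVal, sum_eq_sum_Ico_succ_bot (by omega)]
    simp
  have h2 : |∑ l ∈ Ico (a + 1) k, fracCoeff e c a l * y ^ (e l - e a)|
      ≤ ∑ l ∈ Ico (a + 1) k, (2 : ℝ) ^ (2 * lam) * ((2 : ℝ) ^ (4 * lam + 1))⁻¹ := by
    refine (abs_sum_le_sum_abs _ _).trans (sum_le_sum fun l hl => ?_)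
    have hl := mem_Ico.1 hl
    rw [abs_mul, abs_of_nonneg (a := y ^ _) (by positivity)]
    refine mul_le_mul (h.coeff_le (by omega) hl.2) ?_ (by positivity) (by positivity)
    refine le_trans (pow_le_pow_of_le_one hy0.le hy1 ?_) hy
    have := h.mono hl.1 hl.2
    omega
  rw [sum_const, Nat.card_Ico, nsmul_eq_mul] at h2
  have h3 : ((k - (a + 1) : ℕ) : ℝ) ≤ 2 ^ lam :=
    le_trans (by exact_mod_cast (by omega : k - (a + 1) ≤ k)) h.k_le
  have h4 := h.le_coeff le_rfl (by omega : a < k)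
  have h5 : ((k - (a + 1) : ℕ) : ℝ) * ((2 : ℝ) ^ (2 * lam) * ((2 : ℝ) ^ (4 * lam + 1))⁻¹)
      ≤ 2 ^ lam * ((2 : ℝ) ^ (2 * lam) * ((2 : ℝ) ^ (4 * lam + 1))⁻¹) := by gcongr
  have h6 : (2 : ℝ) ^ lam * ((2 : ℝ) ^ (2 * lam) * ((2 : ℝ) ^ (4 * lam + 1))⁻¹)
      = ((2 : ℝ) ^ (lam + 1))⁻¹ := by
    have : (2 : ℝ) ^ (4 * lam + 1) = 2 ^ lam * 2 ^ (2 * lam) * 2 ^ (lam + 1) := by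
      rw [← pow_add, ← pow_add]; congr 1; ring
    rw [this]; field_simp
  have h7 : ((2 : ℝ) ^ lam)⁻¹ = ((2 : ℝ) ^ (lam + 1))⁻¹ + ((2 : ℝ) ^ (lam + 1))⁻¹ := by
    rw [pow_succ]; field_simp; norm_num
  have h8 := abs_sub_abs_le_abs_sub (fracCoeff e c a a)
    (-∑ l ∈ Ico (a + 1) k, fracCoeff e c a l * y ^ (e l - e a))
  rw [sub_neg_eq_add, ← h1, abs_neg] at h8
  linarith

theorem half_pow_le (g n : ℕ) (hn : 1 ≤ n) (hg : g ≤ n) {y ξ : ℝ} (hy : 0 < y)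
    (hξ : y * (1 - 1 / (2 * n)) ≤ ξ) : y ^ g / 2 ≤ ξ ^ g := by
  have hn' : (1 : ℝ) ≤ n := by exact_mod_cast hn
  have hg' : (g : ℝ) ≤ n := by exact_mod_cast hg
  have h0 : (1 : ℝ) / (2 * n) ≤ 1 / 2 := by
    rw [div_le_div_iff₀ (by positivity) (by norm_num)]; linarith
  have h1 := one_add_mul_le_pow (a := -(1 / (2 * (n : ℝ)))) (by linarith) g
  have h2 : (g : ℝ) * (1 / (2 * n)) ≤ 1 / 2 := by
    rw [mul_one_div, div_le_div_iff₀ (by positivity) (by norm_num)]; linarith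
  have h3 : (1 : ℝ) / 2 ≤ (1 - 1 / (2 * n)) ^ g := by
    rw [← sub_eq_add_neg] at h1; linarith
  calc y ^ g / 2 = y ^ g * (1 / 2) := by ring
    _ ≤ y ^ g * (1 - 1 / (2 * n)) ^ g := by gcongr
    _ = (y * (1 - 1 / (2 * n))) ^ g := by rw [mul_pow]
    _ ≤ ξ ^ g := pow_le_pow_left₀ (mul_nonneg hy.le (by linarith)) hξ g

theorem Sized.le_abs_fracVal (h : Sized n k lam e c) {x δ : ℝ} (hδ : 0 < δ) (hxδ : δ ≤ x)
    (hδl : ((2 : ℝ) ^ lam)⁻¹ ≤ δ)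
    (h0 : ∀ a < k, ∀ y, |y - x| < δ / 2 → fracVal e c k a y ≠ 0) (d : ℕ) :
    ∀ a, a + d + 1 = k → ∀ y, |y - x| ≤ δ / (4 * k * n) * a →
      (((2 : ℝ) ^ (7 * lam + 4)) ^ (d + 1))⁻¹ ≤ |fracVal e c k a y| := by
  have hk : (2 : ℝ) ≤ k := by exact_mod_cast h.two_le
  have hn : (1 : ℝ) ≤ n := by exact_mod_cast h.one_le
  set r : ℝ := δ / (4 * k * n) with hr
  have hr0 : 0 < r := by positivity
  have hrk : r * k = δ / (4 * n) := by rw [hr]; field_simp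
  have hrk' : r * k ≤ δ / 4 := by
    rw [hrk]; exact div_le_div_of_nonneg_left hδ.le (by norm_num) (by linarith)
  have hone : (1 : ℝ) ≤ 2 ^ (7 * lam + 4) := one_le_pow₀ (by norm_num)
  have hrl : ((2 : ℝ) ^ (3 * lam + 2))⁻¹ ≤ r := by
    have e1 : (n : ℝ) ≤ 2 ^ lam := by
      refine le_trans ?_ h.pow_le
      exact le_self_pow₀ hn (by have := h.two_le; omega)
    have e2 : (4 : ℝ) * k * n ≤ 2 ^ 2 * 2 ^ lam * 2 ^ lam := by
      have := h.k_le
      norm_num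
      gcongr
    have e3 : (2 : ℝ) ^ (3 * lam + 2) = 2 ^ lam * (2 ^ 2 * 2 ^ lam * 2 ^ lam) := by
      rw [← pow_add, ← pow_add, ← pow_add]; congr 1; ring
    rw [e3, mul_inv, hr, div_eq_mul_inv]
    gcongr
  induction d with
  | zero =>
    intro a ha y _
    have : Ico a k = {a} := by rw [← ha]; simp
    rw [fracVal, this, sum_singleton, tsub_self, pow_zero, mul_one]
    refine le_trans ?_ (h.le_coeff le_rfl (by omega))
    rw [zero_add, pow_one]
    exact inv_anti₀ (by positivity) (pow_le_pow_right₀ (by norm_num) (by omega))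
  | succ d ih =>
    intro a ha y hy
    have ha' : (a : ℝ) + 1 ≤ k := by exact_mod_cast (by omega : a + 1 ≤ k)
    have hyx := _root_.abs_le.1 hy
    have hra : r * a + r ≤ δ / 4 := by
      have : r * (a + 1) ≤ r * k := by gcongr
      linarith
    have hyδ : δ / 2 ≤ y := by linarith
    have hy0 : 0 < y := by linarith
    have he := h.lt a (a + 1) (by omega) (by omega)
    by_cases hs : y ≤ 1 ∧ y ^ (e (a + 1) - e a) ≤ ((2 : ℝ) ^ (4 * lam + 1))⁻¹
    · refine le_trans ?_ (h.le_abs_of_small (by omega) hy0 hs.1 hs.2)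
      refine inv_anti₀ (by positivity) ?_
      calc (2 : ℝ) ^ (lam + 1) ≤ 2 ^ (7 * lam + 4) :=
            pow_le_pow_right₀ (by norm_num) (by omega)
        _ ≤ _ := le_self_pow₀ hone (by omega)
    · have hyg : ((2 : ℝ) ^ (4 * lam + 1))⁻¹ ≤ y ^ (e (a + 1) - e a - 1) := by
        by_cases hy1 : y ≤ 1
        · have := lt_of_not_ge fun hh => hs ⟨hy1, hh⟩
          refine this.le.trans (pow_le_pow_of_le_one hy0.le hy1 (by omega))
        · refine le_trans ?_ (one_le_pow₀ (by linarith))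
          exact inv_le_one_of_one_le₀ (one_le_pow₀ (by norm_num))
      have hmain := le_abs_of_le_abs_deriv (f := fracVal e c k a)
        (f' := fun ξ => ξ ^ (e (a + 1) - e a - 1) * fracVal e c k (a + 1) ξ) (y := y) (h := r)
        (m := ((2 : ℝ) ^ (4 * lam + 2))⁻¹ * (((2 : ℝ) ^ (7 * lam + 4)) ^ (d + 1))⁻¹) hr0
        (by positivity) (fun ξ _ => hasDerivAt_fracVal h.lt (by omega) ξ)
        (fun ξ hξ => h0 a (by omega) ξ (abs_lt.2 ⟨by linarith [hξ.1], by linarith [hξ.2]⟩))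
        (((continuous_pow _).mul (continuous_fracVal _)).continuousOn) (by
          intro ξ hξ
          have h1 := ih (a + 1) (by omega) ξ (by
            push_cast
            rw [mul_add, mul_one]
            exact _root_.abs_le.2 ⟨by linarith [hξ.1], by linarith [hξ.2]⟩)
          have h2 : y ^ (e (a + 1) - e a - 1) / 2 ≤ ξ ^ (e (a + 1) - e a - 1) := by
            refine half_pow_le _ n h.one_le ?_ hy0 ?_
            · have := h.exp_le (a + 1) (by omega); omega
            · refine le_trans ?_ hξ.1
              have : r ≤ y * (1 / (2 * n)) := by
                rw [hr, mul_one_div, div_le_div_iff₀ (by positivity) (by positivity)]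
                calc δ * (2 * n) ≤ 2 * y * (2 * n) := by gcongr; linarith
                  _ = y * (4 * 1 * n) := by ring
                  _ ≤ y * (4 * k * n) := by gcongr; linarith
              linarith
          have h3 : (0 : ℝ) ≤ ξ ^ (e (a + 1) - e a - 1) := le_trans (by positivity) h2
          rw [abs_mul, abs_of_nonneg h3]
          refine mul_le_mul ?_ h1 (by positivity) h3
          refine le_trans ?_ h2
          rw [pow_succ, mul_inv]
          linarith)
      refine le_trans ?_ hmain
      have e1 : (((2 : ℝ) ^ (7 * lam + 4)) ^ (d + 1 + 1))⁻¹ = ((2 : ℝ) ^ (3 * lam + 2))⁻¹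
          * (((2 : ℝ) ^ (4 * lam + 2))⁻¹ * (((2 : ℝ) ^ (7 * lam + 4)) ^ (d + 1))⁻¹) := by
        have e2 : (2 : ℝ) ^ (7 * lam + 4) = 2 ^ (3 * lam + 2) * 2 ^ (4 * lam + 2) := by
          rw [← pow_add]; congr 1; ring
        rw [pow_succ _ (d + 1), ← mul_inv, ← mul_inv]
        nth_rw 2 [e2]
        congr 1; ring
      rw [e1]
      gcongr

theorem Sized.exists_large (h : Sized n k lam e c) {t : ℕ} (ht : k ^ 2 ≤ t) {x₀ δ : ℝ}
    (hδ : 0 < δ) (hx₀ : 0 < x₀) (hδl : ((2 : ℝ) ^ lam)⁻¹ ≤ δ) :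
    ∃ i ≤ 2 * t, ∀ a < k, ((2 : ℝ) ^ (k * (7 * lam + 4)))⁻¹ ≤ |fracVal e c k a (x₀ + i * δ)| := by
  obtain ⟨i, hi1, hi2, hi⟩ := exists_rootFree h.lt h.ne_zero (by have := h.two_le; omega) ht
    (x₀ := x₀) hδ
  refine ⟨i, hi2, fun a ha => ?_⟩
  have hi' : (1 : ℝ) ≤ i := by exact_mod_cast hi1
  have h1 := h.le_abs_fracVal hδ (x := x₀ + i * δ) (by nlinarith) hδl hi (k - 1 - a) a (by omega)
    (x₀ + i * δ) (by rw [sub_self, abs_zero]; positivity)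
  refine le_trans (inv_anti₀ (by positivity) ?_) h1
  rw [← pow_mul]
  refine pow_le_pow_right₀ (by norm_num) ?_
  rw [mul_comm]
  exact Nat.mul_le_mul_right _ (by omega)

end LowerBound

/-! ## Simultaneous Horner evaluation of the fractional derivatives -/

/-- One step of the inner loop: `H a := H a * y + w`, `w := w * (e (j - 1) - e a)`. -/
def hornerBody : Prog :=
  .seq (.arith .add (.reg 15) (rg 13) (rg 1)) <|
  .seq (.arith .add (.reg 15) (rg 15) (cst 27)) <|
  .seq (.arith .mul (.reg 14) (.ind 15) (rg 9)) <|
  .seq (.arith .shr (.reg 14) (rg 14) (rg 3)) <|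
  .seq (.arith .add (.reg 14) (rg 14) (rg 12)) <|
  .seq (.arith .add (.ind 15) (rg 14) (cst 0)) <|
  .seq (.arith .add (.reg 15) (rg 11) (cst 26)) <|
  .seq (setReg 18 (.ind 15)) <|
  .seq (.arith .add (.reg 15) (rg 13) (cst 27)) <|
  .seq (.arith .sub (.reg 18) (rg 18) (.ind 15)) <|
  .seq (.arith .mul (.reg 12) (rg 12) (rg 18)) <|
  .arith .add (.reg 13) (rg 13) (cst 1)

/-- The inner loop. -/
def hornerLoop : Prog := .loop (rg 13) (rg 11) hornerBody

section Horner

variable {O : ℕ → ℕ → ℤ} {bd K : ℕ} {E : ℕ → ℤ} {s : ℕ}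

theorem val_ind_H (st : St) {a r : ℕ} (h : mem K E st r = a + K + 27) :
    (Operand.ind r).val (mem K E st) = st.H a := by
  change mem K E st (mem K E st r).toNat = _
  refine mem_H K E st ?_
  rw [h]; omega

theorem val_ind_E (st : St) {a r : ℕ} (h : mem K E st r = a + 26) (ha : a ≤ K) :
    (Operand.ind r).val (mem K E st) = E a := by
  change mem K E st (mem K E st r).toNat = _
  refine mem_E K E st ha ?_
  rw [h]; omega

theorem hornerBody_runs (st : St) (J a : ℕ) (w' : ℤ) (haJ : a ≤ J) (hJ : J < K) (hs : st.s = s)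
    (hk : st.k = K) (hj : st.j = J + 1) (ha : st.a = a)
    (hw : st.w * (E (J + 1) - E (a + 1)) = w') (hwb : |w'| ≤ 2 ^ bd)
    (hKb : (3 * K + 64 : ℤ) ≤ 2 ^ bd)
    (hE : ∀ i ≤ K, |E i| ≤ 2 ^ bd) (hEd : |E (J + 1) - E (a + 1)| ≤ 2 ^ bd)
    (hH : |st.H a * st.y| ≤ 2 ^ bd) (hH' : |st.H a * st.y / 2 ^ s + st.w| ≤ 2 ^ bd) :
    ∃ p' u' : ℤ, Runs O bd hornerBody (mem K E st)
      (mem K E {st with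
        H := Function.update st.H a (st.H a * st.y / 2 ^ s + st.w)
        h := st.H a * st.y / 2 ^ s + st.w
        w := w', a := (a + 1 : ℕ), p := p', u := u'}) 12 := by
  have hJ' : (J : ℤ) < K := by exact_mod_cast hJ
  have haJ' : (a : ℤ) ≤ J := by exact_mod_cast haJ
  have c0 : |(a : ℤ) + K| ≤ 2 ^ bd := by rw [abs_of_nonneg (by positivity)]; omega
  have c1 : |(a : ℤ) + K + 27| ≤ 2 ^ bd := by rw [abs_of_nonneg (by positivity)]; omega
  have c2 : |(J : ℤ) + 1 + 26| ≤ 2 ^ bd := by rw [abs_of_nonneg (by positivity)]; omega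
  have c3 : |(a : ℤ) + 27| ≤ 2 ^ bd := by rw [abs_of_nonneg (by positivity)]; omega
  have c4 : |((a + 1 : ℕ) : ℤ)| ≤ 2 ^ bd := by
    rw [abs_of_nonneg (by positivity)]; push_cast; omega
  have c5 : |st.H a * st.y / 2 ^ s| ≤ 2 ^ bd := by
    refine le_trans ?_ hH
    rw [abs_le]
    have hp : (1 : ℤ) ≤ 2 ^ s := one_le_pow₀ (by norm_num)
    have h1 := neg_abs_le (st.H a * st.y)
    have h2 := le_abs_self (st.H a * st.y)
    have h3 := abs_nonneg (st.H a * st.y)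
    constructor
    · refine (Int.le_ediv_iff_mul_le (by omega)).2 ?_
      nlinarith
    · refine Int.ediv_le_of_le_mul (by omega) ?_
      nlinarith
  refine ⟨a + 27, E (J + 1) - E (a + 1), ?_⟩
  apply Runs.cast
  · apply Runs.seq (Runs.op c0 (upd_p K E _ _) (by simp [ha, hk]))
    apply Runs.seq (Runs.op c1 (upd_p K E _ _) (by simp))
    apply Runs.seq (Runs.op hH (upd_h K E _ _) (by
      rw [ArithOp.eval, val_ind_H _ (a := a) (by simp)]; simp))
    apply Runs.seq (Runs.op c5 (upd_h K E _ _) (by simp [hs]))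
    apply Runs.seq (Runs.op hH' (upd_h K E _ _) (by simp))
    apply Runs.seq (Runs.op hH' (upd_H K E _ _ (a := a) (by simp; omega)) (by simp))
    apply Runs.seq (Runs.op c2 (upd_p K E _ _) (by simp [hj]))
    apply Runs.seq (Runs.op (hE (J + 1) (by omega)) (upd_u K E _ _) (by
      rw [ArithOp.eval, val_ind_E _ (a := J + 1) (by simp) (by omega)]; simp))
    apply Runs.seq (Runs.op c3 (upd_p K E _ _) (by simp [ha]))
    apply Runs.seq (Runs.op hEd (upd_u K E _ _) (by
      rw [ArithOp.eval, val_ind_E _ (a := a + 1) (by simp; ring) (by omega)]; simp))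
    apply Runs.seq (Runs.op hwb (upd_w K E _ _) (by simpa using hw))
    exact Runs.op c4 (upd_a K E _ _) (by simp [ha])
  · norm_num
  · simp

theorem hornerLoop_runs (J : ℕ) (W : ℕ → ℤ) (hJ : J < K)
    (hW : ∀ a ≤ J, W a * (E (J + 1) - E (a + 1)) = W (a + 1))
    (hWb : ∀ a ≤ J + 1, |W a| ≤ 2 ^ bd) (hKb : (3 * K + 64 : ℤ) ≤ 2 ^ bd)
    (hE : ∀ i ≤ K, |E i| ≤ 2 ^ bd) (hEd : ∀ a ≤ J, |E (J + 1) - E (a + 1)| ≤ 2 ^ bd) (d : ℕ) :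
    ∀ (st : St) (a : ℕ), a + d = J + 1 → st.s = s → st.k = K → st.j = J + 1 → st.a = a →
      st.w = W a → (∀ i, a ≤ i → i ≤ J → |st.H i * st.y| ≤ 2 ^ bd) →
      (∀ i, a ≤ i → i ≤ J → |st.H i * st.y / 2 ^ s + W i| ≤ 2 ^ bd) →
    ∃ (p' u' h' : ℤ) (H' : ℕ → ℤ), Runs O bd hornerLoop (mem K E st)
      (mem K E {st with H := H', h := h', w := W (J + 1), a := (J + 1 : ℕ), p := p', u := u'})
      (13 * d + 1) ∧
      (∀ i, a ≤ i → i ≤ J → H' i = st.H i * st.y / 2 ^ s + W i) ∧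
      (∀ i < a, H' i = st.H i) ∧
      h' = if d = 0 then st.h else st.H J * st.y / 2 ^ s + W J := by
  induction d with
  | zero =>
    intro st a had hs hk hj ha hw hH hH'
    refine ⟨st.p, st.u, st.h, st.H, ?_, fun i h1 h2 => by omega, fun _ _ => rfl, rfl⟩
    apply Runs.cast
    · exact Runs.loop_done (by simp [ha, hj]; omega)
    · omega
    · have : a = J + 1 := by omega
      subst this
      congr 1
      rw [← ha, ← hw]
  | succ d ih =>
    intro st a had hs hk hj ha hw hH hH'
    obtain ⟨p1, u1, r1⟩ := hornerBody_runs (O := O) (bd := bd) (s := s) st J a (W (a + 1))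
      (by omega) hJ hs
      hk hj ha (by rw [hw]; exact hW a (by omega)) (hWb _ (by omega)) hKb hE
      (hEd a (by omega)) (hH a le_rfl (by omega)) (by rw [hw]; exact hH' a le_rfl (by omega))
    obtain ⟨p2, u2, h2, H2, r2, q1, q2, q3⟩ := ih {st with
        H := Function.update st.H a (st.H a * st.y / 2 ^ s + st.w)
        h := st.H a * st.y / 2 ^ s + st.w
        w := W (a + 1), a := (a + 1 : ℕ), p := p1, u := u1} (a + 1) (by omega) hs hk hj rfl rfl
      (by
        intro i h1 h2
        simp only [Function.update_of_ne (show i ≠ a by omega)]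
        exact hH i (by omega) h2)
      (by
        intro i h1 h2
        simp only [Function.update_of_ne (show i ≠ a by omega)]
        exact hH' i (by omega) h2)
    dsimp only at q1 q2 q3
    refine ⟨p2, u2, h2, H2, ?_, ?_, ?_, ?_⟩
    · apply Runs.cast
      · exact Runs.loop_step (by simp [ha, hj]; omega) r1 r2
      · omega
      · rfl
    · intro i h1 h2
      rcases Nat.eq_or_lt_of_le h1 with rfl | h1
      · rw [q2 a (by omega), Function.update_self, hw]
      · rw [q1 i h1 h2, Function.update_of_ne (by omega)]
    · intro i hi
      rw [q2 i (by omega), Function.update_of_ne (by omega)]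
    · rw [q3, if_neg (by omega : d + 1 ≠ 0)]
      by_cases hd : d = 0
      · have : a = J := by omega
        rw [if_pos hd, hw, this]
      · rw [if_neg hd]
        simp only [Function.update_of_ne (show J ≠ a by omega)]

end Horner

/-! ## Error analysis of the Horner scheme -/

section Error

open Finset

/-- Tail of the `a`-th fractional derivative, divided by `x ^ (e r - e a)`. -/
def hornerTail (e : ℕ → ℕ) (c : ℕ → ℝ) (k a j r : ℕ) (x : ℝ) : ℝ :=
  ∑ l ∈ Ico j k, fracCoeff e c a l * x ^ (e l - e r)

variable {n k lam : ℕ} {e : ℕ → ℕ} {c : ℕ → ℝ}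

theorem hornerTail_self (a : ℕ) (x : ℝ) :
    hornerTail e c k a a a x = fracVal e c k a x := rfl

theorem hornerTail_eq_add {a J : ℕ} (hJ : J < k) (x : ℝ) :
    hornerTail e c k a J J x = hornerTail e c k a (J + 1) J x + fracCoeff e c a J := by
  rw [hornerTail, sum_eq_sum_Ico_succ_bot hJ, tsub_self, pow_zero, mul_one, add_comm]; rfl

theorem hornerTail_shift (h : Sized n k lam e c) {a j r : ℕ} (hrj : r ≤ j) (x : ℝ) :
    hornerTail e c k a j r x = x ^ (e j - e r) * hornerTail e c k a j j x := by
  rw [hornerTail, hornerTail, mul_sum]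
  refine sum_congr rfl fun l hl => ?_
  have hl := mem_Ico.1 hl
  have h1 := h.mono hl.1 hl.2
  have h2 := h.mono hrj (lt_of_le_of_lt hl.1 hl.2)
  have : e l - e r = (e j - e r) + (e l - e j) := by omega
  rw [this, pow_add]; ring

theorem abs_hornerTail_le (h : Sized n k lam e c) {a j : ℕ} {x Z S : ℝ}
    (hx : 0 ≤ x) (hxZ : x ≤ Z) (hZ : 1 ≤ Z) (hS : ∑ l ∈ Ico j k, |fracCoeff e c a l| ≤ S) :
    |hornerTail e c k a j j x| ≤ S * Z ^ (e (k - 1) - e j) := by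
  refine (abs_sum_le_sum_abs _ _).trans ?_
  refine le_trans ?_ (mul_le_mul_of_nonneg_right hS (by positivity))
  rw [sum_mul]
  refine sum_le_sum fun l hl => ?_
  have hl := mem_Ico.1 hl
  rw [abs_mul, abs_of_nonneg (a := x ^ _) (by positivity)]
  have h1 := h.mono (by omega : l ≤ k - 1) (by omega)
  gcongr
  exact (pow_le_pow_left₀ hx hxZ _).trans (pow_le_pow_right₀ hZ (by omega))

/-- The parameters of the error analysis at one point: `X / 2 ^ s` approximates `x ≥ 0` with error
at most `U / 2 ^ s`, `Z ≥ 1` bounds both, `S` bounds the coefficient sums of the fractional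
derivatives, and `R / 2 ^ s` is the resulting error bound. -/
structure EvalData (n k s : ℕ) (e : ℕ → ℕ) (c : ℕ → ℝ) (x Z U S R : ℝ) (X : ℤ) : Prop where
  X_nonneg : 0 ≤ X
  x_nonneg : 0 ≤ x
  x_le : x ≤ Z
  X_le : (X : ℝ) ≤ Z * 2 ^ s
  one_le : 1 ≤ Z
  dist_le : |(X : ℝ) - x * 2 ^ s| ≤ U
  sum_le : ∀ a j, a ≤ j → j ≤ k → ∑ l ∈ Ico j k, |fracCoeff e c a l| ≤ S
  err_le : (S * n * (U + 1) + k * (1 + 2 * (n : ℝ) ^ k)) * Z ^ n ≤ R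

variable {s : ℕ} {x Z U S R : ℝ} {X : ℤ}

theorem EvalData.U_nonneg (d : EvalData n k s e c x Z U S R X) : 0 ≤ U :=
  (abs_nonneg _).trans d.dist_le

theorem EvalData.S_nonneg (d : EvalData n k s e c x Z U S R X) : 0 ≤ S := by
  have := d.sum_le 0 k (Nat.zero_le _) le_rfl
  simpa using this

/-- Error bound before the division by `2 ^ s` is carried out at index `J`. -/
noncomputable def hornerErr (n k : ℕ) (e : ℕ → ℕ) (U S Z : ℝ) (J : ℕ) (D : ℝ) : ℝ :=
  (S * (e (k - 1) - e J : ℕ) * (U + 1) + ((k - J : ℕ) : ℝ) * (1 + 2 * (n : ℝ) ^ k) - D)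
    * Z ^ (e (k - 1) - e J)

theorem EvalData.hornerErr_le (d : EvalData n k s e c x Z U S R X) (h : Sized n k lam e c) {J : ℕ}
    {D : ℝ} (hD : 0 ≤ D) : hornerErr n k e U S Z J D ≤ R := by
  have hk := h.two_le
  refine le_trans ?_ d.err_le
  have hS := d.S_nonneg
  have hU := d.U_nonneg
  have h1 : e (k - 1) - e J ≤ n := (Nat.sub_le _ _).trans (h.exp_le _ (by omega))
  have h2 : ((e (k - 1) - e J : ℕ) : ℝ) ≤ n := by exact_mod_cast h1
  have h3 : ((k - J : ℕ) : ℝ) ≤ k := by exact_mod_cast Nat.sub_le _ _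
  have h4 : Z ^ (e (k - 1) - e J) ≤ Z ^ n := pow_le_pow_right₀ d.one_le h1
  have h5 : 0 ≤ Z ^ (e (k - 1) - e J) := by have := d.one_le; positivity
  unfold hornerErr
  refine mul_le_mul ?_ h4 h5 (by positivity)
  have : S * (e (k - 1) - e J : ℕ) * (U + 1) ≤ S * n * (U + 1) := by gcongr
  have : ((k - J : ℕ) : ℝ) * (1 + 2 * (n : ℝ) ^ k) ≤ k * (1 + 2 * (n : ℝ) ^ k) := by gcongr
  linarith

/-- Error of a computed power of the approximate point. -/
theorem EvalData.abs_pow_sub_le (d : EvalData n k s e c x Z U S R X) {g : ℕ} {y : ℤ}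
    (hy : Apx s ((X : ℝ) / 2 ^ s) Z g g y) : |(y : ℝ) - x ^ g * 2 ^ s| ≤ g * (U + 1) * Z ^ g := by
  have hs : (0 : ℝ) < 2 ^ s := by positivity
  have hX : (0 : ℝ) ≤ (X : ℝ) / 2 ^ s := by
    have : (0 : ℝ) ≤ X := by exact_mod_cast d.X_nonneg
    positivity
  have hXZ : (X : ℝ) / 2 ^ s ≤ Z := (div_le_iff₀ hs).2 d.X_le
  have hZ := d.one_le
  have h1 := abs_pow_sub_pow_le ((X : ℝ) / 2 ^ s) x g
  have h2 : max |(X : ℝ) / 2 ^ s| |x| ^ (g - 1) ≤ Z ^ g := by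
    rw [abs_of_nonneg hX, abs_of_nonneg d.x_nonneg]
    exact (pow_le_pow_left₀ (le_max_of_le_left hX) (max_le hXZ d.x_le) _).trans
      (pow_le_pow_right₀ hZ (by omega))
  have h3 : |(X : ℝ) / 2 ^ s - x| * 2 ^ s ≤ U := by
    have : |(X : ℝ) / 2 ^ s - x| * 2 ^ s = |(X : ℝ) - x * 2 ^ s| := by
      rw [← abs_of_pos hs, ← abs_mul, abs_of_pos hs, sub_mul, div_mul_cancel₀ _ hs.ne']
    rw [this]; exact d.dist_le
  have h4 : |((X : ℝ) / 2 ^ s) ^ g * 2 ^ s - x ^ g * 2 ^ s| ≤ g * U * Z ^ g := by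
    rw [← sub_mul, abs_mul, abs_of_pos hs]
    calc _ ≤ |(X : ℝ) / 2 ^ s - x| * g * max |(X : ℝ) / 2 ^ s| |x| ^ (g - 1) * 2 ^ s := by gcongr
      _ ≤ |(X : ℝ) / 2 ^ s - x| * g * Z ^ g * 2 ^ s := by gcongr
      _ = g * (|(X : ℝ) / 2 ^ s - x| * 2 ^ s) * Z ^ g := by ring
      _ ≤ _ := by gcongr
  have h5 : |(y : ℝ) - ((X : ℝ) / 2 ^ s) ^ g * 2 ^ s| ≤ g * Z ^ g := by
    rw [abs_le]
    exact ⟨by linarith [hy.2.2], by have := hy.2.1; have : 0 ≤ (g : ℝ) * Z ^ g := by positivity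
                                    linarith⟩
  have h6 := abs_sub_le (y : ℝ) (((X : ℝ) / 2 ^ s) ^ g * 2 ^ s) (x ^ g * 2 ^ s)
  nlinarith

theorem EvalData.abs_le_of_err (d : EvalData n k s e c x Z U S R X) (h : Sized n k lam e c)
    {a J : ℕ} (haJ : a ≤ J) (hJ : J < k) {H : ℤ}
    (hH : |(H : ℝ) - hornerTail e c k a J J x * 2 ^ s| ≤ R) :
    |(H : ℝ)| ≤ 2 ^ s * S * Z ^ n + R := by
  have hs : (0 : ℝ) < 2 ^ s := by positivity
  have h1 := abs_hornerTail_le h d.x_nonneg d.x_le d.one_le (d.sum_le a J haJ hJ.le)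
  have h2 : |hornerTail e c k a J J x * 2 ^ s| ≤ 2 ^ s * S * Z ^ n := by
    rw [abs_mul, abs_of_pos hs]
    have hS := d.S_nonneg
    have : Z ^ (e (k - 1) - e J) ≤ Z ^ n := pow_le_pow_right₀ d.one_le
      ((Nat.sub_le _ _).trans (h.exp_le _ (by omega)))
    calc _ ≤ S * Z ^ (e (k - 1) - e J) * 2 ^ s := by gcongr
      _ ≤ S * Z ^ n * 2 ^ s := by gcongr
      _ = _ := by ring
  have h3 := abs_sub_abs_le_abs_sub (H : ℝ) (hornerTail e c k a J J x * 2 ^ s)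
  linarith

/-- The multiplication step of the Horner scheme. -/
theorem EvalData.mul_step (d : EvalData n k s e c x Z U S R X) (h : Sized n k lam e c)
    {a J : ℕ} (haJ : a ≤ J) (hJ : J + 1 < k) {H y : ℤ}
    (hy : Apx s ((X : ℝ) / 2 ^ s) Z (e (J + 1) - e J) (e (J + 1) - e J : ℕ) y)
    (hH : |(H : ℝ) - hornerTail e c k a (J + 1) (J + 1) x * 2 ^ s|
      ≤ hornerErr n k e U S Z (J + 1) 0) :
    |((H * y / 2 ^ s : ℤ) : ℝ) - hornerTail e c k a (J + 1) J x * 2 ^ s|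
      ≤ hornerErr n k e U S Z J (2 * (n : ℝ) ^ k) := by
  have hs : (0 : ℝ) < 2 ^ s := by positivity
  have hZ := d.one_le
  have hS := d.S_nonneg
  have hU := d.U_nonneg
  have h0 := h.lt J (J + 1) (by omega) hJ
  have h1' := h.mono (by omega : J + 1 ≤ k - 1) (by omega)
  set g := e (J + 1) - e J with hg
  set m := e (k - 1) - e (J + 1) with hm
  have hgm : e (k - 1) - e J = g + m := by omega
  have h1 := d.abs_pow_sub_le hy
  have hX : (0 : ℝ) ≤ (X : ℝ) / 2 ^ s := by
    have : (0 : ℝ) ≤ X := by exact_mod_cast d.X_nonneg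
    positivity
  have h2 := hy.le hX ((div_le_iff₀ hs).2 d.X_le)
  have hy0 : (0 : ℝ) ≤ y := by exact_mod_cast hy.1
  have h3 := abs_hornerTail_le h d.x_nonneg d.x_le hZ (d.sum_le a (J + 1) (by omega) hJ.le)
  rw [← hm] at h3
  rw [hornerTail_shift h (by omega : J ≤ J + 1), ← hg]
  set T := hornerTail e c k a (J + 1) (J + 1) x
  obtain ⟨f1, f2⟩ := floor_shift (H * y) s
  push_cast at f1 f2
  set Q : ℝ := ((H * y / 2 ^ s : ℤ) : ℝ)
  have e1 : |Q * 2 ^ s - H * y| ≤ 2 ^ s := by rw [abs_le]; constructor <;> linarith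
  have e2 : |(H : ℝ) * y - T * 2 ^ s * y| ≤ hornerErr n k e U S Z (J + 1) 0 * (Z ^ g * 2 ^ s) := by
    rw [← sub_mul, abs_mul, abs_of_nonneg hy0]
    exact mul_le_mul hH h2 hy0 ((abs_nonneg _).trans hH)
  have e3 : |T * 2 ^ s * y - T * 2 ^ s * (x ^ g * 2 ^ s)|
      ≤ S * Z ^ m * 2 ^ s * (g * (U + 1) * Z ^ g) := by
    rw [← mul_sub, abs_mul, abs_mul, abs_of_pos hs]
    gcongr
  have e4 : |Q * 2 ^ s - x ^ g * T * 2 ^ s * 2 ^ s| ≤ 2 ^ s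
      + hornerErr n k e U S Z (J + 1) 0 * (Z ^ g * 2 ^ s)
      + S * Z ^ m * 2 ^ s * (g * (U + 1) * Z ^ g) := by
    have : Q * 2 ^ s - x ^ g * T * 2 ^ s * 2 ^ s = (Q * 2 ^ s - H * y)
        + (H * y - T * 2 ^ s * y) + (T * 2 ^ s * y - T * 2 ^ s * (x ^ g * 2 ^ s)) := by ring
    rw [this]
    exact (abs_add_le _ _).trans (add_le_add ((abs_add_le _ _).trans (add_le_add e1 e2)) e3)
  rw [← sub_mul, abs_mul, abs_of_pos hs] at e4
  refine le_of_mul_le_mul_right (e4.trans ?_) hs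
  unfold hornerErr
  rw [hgm, ← hm]
  have h6 : ((k - J : ℕ) : ℝ) = ((k - (J + 1) : ℕ) : ℝ) + 1 := by
    have : k - J = k - (J + 1) + 1 := by omega
    exact_mod_cast this
  rw [h6]
  push_cast
  have h7 : (1 : ℝ) ≤ Z ^ (g + m) := one_le_pow₀ hZ
  have h8 : (2 : ℝ) ^ s ≤ Z ^ (g + m) * 2 ^ s := le_mul_of_one_le_left hs.le h7
  rw [pow_add] at h8 ⊢
  linarith

/-- The addition step of the Horner scheme. -/
theorem add_step {a J : ℕ} (hJ : J < k) {Q W : ℤ}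
    (hQ : |(Q : ℝ) - hornerTail e c k a (J + 1) J x * 2 ^ s|
      ≤ hornerErr n k e U S Z J (2 * (n : ℝ) ^ k))
    (hW : |(W : ℝ) - fracCoeff e c a J * 2 ^ s| ≤ 2 * (n : ℝ) ^ k) (hZ : 1 ≤ Z) :
    |((Q + W : ℤ) : ℝ) - hornerTail e c k a J J x * 2 ^ s| ≤ hornerErr n k e U S Z J 0 := by
  rw [hornerTail_eq_add hJ]
  have : ((Q + W : ℤ) : ℝ) - (hornerTail e c k a (J + 1) J x + fracCoeff e c a J) * 2 ^ s
      = (Q - hornerTail e c k a (J + 1) J x * 2 ^ s) + (W - fracCoeff e c a J * 2 ^ s) := by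
    push_cast; ring
  rw [this]
  refine (abs_add_le _ _).trans ((add_le_add hQ hW).trans ?_)
  unfold hornerErr
  have h1 : (1 : ℝ) ≤ Z ^ (e (k - 1) - e J) := one_le_pow₀ hZ
  have h2 : 2 * (n : ℝ) ^ k ≤ 2 * (n : ℝ) ^ k * Z ^ (e (k - 1) - e J) :=
    le_mul_of_one_le_right (by positivity) h1
  linarith

/-- Before the first step the product is zero. -/
theorem hornerErr_start (h : Sized n k lam e c) {a : ℕ} :
    |((0 : ℤ) : ℝ) - hornerTail e c k a k (k - 1) x * 2 ^ s|
      ≤ hornerErr n k e U S Z (k - 1) (2 * (n : ℝ) ^ k) := by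
  have hk := h.two_le
  have : k - (k - 1) = 1 := by omega
  simp [hornerTail, hornerErr, this]

end Error

/-! ## Evaluation at one point -/

/-- One step of the evaluation loop. -/
def evalBody : Prog :=
  .seq (.arith .add (.reg 18) (rg 11) (cst 1)) <|
  .seq (.ask (.reg 12) (rg 18) (rg 4)) <|
  .seq (setReg 13 (cst 0)) <|
  .seq hornerLoop <|
  .seq (.ite (cst 0) (rg 14) .skip (.arith .sub (.reg 14) (cst 0) (rg 14))) <|
  .seq (.ite (cst 0) (rg 10) (.ite (rg 10) (rg 14) .skip (setReg 10 (rg 14)))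
    (setReg 10 (rg 14))) <|
  .seq (.arith .add (.reg 15) (rg 11) (cst 26)) <|
  .seq (setReg 16 (.ind 15)) <|
  .seq (.arith .add (.reg 15) (rg 11) (cst 25)) <|
  .seq (.arith .sub (.reg 16) (rg 16) (.ind 15)) <|
  .seq (setReg 17 (rg 8)) <|
  .seq powProg <|
  .arith .sub (.reg 11) (rg 11) (cst 1)

/-- `mn := min |f^[a] x|`. -/
def evalProg : Prog :=
  .seq (setReg 9 (cst 0)) <|
  .seq (setReg 10 (cst (-1))) <|
  .seq (setReg 11 (rg 1)) <|
  .loop (cst 0) (rg 11) evalBody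

section Eval

open Finset

/-- The numbers occurring in the evaluation are bounded by `2 ^ bd`. -/
structure BitBound (n k s bd : ℕ) (Z S R : ℝ) : Prop where
  index : (3 * k + 64 + n : ℤ) ≤ 2 ^ bd
  scale : s ≤ bd
  horner : (2 ^ s * S * Z ^ n + R) * (Z ^ n * 2 ^ s) ≤ 2 ^ bd
  power : Z ^ (2 * n) * 2 ^ (2 * s) ≤ 2 ^ bd

/-- The table of exponents, shifted by `k`. -/
structure ExpTable (k : ℕ) (e : ℕ → ℕ) (E : ℕ → ℤ) : Prop where
  zero : E 0 = k
  succ : ∀ i < k, E (i + 1) = k + e i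

/-- The invariant of the evaluation loop. -/
structure EvalInv (n k s bd : ℕ) (e : ℕ → ℕ) (c : ℕ → ℝ) (x Z U S R : ℝ) (j : ℕ) (H : ℕ → ℤ)
    (y mn : ℤ) : Prop where
  mul_le : ∀ a < j, |H a * y| ≤ 2 ^ bd
  mul_err : ∀ a < j, |((H a * y / 2 ^ s : ℤ) : ℝ) - hornerTail e c k a j (j - 1) x * 2 ^ s|
    ≤ hornerErr n k e U S Z (j - 1) (2 * (n : ℝ) ^ k)
  mn_start : j = k → mn = -1
  mn_nonneg : j < k → 0 ≤ mn
  le_mn : j < k → ∃ a, j ≤ a ∧ a < k ∧ |fracVal e c k a x| * 2 ^ s - R ≤ mn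
  mn_le : ∀ a, j ≤ a → a < k → (mn : ℝ) ≤ |fracVal e c k a x| * 2 ^ s + R

variable {O : ℕ → ℕ → ℤ} {n k lam s q bd : ℕ} {e : ℕ → ℕ} {c : ℕ → ℝ} {E : ℕ → ℤ}
  {x Z U S R : ℝ} {X : ℤ}

theorem EvalData.two_mul_pow_le (d : EvalData n k s e c x Z U S R X) (h : Sized n k lam e c) :
    2 * (n : ℝ) ^ k ≤ R := by
  refine le_trans ?_ d.err_le
  have hS := d.S_nonneg
  have hU := d.U_nonneg
  have h1 : (1 : ℝ) ≤ Z ^ n := one_le_pow₀ d.one_le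
  have h2 : (1 : ℝ) ≤ k := by exact_mod_cast (by have := h.two_le; omega : 1 ≤ k)
  have h3 : 0 ≤ S * n * (U + 1) := by positivity
  have h4 : 1 + 2 * (n : ℝ) ^ k ≤ k * (1 + 2 * (n : ℝ) ^ k) :=
    le_mul_of_one_le_left (by positivity) h2
  calc 2 * (n : ℝ) ^ k ≤ S * n * (U + 1) + k * (1 + 2 * (n : ℝ) ^ k) := by linarith
    _ ≤ _ := le_mul_of_one_le_right (by positivity) h1

theorem EvalData.V_le (d : EvalData n k s e c x Z U S R X) (h : Sized n k lam e c)
    (B : BitBound n k s bd Z S R) : 2 ^ s * S * Z ^ n + R ≤ 2 ^ bd := by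
  refine le_trans ?_ B.horner
  have h1 : (1 : ℝ) ≤ Z ^ n := one_le_pow₀ d.one_le
  have h2 : (1 : ℝ) ≤ 2 ^ s := one_le_pow₀ (by norm_num)
  have hR : 0 ≤ R := le_trans (by positivity) (d.two_mul_pow_le h)
  have hS := d.S_nonneg
  exact le_mul_of_one_le_right (by positivity) (one_le_mul_of_one_le_of_one_le h1 h2)

/-- The sequence of values of `w` in the inner loop. -/
def wSeq (e : ℕ → ℕ) (w : ℤ) (J a : ℕ) : ℤ := w * ∏ i ∈ range a, ((e J : ℤ) - e i)

theorem wSeq_succ (w : ℤ) (J a : ℕ) : wSeq e w J a * ((e J : ℤ) - e a) = wSeq e w J (a + 1) := by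
  simp [wSeq, prod_range_succ, mul_assoc]

theorem wSeq_err (h : Sized n k lam e c) {w : ℤ} {J a : ℕ} (haJ : a ≤ J) (hJ : J < k)
    (hw : |(w : ℝ) - c J * 2 ^ s| ≤ 2) :
    |(wSeq e w J a : ℝ) - fracCoeff e c a J * 2 ^ s| ≤ 2 * (n : ℝ) ^ k := by
  have h1 := one_le_prod_sub h.lt haJ hJ
  have : (wSeq e w J a : ℝ) - fracCoeff e c a J * 2 ^ s
      = (w - c J * 2 ^ s) * ∏ i ∈ range a, ((e J : ℝ) - e i) := by
    simp only [wSeq, fracCoeff]; push_cast; ring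
  rw [this, abs_mul, abs_of_nonneg (a := ∏ i ∈ range a, ((e J : ℝ) - e i)) (by linarith)]
  exact mul_le_mul hw (h.prod_le haJ hJ) (by linarith) (by norm_num)

theorem int_abs_le_of_real {z : ℤ} {r : ℝ} (h : |(z : ℝ)| ≤ r) (hr : r ≤ 2 ^ bd) :
    |z| ≤ 2 ^ bd := by
  have := h.trans hr
  exact_mod_cast this

theorem EvalData.wSeq_le (d : EvalData n k s e c x Z U S R X) (h : Sized n k lam e c)
    (B : BitBound n k s bd Z S R) {w : ℤ} {J : ℕ} (hJ : J < k)
    (hw : |(w : ℝ) - c J * 2 ^ s| ≤ 2) : ∀ a ≤ J + 1, |wSeq e w J a| ≤ 2 ^ bd := by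
  intro a ha
  rcases Nat.eq_or_lt_of_le ha with rfl | ha
  · rw [← wSeq_succ, sub_self, mul_zero, abs_zero]; positivity
  · have h1 := wSeq_err h (by omega : a ≤ J) hJ hw
    have h2 := abs_sub_abs_le_abs_sub (wSeq e w J a : ℝ) (fracCoeff e c a J * 2 ^ s)
    have h3 : |fracCoeff e c a J| ≤ S := by
      refine le_trans ?_ (d.sum_le a J (by omega) hJ.le)
      exact single_le_sum (f := fun l => |fracCoeff e c a l|) (fun _ _ => abs_nonneg _)
        (mem_Ico.2 ⟨le_rfl, hJ⟩)
    have hs : (0 : ℝ) < 2 ^ s := by positivity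
    have hS := d.S_nonneg
    have h4 : |fracCoeff e c a J * 2 ^ s| ≤ 2 ^ s * S * Z ^ n := by
      rw [abs_mul, abs_of_pos hs]
      calc |fracCoeff e c a J| * 2 ^ s ≤ S * 2 ^ s := by gcongr
        _ = 2 ^ s * S := by ring
        _ ≤ _ := le_mul_of_one_le_right (by positivity) (one_le_pow₀ d.one_le)
    refine int_abs_le_of_real (r := 2 ^ s * S * Z ^ n + R) ?_ (d.V_le h B)
    have := d.two_mul_pow_le h
    linarith

theorem ExpTable.sub_eq (T : ExpTable k e E) {i j : ℕ} (hi : i < k) (hj : j < k) :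
    E (i + 1) - E (j + 1) = (e i : ℤ) - e j := by
  rw [T.succ i hi, T.succ j hj]; ring

theorem ExpTable.gap (T : ExpTable k e E) (h : Sized n k lam e c) (h0 : e 0 = 0) {J : ℕ}
    (hJ : J < k) : E (J + 1) - E J = ((e J - e (J - 1) : ℕ) : ℤ) := by
  cases J with
  | zero => rw [T.zero, T.succ 0 hJ, h0]; simp
  | succ J =>
    rw [T.sub_eq hJ (by omega)]
    have := h.lt J (J + 1) (by omega) hJ
    simp only [Nat.add_sub_cancel]
    omega

theorem ExpTable.abs_le (T : ExpTable k e E) (h : Sized n k lam e c)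
    (B : BitBound n k s bd Z S R) : ∀ i ≤ k, |E i| ≤ 2 ^ bd := by
  intro i hi
  have := B.index
  cases i with
  | zero => rw [T.zero, abs_of_nonneg (by positivity)]; omega
  | succ i =>
    rw [T.succ i (by omega), abs_of_nonneg (by positivity)]
    have := h.exp_le i (by omega)
    omega

theorem minUpdate_runs (st : St) (hh : |st.h| ≤ 2 ^ bd) :
    ∃ mn' : ℤ, Runs O bd (.ite (cst 0) (rg 10) (.ite (rg 10) (rg 14) .skip (setReg 10 (rg 14)))
      (setReg 10 (rg 14))) (mem k E st) (mem k E {st with mn := mn'}) 3 ∧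
      mn' = if 0 ≤ st.mn then min st.mn st.h else st.h := by
  by_cases h1 : 0 ≤ st.mn
  · by_cases h2 : st.mn ≤ st.h
    · refine ⟨st.mn, ?_, by rw [if_pos h1, min_eq_left h2]⟩
      exact Runs.mono (Runs.ite_true (by simpa using h1) (Runs.ite_true (by simpa using h2)
        Runs.skip)) (by norm_num)
    · refine ⟨st.h, ?_, by rw [if_pos h1, min_eq_right (by omega)]⟩
      exact Runs.mono (Runs.ite_true (by simpa using h1) (Runs.ite_false (by simpa using h2)
        (Runs.op hh (upd_mn _ _ _ _) (by simp)))) (by norm_num)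
  · refine ⟨st.h, ?_, by rw [if_neg h1]⟩
    exact Runs.mono (Runs.ite_false (by simpa using h1)
        (Runs.op hh (upd_mn _ _ _ _) (by simp))) (by norm_num)

theorem absReg_runs (st : St) (hh : |st.h| ≤ 2 ^ bd) :
    Runs O bd (.ite (cst 0) (rg 14) .skip (.arith .sub (.reg 14) (cst 0) (rg 14)))
      (mem k E st) (mem k E {st with h := |st.h|}) 2 := by
  by_cases h1 : 0 ≤ st.h
  · rw [abs_of_nonneg h1]
    exact Runs.ite_true (by simpa using h1) Runs.skip
  · rw [abs_of_neg (by omega)]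
    refine Runs.ite_false (by simpa using h1) (Runs.op ?_ (upd_h _ _ _ _) (by simp))
    rwa [abs_neg]

theorem evalBody_runs (d : EvalData n k s e c x Z U S R X) (h : Sized n k lam e c)
    (B : BitBound n k s bd Z S R) (T : ExpTable k e E) (h0 : e 0 = 0) (hqs : q + 1 = s)
    (hO : ∀ J < k, |(O (J + 2) q : ℝ) - c J * 2 ^ s| ≤ 2)
    (st : St) (J : ℕ) (hJ : J < k) (hs : st.s = s) (hq : st.q = q) (hk : st.k = k) (hx : st.x = X)
    (hj : st.j = J + 1) (I : EvalInv n k s bd e c x Z U S R (J + 1) st.H st.y st.mn) :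
    ∃ (y' b' u' v' p' a' w' h' mn' : ℤ) (H' : ℕ → ℤ),
      Runs O bd evalBody (mem k E st) (mem k E {st with
        y := y', b := b', u := u', v := v', p := p', a := a', w := w', h := h', mn := mn', H := H'
        g := 0, j := J}) (13 * k + 9 * n.size + 20) ∧
      EvalInv n k s bd e c x Z U S R J H' y' mn' := by
  have hw := hO J hJ
  set w₀ := O (J + 2) q with hw₀
  set W := wSeq e w₀ J with hWdef
  have hWb := d.wSeq_le h B hJ hw
  have hidx := B.index
  have hJk : (J : ℤ) < k := by exact_mod_cast hJ
  have hEb := T.abs_le h B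
  have hWs : ∀ a ≤ J, W a * (E (J + 1) - E (a + 1)) = W (a + 1) := fun a ha => by
    rw [T.sub_eq hJ (by omega)]; exact wSeq_succ _ _ _
  have hEd : ∀ a ≤ J, |E (J + 1) - E (a + 1)| ≤ 2 ^ bd := fun a ha => by
    rw [T.sub_eq hJ (by omega)]
    have h1 := h.mono ha hJ
    have h2 := h.exp_le J hJ
    rw [abs_of_nonneg (by omega)]; omega
  have hnew : ∀ i ≤ J, |((st.H i * st.y / 2 ^ s + W i : ℤ) : ℝ) - hornerTail e c k i J J x * 2 ^ s|
      ≤ hornerErr n k e U S Z J 0 := fun i hi =>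
    add_step hJ (I.mul_err i (by omega)) (wSeq_err h hi hJ hw) d.one_le
  have hnewR : ∀ i ≤ J, |((st.H i * st.y / 2 ^ s + W i : ℤ) : ℝ)| ≤ 2 ^ s * S * Z ^ n + R :=
    fun i hi => d.abs_le_of_err h hi hJ ((hnew i hi).trans (d.hornerErr_le h le_rfl))
  have hnewb : ∀ i ≤ J, |st.H i * st.y / 2 ^ s + W i| ≤ 2 ^ bd := fun i hi =>
    int_abs_le_of_real (hnewR i hi) (d.V_le h B)
  obtain ⟨p1, u1, h1, H1, r1, i1, -, i3⟩ := hornerLoop_runs (O := O) (bd := bd) (s := s) J W hJ hWs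
    hWb (by omega) hEb hEd (J + 1) {st with u := J + 2, w := w₀, a := 0} 0 (by omega) hs hk hj rfl
    (by simp [hWdef, wSeq]) (fun i _ hi => I.mul_le i (by omega)) (fun i _ hi => hnewb i hi)
  rw [if_neg (by omega)] at i3
  dsimp only at i1 i3 r1
  have hh1 : |h1| ≤ 2 ^ bd := by rw [i3]; exact hnewb J le_rfl
  have hh2 : |(|h1|)| ≤ 2 ^ bd := by rwa [abs_abs]
  obtain ⟨mn', r3, i4⟩ := minUpdate_runs (O := O) (bd := bd) (k := k) (E := E)
    {st with u := u1, w := W (J + 1), a := (J + 1 : ℕ), p := p1, H := H1, h := |h1|} hh2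
  dsimp only at i4 r3
  have hgap := T.gap h h0 hJ
  set g := e J - e (J - 1) with hg
  have hgn : g ≤ n := (Nat.sub_le _ _).trans (h.exp_le J hJ)
  have hgb : (g : ℤ) ≤ 2 ^ bd := by omega
  have hsb : (2 : ℝ) ^ s ≤ 2 ^ bd := pow_le_pow_right₀ (by norm_num) B.scale
  have hs' : (0 : ℝ) < 2 ^ s := by positivity
  have hXb : |X| ≤ 2 ^ bd := by
    have h2 : (1 : ℝ) ≤ Z := d.one_le
    refine abs_le_pow_of_real d.X_nonneg d.X_le (le_trans ?_ B.power)
    have : Z ≤ Z ^ (2 * n) := le_self_pow₀ h2 (by have := h.one_le; omega)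
    have : (2 : ℝ) ^ s ≤ 2 ^ (2 * s) := pow_le_pow_right₀ (by norm_num) (by omega)
    gcongr
  obtain ⟨y', b', u', v', r4, i5⟩ := powProg_runs (O := O) (bd := bd) (K := k) (E := E) (s := s)
    (x := (X : ℝ) / 2 ^ s) d.one_le g {st with
      u := u1, w := W (J + 1), a := (J + 1 : ℕ), p := J + 1 + 25, H := H1, h := |h1|, mn := mn'
      g := g, b := X} hs rfl hgb hsb d.X_nonneg (by field_simp) ((div_le_iff₀ hs').2 d.X_le)
    (le_trans (by
      have := pow_le_pow_right₀ d.one_le (by omega : 2 * g ≤ 2 * n)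
      gcongr) B.power)
  refine ⟨y', b', u', v', J + 1 + 25, (J + 1 : ℕ), W (J + 1), |h1|, mn', H1, ?_, ?_⟩
  · have c1 : |(J : ℤ) + 2| ≤ 2 ^ bd := by rw [abs_of_nonneg (by positivity)]; omega
    have c2 : |(J : ℤ) + 1 + 26| ≤ 2 ^ bd := by rw [abs_of_nonneg (by positivity)]; omega
    have c3 : |(J : ℤ) + 1 + 25| ≤ 2 ^ bd := by rw [abs_of_nonneg (by positivity)]; omega
    have c4 : |(J : ℤ)| ≤ 2 ^ bd := by rw [abs_of_nonneg (by positivity)]; omega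
    have hw0 : |w₀| ≤ 2 ^ bd := by
      have := hWb 0 (by omega)
      simpa [wSeq] using this
    apply Runs.cast
    · apply Runs.seq (Runs.op c1 (upd_u k E _ _) (by simp [hj]; ring))
      apply Runs.seq (Runs.query (i := J + 2) (q := q) hw0 (by have := B.scale; omega)
        (upd_w k E _ _) (by simp) (by simp [hq]) hw₀.symm)
      apply Runs.seq (Runs.op (v := 0) (by simp) (upd_a k E _ _) (by simp))
      apply Runs.seq r1
      apply Runs.seq (absReg_runs _ hh1)
      apply Runs.seq r3
      apply Runs.seq (Runs.op c2 (upd_p k E _ _) (by simp [hj]))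
      apply Runs.seq (Runs.op (hEb (J + 1) (by omega)) (upd_g k E _ _) (by
        rw [ArithOp.eval, val_ind_E _ (a := J + 1) (by simp) (by omega)]; simp))
      apply Runs.seq (Runs.op c3 (upd_p k E _ _) (by simp [hj]))
      apply Runs.seq (Runs.op (v := g) (by rw [abs_of_nonneg (by positivity)]; exact hgb)
        (upd_g k E _ _) (by
          rw [ArithOp.eval, val_ind_E _ (a := J) (by simp; ring) (by omega)]; simpa using hgap))
      apply Runs.seq (Runs.op hXb (upd_b k E _ _) (by simp [hx]))
      apply Runs.seq r4
      exact Runs.op c4 (upd_j k E _ _) (by simp [hj])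
    · have : g.size ≤ n.size := Nat.size_le_size hgn
      omega
    · simp
  · have hX0 : 0 ≤ (X : ℝ) / 2 ^ s := by
      have : (0 : ℝ) ≤ X := by exact_mod_cast d.X_nonneg
      positivity
    have hyZ := i5.le hX0 ((div_le_iff₀ hs').2 d.X_le)
    have hy0 : (0 : ℝ) ≤ y' := by exact_mod_cast i5.1
    have hJerr := (hnew J le_rfl).trans (d.hornerErr_le h le_rfl)
    rw [hornerTail_self, ← i3] at hJerr
    have hJabs : |((|h1| : ℤ) : ℝ) - |fracVal e c k J x| * 2 ^ s| ≤ R := by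
      refine le_trans ?_ hJerr
      have h2 := abs_abs_sub_abs_le (h1 : ℝ) (fracVal e c k J x * 2 ^ s)
      rwa [abs_mul (fracVal e c k J x), abs_of_pos hs', ← Int.cast_abs] at h2
    obtain ⟨hJ1, hJ2⟩ := _root_.abs_le.1 hJabs
    refine ⟨?_, ?_, fun hh => by omega, fun _ => ?_, fun _ => ?_, ?_⟩
    · intro a ha
      rw [i1 a (by omega) (by omega)]
      refine int_abs_le_of_real (r := (2 ^ s * S * Z ^ n + R) * (Z ^ n * 2 ^ s)) ?_ B.horner
      rw [Int.cast_mul, abs_mul, abs_of_nonneg hy0]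
      have h2 := hnewR a (by omega)
      refine mul_le_mul h2 (hyZ.trans ?_) hy0 ((abs_nonneg _).trans h2)
      have := pow_le_pow_right₀ d.one_le hgn
      gcongr
    · intro a ha
      obtain ⟨J', rfl⟩ : ∃ J', J = J' + 1 := ⟨J - 1, by omega⟩
      rw [i1 a (by omega) (by omega)]
      simp only [Nat.add_sub_cancel] at hg ⊢
      exact d.mul_step h (by omega) hJ (by rw [← hg]; exact i5) (hnew a (by omega))
    · rw [i4]
      split_ifs with hmn
      · exact le_min hmn (abs_nonneg _)
      · exact abs_nonneg _
    · by_cases hmn : 0 ≤ st.mn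
      · have hlt : J + 1 < k := by
          by_contra hh
          have := I.mn_start (by omega)
          omega
        rw [if_pos hmn] at i4
        rcases min_choice st.mn |h1| with hm | hm
        · obtain ⟨a, ha1, ha2, ha3⟩ := I.le_mn hlt
          exact ⟨a, by omega, ha2, by rw [i4, hm]; exact ha3⟩
        · exact ⟨J, le_rfl, hJ, by rw [i4, hm]; linarith⟩
      · rw [if_neg hmn] at i4
        exact ⟨J, le_rfl, hJ, by rw [i4]; linarith⟩
    · intro a ha1 ha2
      by_cases hmn : 0 ≤ st.mn
      · rw [if_pos hmn] at i4
        have m1 : (mn' : ℝ) ≤ st.mn := by rw [i4]; exact_mod_cast min_le_left _ _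
        have m2 : (mn' : ℝ) ≤ (|h1| : ℤ) := by rw [i4]; exact_mod_cast min_le_right _ _
        rcases Nat.eq_or_lt_of_le ha1 with rfl | ha1
        · linarith
        · exact m1.trans (I.mn_le a ha1 ha2)
      · rw [if_neg hmn] at i4
        rcases Nat.eq_or_lt_of_le ha1 with rfl | ha1
        · rw [i4]; linarith
        · exact absurd (I.mn_nonneg (by omega)) hmn

theorem evalLoop_runs (d : EvalData n k s e c x Z U S R X) (h : Sized n k lam e c)
    (B : BitBound n k s bd Z S R) (T : ExpTable k e E) (h0 : e 0 = 0) (hqs : q + 1 = s)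
    (hO : ∀ J < k, |(O (J + 2) q : ℝ) - c J * 2 ^ s| ≤ 2) (j : ℕ) :
    ∀ (st : St), j ≤ k → st.s = s → st.q = q → st.k = k → st.x = X → st.j = j →
      EvalInv n k s bd e c x Z U S R j st.H st.y st.mn →
    ∃ (y' b' u' v' p' a' w' h' mn' g' : ℤ) (H' : ℕ → ℤ),
      Runs O bd (.loop (cst 0) (rg 11) evalBody) (mem k E st) (mem k E {st with
        y := y', b := b', u := u', v := v', p := p', a := a', w := w', h := h', mn := mn', H := H'
        g := g', j := 0}) ((13 * k + 9 * n.size + 21) * j + 1) ∧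
      EvalInv n k s bd e c x Z U S R 0 H' y' mn' := by
  induction j with
  | zero =>
    intro st _ hs hq hk hx hj I
    refine ⟨st.y, st.b, st.u, st.v, st.p, st.a, st.w, st.h, st.mn, st.g, st.H, ?_, I⟩
    apply Runs.cast
    · exact Runs.loop_done (by simp [hj])
    · omega
    · congr 1
      rw [← Nat.cast_zero, ← hj]
  | succ J ih =>
    intro st hJ hs hq hk hx hj I
    obtain ⟨y1, b1, u1, v1, p1, a1, w1, h1, mn1, H1, r1, I1⟩ := evalBody_runs d h B T h0 hqs hO st J
      hJ hs hq hk hx (by rw [hj]; push_cast; rfl) I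
    obtain ⟨y2, b2, u2, v2, p2, a2, w2, h2, mn2, g2, H2, r2, I2⟩ := ih {st with
        y := y1, b := b1, u := u1, v := v1, p := p1, a := a1, w := w1, h := h1, mn := mn1, H := H1
        g := 0, j := J} (by omega) hs hq hk hx rfl I1
    refine ⟨y2, b2, u2, v2, p2, a2, w2, h2, mn2, g2, H2, ?_, I2⟩
    apply Runs.cast
    · exact Runs.loop_step (by simp [hj]) r1 r2
    · rw [mul_add]; omega
    · rfl

theorem evalProg_runs (d : EvalData n k s e c x Z U S R X) (h : Sized n k lam e c)
    (B : BitBound n k s bd Z S R) (T : ExpTable k e E) (h0 : e 0 = 0) (hqs : q + 1 = s)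
    (hO : ∀ J < k, |(O (J + 2) q : ℝ) - c J * 2 ^ s| ≤ 2) (st : St) (hs : st.s = s)
    (hq : st.q = q) (hk : st.k = k) (hx : st.x = X) :
    ∃ (y' b' u' v' p' a' w' h' mn' g' : ℤ) (H' : ℕ → ℤ),
      Runs O bd evalProg (mem k E st) (mem k E {st with
        y := y', b := b', u := u', v := v', p := p', a := a', w := w', h := h', mn := mn', H := H'
        g := g', j := 0}) ((13 * k + 9 * n.size + 21) * k + 4) ∧
      0 ≤ mn' ∧ (∃ a < k, |fracVal e c k a x| * 2 ^ s - R ≤ mn') ∧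
      ∀ a < k, (mn' : ℝ) ≤ |fracVal e c k a x| * 2 ^ s + R := by
  have hk2 := h.two_le
  have hidx := B.index
  obtain ⟨y2, b2, u2, v2, p2, a2, w2, h2, mn2, g2, H2, r2, I2⟩ := evalLoop_runs d h B T h0 hqs hO k
    {st with y := 0, mn := -1, j := k} le_rfl hs hq hk hx rfl
    ⟨fun a _ => by simp, fun a _ => by
      have := hornerErr_start (e := e) (c := c) (s := s) (x := x) (Z := Z) (U := U) (S := S) (a := a) h
      simpa using this, fun _ => rfl, fun hh => absurd hh (lt_irrefl _),
      fun hh => absurd hh (lt_irrefl _), fun a h1 h2 => by omega⟩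
  refine ⟨y2, b2, u2, v2, p2, a2, w2, h2, mn2, g2, H2, ?_, I2.mn_nonneg (by omega), ?_, ?_⟩
  · apply Runs.cast
    · apply Runs.seq (Runs.op (v := 0) (by simp) (upd_y k E _ _) (by simp))
      apply Runs.seq (Runs.op (v := -1) (by rw [abs_neg, abs_one]; omega) (upd_mn k E _ _) (by simp))
      apply Runs.seq (Runs.op (v := k) (by rw [abs_of_nonneg (by positivity)]; omega)
        (upd_j k E _ _) (by simp [hk]))
      exact r2
    · omega
    · rfl
  · obtain ⟨a, -, ha, ha'⟩ := I2.le_mn (by omega)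
    exact ⟨a, ha, ha'⟩
  · exact fun a ha => I2.mn_le a (Nat.zero_le _) ha

end Eval

/-! ## Numerical analysis of one round -/

section RoundAnalysis

open Finset

/-- A problem instance, with all sizes expressed in terms of one natural number `lam`. -/
structure Instance (n k lam t : ℕ) (e : ℕ → ℕ) (c : ℕ → ℝ) (m δ A : ℝ) : Prop
    extends Sized n k lam e c where
  exp_zero : e 0 = 0
  sq_le : k ^ 2 ≤ t
  t_le : (t : ℝ) ≤ 2 ^ lam
  step_pos : 0 < δ
  le_step : ((2 : ℝ) ^ lam)⁻¹ ≤ δ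
  pos : ∀ i ≤ 2 * t, 0 < multiPt m t δ i
  le : ∀ i ≤ 2 * t, multiPt m t δ i ≤ A
  one_le_A : 1 ≤ A
  A_pow_le : A ^ n ≤ 2 ^ lam

/-- Oracle answers at scale `2 ^ s`. -/
structure Answers (k s : ℕ) (c : ℕ → ℝ) (m δ : ℝ) (am ad : ℤ) (w : ℕ → ℤ) : Prop where
  center : |(am : ℝ) - m * 2 ^ s| ≤ 2
  step : |(ad : ℝ) - δ * 2 ^ s| ≤ 2
  coeff : ∀ l < k, |(w l : ℝ) - c l * 2 ^ s| ≤ 2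

/-- The approximate points. -/
def ptReg (t : ℕ) (am ad : ℤ) (i : ℕ) : ℤ := max 0 (((i : ℤ) - t) * ad + am)

/-- The upper bound for all points. -/
def zReg (s t : ℕ) (am ad : ℤ) : ℤ := max (2 ^ s) (am + t * ad + (t + 1) * 4)

/-- The upper bound for the sum of the coefficients. -/
def sumReg (s : ℕ) (w : ℕ → ℤ) (j : ℕ) : ℤ := 2 ^ s + ∑ l ∈ range j, (|w l| + 2)

variable {n k lam t s : ℕ} {e : ℕ → ℕ} {c : ℕ → ℝ} {m δ A : ℝ} {am ad : ℤ} {w : ℕ → ℤ}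

theorem Instance.four_le (P : Instance n k lam t e c m δ A) : 4 ≤ t := by
  have h1 := P.two_le
  have h2 := P.sq_le
  nlinarith

theorem abs_linear_le (Q : Answers k s c m δ am ad w) {i : ℕ} (hi : i ≤ 2 * t) :
    |((((i : ℤ) - t) * ad + am : ℤ) : ℝ) - multiPt m t δ i * 2 ^ s| ≤ 2 * (t + 1) := by
  have h1 : ((((i : ℤ) - t) * ad + am : ℤ) : ℝ) - multiPt m t δ i * 2 ^ s
      = ((i : ℝ) - t) * (ad - δ * 2 ^ s) + (am - m * 2 ^ s) := by
    rw [multiPt]; push_cast; ring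
  have h2 : |(i : ℝ) - t| ≤ t := by
    have : (i : ℝ) ≤ 2 * t := by exact_mod_cast hi
    rw [abs_le]; constructor <;> linarith [(Nat.cast_nonneg i : (0 : ℝ) ≤ i)]
  rw [h1]
  refine (abs_add_le _ _).trans ?_
  rw [abs_mul]
  have h3 := mul_le_mul h2 Q.step (abs_nonneg _) (Nat.cast_nonneg t)
  linarith [Q.center]

theorem Instance.abs_ptReg_sub (P : Instance n k lam t e c m δ A) (Q : Answers k s c m δ am ad w)
    {i : ℕ} (hi : i ≤ 2 * t) :
    |(ptReg t am ad i : ℝ) - multiPt m t δ i * 2 ^ s| ≤ 2 * (t + 1) := by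
  have h1 := abs_linear_le (t := t) Q hi
  have h2 : 0 ≤ multiPt m t δ i * 2 ^ s := by have := P.pos i hi; positivity
  rw [ptReg]
  rcases le_total 0 (((i : ℤ) - t) * ad + am) with h | h
  · rwa [max_eq_right h]
  · rw [max_eq_left h]
    have h3 : ((((i : ℤ) - t) * ad + am : ℤ) : ℝ) ≤ 0 := by exact_mod_cast h
    rw [abs_le] at h1 ⊢
    simp only [Int.cast_zero]
    constructor <;> linarith

theorem Instance.multiPt_le (P : Instance n k lam t e c m δ A) (Q : Answers k s c m δ am ad w)
    {i : ℕ} (hi : i ≤ 2 * t) :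
    multiPt m t δ i * 2 ^ s + 2 * (t + 1) ≤ zReg s t am ad := by
  have h1 := (abs_le.1 (abs_linear_le (t := t) Q (le_refl (2 * t)))).1
  have h2 : multiPt m t δ i * 2 ^ s ≤ multiPt m t δ (2 * t) * 2 ^ s := by
    have h3 : (i : ℝ) ≤ ((2 * t : ℕ) : ℝ) := by exact_mod_cast hi
    have := P.step_pos
    unfold multiPt
    gcongr
  have h3 : ((am + t * ad + (t + 1) * 4 : ℤ) : ℝ) ≤ zReg s t am ad := by
    exact_mod_cast le_max_right _ _
  push_cast at h1 h3
  linarith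

theorem Instance.ptReg_le (P : Instance n k lam t e c m δ A) (Q : Answers k s c m δ am ad w)
    {i : ℕ} (hi : i ≤ 2 * t) : (ptReg t am ad i : ℝ) ≤ zReg s t am ad := by
  have h1 := (abs_le.1 (P.abs_ptReg_sub Q hi)).2
  have h2 := P.multiPt_le Q hi
  linarith

theorem Instance.zReg_le (P : Instance n k lam t e c m δ A) (Q : Answers k s c m δ am ad w) :
    (zReg s t am ad : ℝ) ≤ A * 2 ^ s + 6 * (t + 1) := by
  have hA := P.one_le_A
  have hs : (0 : ℝ) < 2 ^ s := by positivity
  rw [zReg, Int.cast_max]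
  refine max_le ?_ ?_
  · push_cast
    have : (2 : ℝ) ^ s ≤ A * 2 ^ s := le_mul_of_one_le_left hs.le hA
    have : (0 : ℝ) ≤ t := Nat.cast_nonneg t
    linarith
  · have h1 := (abs_le.1 (abs_linear_le (t := t) Q (le_refl (2 * t)))).2
    have h2 : multiPt m t δ (2 * t) * 2 ^ s ≤ A * 2 ^ s := by
      have := P.le (2 * t) le_rfl
      gcongr
    push_cast at h1 ⊢
    linarith

/-- The bound for the points as a real number. -/
noncomputable def zVal (s t : ℕ) (am ad : ℤ) : ℝ := (zReg s t am ad : ℝ) / 2 ^ s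

theorem zVal_mul : zVal s t am ad * 2 ^ s = zReg s t am ad := by
  unfold zVal; field_simp

theorem one_le_zVal : 1 ≤ zVal s t am ad := by
  rw [zVal, le_div_iff₀ (by positivity), one_mul]
  exact_mod_cast le_max_left _ _

theorem one_add_pow_le_two {u : ℝ} (hu : 0 ≤ u) {n : ℕ} (h : n * u ≤ 1 / 2) : (1 + u) ^ n ≤ 2 := by
  have h0 := one_add_mul_le_pow (a := -(u / (1 + u))) (by
    have : u / (1 + u) ≤ 1 := (div_le_one (by linarith)).2 (by linarith)
    linarith) n
  have h1 : 1 + -(u / (1 + u)) = (1 + u)⁻¹ := by field_simp; ring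
  have h2 : (n : ℝ) * (u / (1 + u)) ≤ 1 / 2 := by
    refine le_trans ?_ h
    gcongr
    exact div_le_self hu (by linarith)
  rw [h1, inv_pow] at h0
  have h3 : (0 : ℝ) < (1 + u) ^ n := by positivity
  have h4 : (1 : ℝ) / 2 ≤ ((1 + u) ^ n)⁻¹ := by linarith
  rw [le_inv_comm₀ (by norm_num) h3] at h4
  simpa using h4

theorem Instance.zVal_pow_le (P : Instance n k lam t e c m δ A) (Q : Answers k s c m δ am ad w)
    (hs : (12 * n * (t + 1) : ℝ) ≤ 2 ^ s) : zVal s t am ad ^ n ≤ 2 ^ (lam + 1) := by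
  have h0 : (0 : ℝ) < 2 ^ s := by positivity
  have hA := P.one_le_A
  have h1 : zVal s t am ad ≤ A * (1 + 6 * (t + 1) / 2 ^ s) := by
    rw [zVal, div_le_iff₀ h0]
    refine (P.zReg_le Q).trans ?_
    have : A * (1 + 6 * (t + 1) / 2 ^ s) * 2 ^ s = A * 2 ^ s + A * (6 * (t + 1)) := by
      field_simp
    rw [this]
    have : 6 * ((t : ℝ) + 1) ≤ A * (6 * (t + 1)) := le_mul_of_one_le_left (by positivity) hA
    linarith
  have h2 : (1 + 6 * ((t : ℝ) + 1) / 2 ^ s) ^ n ≤ 2 := by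
    refine one_add_pow_le_two (by positivity) ?_
    rw [mul_div_assoc', div_le_div_iff₀ h0 (by norm_num)]
    linarith
  have h3 : 0 ≤ zVal s t am ad := le_trans zero_le_one one_le_zVal
  calc zVal s t am ad ^ n ≤ (A * (1 + 6 * (t + 1) / 2 ^ s)) ^ n := pow_le_pow_left₀ h3 h1 n
    _ = A ^ n * (1 + 6 * (t + 1) / 2 ^ s) ^ n := by rw [mul_pow]
    _ ≤ 2 ^ lam * 2 := mul_le_mul P.A_pow_le h2 (by positivity) (by positivity)
    _ = _ := by rw [pow_succ]

/-- The bound for the sum of the coefficients as a real number. -/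
noncomputable def sumVal (s : ℕ) (w : ℕ → ℤ) (k : ℕ) : ℝ := (sumReg s w k : ℝ) / 2 ^ s

theorem sumVal_mul : sumVal s w k * 2 ^ s = sumReg s w k := by
  unfold sumVal; field_simp

theorem one_le_sumVal : 1 ≤ sumVal s w k := by
  rw [sumVal, le_div_iff₀ (by positivity), one_mul, sumReg]
  have : 0 ≤ ∑ l ∈ range k, (|w l| + 2) := sum_nonneg fun _ _ => by positivity
  exact_mod_cast (by linarith)

theorem sum_abs_le_sumVal (Q : Answers k s c m δ am ad w) :
    ∑ l ∈ range k, |c l| ≤ sumVal s w k := by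
  have h0 : (0 : ℝ) < 2 ^ s := by positivity
  rw [sumVal, le_div_iff₀ h0, sumReg, sum_mul]
  push_cast
  refine le_trans (sum_le_sum fun l hl => ?_) (le_add_of_nonneg_left h0.le)
  have h1 := Q.coeff l (mem_range.1 hl)
  have h2 := abs_sub_abs_le_abs_sub (c l * 2 ^ s) (w l : ℝ)
  rw [abs_sub_comm, abs_mul, abs_of_pos h0] at h2
  linarith

theorem Instance.sumVal_le (P : Instance n k lam t e c m δ A) (Q : Answers k s c m δ am ad w)
    (hs : (4 : ℝ) ≤ 2 ^ s) : sumVal s w k ≤ 2 ^ (2 * lam + 2) := by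
  have h0 : (0 : ℝ) < 2 ^ s := by positivity
  rw [sumVal, div_le_iff₀ h0, sumReg]
  push_cast
  have h1 : ∑ l ∈ range k, (|(w l : ℝ)| + 2) ≤ ∑ l ∈ range k, (2 ^ lam * 2 ^ s + 2 ^ s) := by
    refine sum_le_sum fun l hl => ?_
    have h1 := Q.coeff l (mem_range.1 hl)
    have h2 := abs_sub_abs_le_abs_sub (w l : ℝ) (c l * 2 ^ s)
    rw [abs_mul, abs_of_pos h0] at h2
    have h3 := P.abs_le l (mem_range.1 hl)
    have h4 : |c l| * 2 ^ s ≤ 2 ^ lam * 2 ^ s := by gcongr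
    linarith
  rw [sum_const, card_range, nsmul_eq_mul] at h1
  have hl : (1 : ℝ) ≤ 2 ^ lam := one_le_pow₀ (by norm_num)
  have h2 : (k : ℝ) * (2 ^ lam * 2 ^ s + 2 ^ s) ≤ 2 ^ lam * (2 ^ lam * 2 ^ s + 2 ^ lam * 2 ^ s) := by
    have := P.k_le
    gcongr
    exact le_mul_of_one_le_left h0.le hl
  have h3 : (2 : ℝ) ^ (2 * lam + 2) = 4 * (2 ^ lam * 2 ^ lam) := by
    rw [pow_add, two_mul, pow_add]; ring
  have h4 : (1 : ℝ) ≤ 2 ^ lam * 2 ^ lam := one_le_mul_of_one_le_of_one_le hl hl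
  have h5 : (2 : ℝ) ^ s ≤ 2 ^ lam * 2 ^ lam * 2 ^ s := le_mul_of_one_le_left h0.le h4
  rw [h3]
  nlinarith

/-- The error bound of a round, multiplied by `2 ^ s`. -/
noncomputable def errVal (n k s t : ℕ) (am ad : ℤ) (w : ℕ → ℤ) : ℝ :=
  5 * t * sumVal s w k * (n : ℝ) ^ (k + 1) * zVal s t am ad ^ n

theorem Instance.k_le_n (P : Instance n k lam t e c m δ A) : k ≤ n + 1 := by
  have hmono : ∀ i < k, i ≤ e i := by
    intro i
    induction i with
    | zero => intro _; exact Nat.zero_le _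
    | succ i ih =>
      intro hi
      have := ih (by omega)
      have := P.lt i (i + 1) (by omega) hi
      omega
  have h2 := P.two_le
  have h3 := hmono (k - 1) (by omega)
  have h4 := P.exp_le (k - 1) (by omega)
  omega

theorem Instance.evalData (P : Instance n k lam t e c m δ A) (Q : Answers k s c m δ am ad w)
    {i : ℕ} (hi : i ≤ 2 * t) :
    EvalData n k s e c (multiPt m t δ i) (zVal s t am ad) (2 * (t + 1))
      (sumVal s w k * (n : ℝ) ^ k) (errVal n k s t am ad w) (ptReg t am ad i) where
  X_nonneg := le_max_left _ _
  x_nonneg := (P.pos i hi).le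
  x_le := by
    rw [zVal, le_div_iff₀ (by positivity)]
    have := P.multiPt_le Q hi
    have : (0 : ℝ) ≤ t := Nat.cast_nonneg t
    linarith
  X_le := by rw [zVal_mul]; exact P.ptReg_le Q hi
  one_le := one_le_zVal
  dist_le := P.abs_ptReg_sub Q hi
  sum_le := by
    intro a j haj hjk
    calc ∑ l ∈ Ico j k, |fracCoeff e c a l| ≤ ∑ l ∈ Ico j k, |c l| * (n : ℝ) ^ k := by
          refine sum_le_sum fun l hl => ?_
          have hl := mem_Ico.1 hl
          have h1 := one_le_prod_sub P.lt (by omega : a ≤ l) hl.2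
          rw [fracCoeff, abs_mul,
            abs_of_nonneg (a := ∏ i ∈ range a, ((e l : ℝ) - e i)) (by linarith)]
          have := P.prod_le (by omega : a ≤ l) hl.2
          gcongr
      _ = (∑ l ∈ Ico j k, |c l|) * (n : ℝ) ^ k := by rw [sum_mul]
      _ ≤ (∑ l ∈ range k, |c l|) * (n : ℝ) ^ k := by
          gcongr
          intro l hl
          exact mem_range.2 (mem_Ico.1 hl).2
      _ ≤ _ := by
          have := sum_abs_le_sumVal Q
          gcongr
  err_le := by
    have hn : (1 : ℝ) ≤ n := by exact_mod_cast P.one_le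
    have hk : (k : ℝ) ≤ 2 * n := by
      have := P.k_le_n
      have := P.one_le
      exact_mod_cast (by omega : k ≤ 2 * n)
    have hS : 1 ≤ sumVal s w k := one_le_sumVal
    have ht : (4 : ℝ) ≤ t := by exact_mod_cast P.four_le
    have hnk : (1 : ℝ) ≤ (n : ℝ) ^ k := one_le_pow₀ hn
    have hZ : 0 ≤ zVal s t am ad := le_trans zero_le_one one_le_zVal
    unfold errVal
    refine mul_le_mul_of_nonneg_right ?_ (by positivity)
    rw [pow_succ]
    set p : ℝ := (n : ℝ) ^ k
    have e1 : (k : ℝ) * (1 + 2 * p) ≤ 2 * n * (3 * p) := by gcongr; linarith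
    have e2 : 2 * (n : ℝ) * (3 * p) ≤ sumVal s w k * (2 * n * (3 * p)) :=
      le_mul_of_one_le_left (by positivity) hS
    have e3 : sumVal s w k * (p * n) * (2 * t + 9) ≤ sumVal s w k * (p * n) * (5 * t) := by
      gcongr; linarith
    linarith

theorem Instance.n_pow_succ_le (P : Instance n k lam t e c m δ A) :
    (n : ℝ) ^ (k + 1) ≤ 2 ^ (2 * lam) := by
  have hn : (1 : ℝ) ≤ n := by exact_mod_cast P.one_le
  have e1 : (n : ℝ) ≤ 2 ^ lam := by
    refine le_trans ?_ P.pow_le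
    exact le_self_pow₀ hn (by have := P.two_le; omega)
  rw [pow_succ, two_mul, pow_add]
  exact mul_le_mul P.pow_le e1 (by positivity) (by positivity)

theorem Instance.errVal_le (P : Instance n k lam t e c m δ A) (Q : Answers k s c m δ am ad w)
    (hs : (12 * n * (t + 1) : ℝ) ≤ 2 ^ s) (hs4 : (4 : ℝ) ≤ 2 ^ s) :
    errVal n k s t am ad w ≤ 2 ^ (6 * lam + 6) := by
  have h1 := P.sumVal_le Q hs4
  have h2 := P.n_pow_succ_le
  have h3 := P.zVal_pow_le Q hs
  have h4 := P.t_le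
  have hZ : 0 ≤ zVal s t am ad := le_trans zero_le_one one_le_zVal
  have hS : 0 ≤ sumVal s w k := le_trans zero_le_one one_le_sumVal
  calc errVal n k s t am ad w
      ≤ 2 ^ 3 * 2 ^ lam * 2 ^ (2 * lam + 2) * 2 ^ (2 * lam) * 2 ^ (lam + 1) := by
        unfold errVal
        gcongr
        norm_num
    _ = 2 ^ (6 * lam + 6) := by
        rw [← pow_add, ← pow_add, ← pow_add, ← pow_add]; congr 1; ring

theorem Instance.horner_bound (P : Instance n k lam t e c m δ A) (Q : Answers k s c m δ am ad w)
    (hs : (12 * n * (t + 1) : ℝ) ≤ 2 ^ s) (hs4 : (4 : ℝ) ≤ 2 ^ s) :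
    2 ^ s * (sumVal s w k * (n : ℝ) ^ k) * zVal s t am ad ^ n + errVal n k s t am ad w
      ≤ 2 ^ (s + 6 * lam + 7) := by
  have h1 := P.sumVal_le Q hs4
  have h3 := P.zVal_pow_le Q hs
  have h5 := P.errVal_le Q hs hs4
  have h6 := P.pow_le
  have hZ : 0 ≤ zVal s t am ad := le_trans zero_le_one one_le_zVal
  have hS : 0 ≤ sumVal s w k := le_trans zero_le_one one_le_sumVal
  have h7 : 2 ^ s * (sumVal s w k * (n : ℝ) ^ k) * zVal s t am ad ^ n ≤ 2 ^ (s + 6 * lam + 6) := by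
    calc _ ≤ (2 : ℝ) ^ s * (2 ^ (2 * lam + 2) * 2 ^ lam) * 2 ^ (lam + 1) := by gcongr
      _ = 2 ^ (s + 4 * lam + 3) := by
        rw [← pow_add, ← pow_add, ← pow_add]; congr 1; ring
      _ ≤ _ := pow_le_pow_right₀ (by norm_num) (by omega)
  have h8 : (2 : ℝ) ^ (6 * lam + 6) ≤ 2 ^ (s + 6 * lam + 6) :=
    pow_le_pow_right₀ (by norm_num) (by omega)
  have h9 : (2 : ℝ) ^ (s + 6 * lam + 7) = 2 ^ (s + 6 * lam + 6) * 2 := by rw [← pow_succ]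
  linarith

theorem Instance.bitBound (P : Instance n k lam t e c m δ A) (Q : Answers k s c m δ am ad w)
    (hs : (12 * n * (t + 1) : ℝ) ≤ 2 ^ s) (hs4 : (4 : ℝ) ≤ 2 ^ s) {bd : ℕ}
    (hbd : 3 * s + 8 * lam + 16 ≤ bd) :
    BitBound n k s bd (zVal s t am ad) (sumVal s w k * (n : ℝ) ^ k) (errVal n k s t am ad w) where
  index := by
    have h1 := P.k_le
    have hn : (1 : ℝ) ≤ n := by exact_mod_cast P.one_le
    have e1 : (n : ℝ) ≤ 2 ^ lam := by
      refine le_trans ?_ P.pow_le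
      exact le_self_pow₀ hn (by have := P.two_le; omega)
    have h2 : (1 : ℝ) ≤ 2 ^ lam := one_le_pow₀ (by norm_num)
    have h3 : (2 : ℝ) ^ (lam + 7) ≤ 2 ^ bd := pow_le_pow_right₀ (by norm_num) (by omega)
    rw [pow_add] at h3
    have h4 : (3 * k + 64 + n : ℝ) ≤ 2 ^ bd := by linarith
    exact_mod_cast h4
  scale := by omega
  horner := by
    have h1 := P.horner_bound Q hs hs4
    have h3 := P.zVal_pow_le Q hs
    have hZ : 0 ≤ zVal s t am ad := le_trans zero_le_one one_le_zVal
    calc _ ≤ (2 : ℝ) ^ (s + 6 * lam + 7) * (2 ^ (lam + 1) * 2 ^ s) := by gcongr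
      _ = 2 ^ (2 * s + 7 * lam + 8) := by
        rw [← pow_add, ← pow_add]; congr 1; ring
      _ ≤ _ := pow_le_pow_right₀ (by norm_num) (by omega)
  power := by
    have h3 := P.zVal_pow_le Q hs
    have hZ : 0 ≤ zVal s t am ad := le_trans zero_le_one one_le_zVal
    rw [mul_comm 2 n, pow_mul]
    calc _ ≤ ((2 : ℝ) ^ (lam + 1)) ^ 2 * 2 ^ (2 * s) := by gcongr
      _ = 2 ^ (2 * lam + 2 + 2 * s) := by
        rw [← pow_mul, ← pow_add]; congr 1; ring
      _ ≤ _ := pow_le_pow_right₀ (by norm_num) (by omega)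

end RoundAnalysis

/-! ## One round of the algorithm -/

/-- One step of the coefficient loop. -/
def coeffBody : Prog :=
  .seq (.arith .add (.reg 18) (rg 11) (cst 2)) <|
  .seq (.ask (.reg 12) (rg 18) (rg 4)) <|
  .seq (.ite (cst 0) (rg 12) (.arith .add (.reg 22) (rg 22) (rg 12))
    (.arith .sub (.reg 22) (rg 22) (rg 12))) <|
  .seq (.arith .add (.reg 22) (rg 22) (cst 2)) <|
  .seq (.arith .mul (.reg 23) (rg 23) (rg 0)) <|
  .arith .add (.reg 11) (rg 11) (cst 1)

/-- Evaluation at the point of index `i`, and update of the best point. -/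
def pointBody : Prog :=
  .seq (.arith .sub (.reg 8) (rg 7) (rg 2)) <|
  .seq (.arith .mul (.reg 8) (rg 8) (rg 6)) <|
  .seq (.arith .add (.reg 8) (rg 8) (rg 5)) <|
  .seq (.ite (cst 0) (rg 8) .skip (setReg 8 (cst 0))) <|
  .seq evalProg <|
  .seq (.ite (rg 10) (rg 20) .skip (.seq (setReg 20 (rg 10)) (setReg 21 (rg 7)))) <|
  .arith .add (.reg 7) (rg 7) (cst 1)

/-- Oracle queries and bounds for the coefficients. -/
def coeffProg : Prog :=
  .seq (.arith .add (.reg 3) (rg 3) (rg 3)) <|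
  .seq (.arith .sub (.reg 4) (rg 3) (cst 1)) <|
  .seq (.ask (.reg 5) (cst 0) (rg 4)) <|
  .seq (.ask (.reg 6) (cst 1) (rg 4)) <|
  .seq (.arith .shl (.reg 22) (cst 1) (rg 3)) <|
  .seq (setReg 23 (rg 0)) <|
  .seq (setReg 11 (cst 0)) <|
  .loop (rg 11) (rg 1) coeffBody

/-- The stopping threshold. -/
def thresholdProg : Prog :=
  .seq (.arith .mul (.reg 18) (rg 2) (rg 6)) <|
  .seq (.arith .add (.reg 24) (rg 5) (rg 18)) <|
  .seq (.arith .add (.reg 18) (rg 2) (cst 1)) <|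
  .seq (.arith .shl (.reg 18) (rg 18) (cst 2)) <|
  .seq (.arith .add (.reg 24) (rg 24) (rg 18)) <|
  .seq (.arith .shl (.reg 9) (cst 1) (rg 3)) <|
  .seq (.ite (rg 9) (rg 24) .skip (setReg 24 (rg 9))) <|
  .seq (setReg 17 (rg 24)) <|
  .seq (setReg 16 (rg 0)) <|
  .seq powProg <|
  .seq (.arith .mul (.reg 22) (rg 22) (rg 23)) <|
  .seq (.arith .mul (.reg 22) (rg 22) (rg 9)) <|
  .seq (.arith .mul (.reg 22) (rg 22) (rg 2)) <|
  .arith .mul (.reg 22) (rg 22) (cst 20)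

/-- The loop over all points, and the stopping test. -/
def searchProg : Prog :=
  .seq (.arith .add (.reg 24) (rg 2) (rg 2)) <|
  .seq (.arith .add (.reg 24) (rg 24) (cst 1)) <|
  .seq (setReg 20 (cst (-1))) <|
  .seq (setReg 7 (cst 0)) <|
  .seq (.loop (rg 7) (rg 24) pointBody) <|
  .seq (.arith .shl (.reg 18) (rg 20) (rg 3)) <|
  .seq (.arith .shl (.reg 18) (rg 18) (rg 3)) <|
  .ite (rg 18) (rg 22) .skip (setReg 25 (cst 1))

/-- One round. -/
def roundProg : Prog := .seq coeffProg (.seq thresholdProg searchProg)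

section Round

open Finset

variable {O : ℕ → ℕ → ℤ} {n k lam t s q bd : ℕ} {e : ℕ → ℕ} {c : ℕ → ℝ} {E : ℕ → ℤ}
  {m δ A : ℝ} {am ad : ℤ} {w : ℕ → ℤ}

theorem sumReg_succ (j : ℕ) : sumReg s w (j + 1) = sumReg s w j + |w j| + 2 := by
  rw [sumReg, sumReg, sum_range_succ]; ring

theorem sumReg_mono {i j : ℕ} (h : i ≤ j) : sumReg s w i ≤ sumReg s w j := by
  unfold sumReg
  have := sum_le_sum_of_subset_of_nonneg (range_subset_range.2 h)
    (f := fun l => |w l| + 2) fun _ _ _ => by positivity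
  linarith

theorem sumReg_nonneg (j : ℕ) : 0 ≤ sumReg s w j := by
  unfold sumReg
  have : 0 ≤ ∑ l ∈ range j, (|w l| + 2) := sum_nonneg fun _ _ => by positivity
  positivity

theorem coeffLoop_runs (hw : ∀ l < k, O (l + 2) q = w l) (hS : sumReg s w k ≤ 2 ^ bd)
    (hn : (n : ℤ) ^ (k + 1) ≤ 2 ^ bd) (hn1 : 1 ≤ n) (hq : q ≤ bd) (hk : (k + 2 : ℤ) ≤ 2 ^ bd)
    (d : ℕ) : ∀ (j : ℕ) (st : St), j + d = k → st.q = q → st.n = n → st.k = k → st.j = j →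
      st.S = sumReg s w j → st.N = (n : ℤ) ^ (j + 1) →
    ∃ u' w' : ℤ, Runs O bd (.loop (rg 11) (rg 1) coeffBody) (mem k E st) (mem k E {st with
      u := u', w := w', S := sumReg s w k, N := (n : ℤ) ^ (k + 1), j := k}) (8 * d + 1) := by
  induction d with
  | zero =>
    intro j st hj hqs hns hks hjs hSs hNs
    obtain rfl : j = k := by omega
    refine ⟨st.u, st.w, ?_⟩
    apply Runs.cast
    · exact Runs.loop_done (by simp [hjs, hks])
    · omega
    · congr 1
      rw [← hSs, ← hNs, ← hjs]
  | succ d ih =>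
    intro j st hj hqs hns hks hjs hSs hNs
    obtain ⟨u', w', r⟩ := ih (j + 1) {st with
      u := j + 2, w := w j, S := sumReg s w (j + 1), N := (n : ℤ) ^ (j + 1 + 1), j := (j + 1 : ℕ)}
      (by omega) hqs hns hks rfl rfl rfl
    have hj' : (j : ℤ) + 1 ≤ k := by exact_mod_cast (by omega : j + 1 ≤ k)
    have b1 := sumReg_succ (s := s) (w := w) j
    have b2 := (sumReg_mono (s := s) (w := w) (by omega : j + 1 ≤ k)).trans hS
    have b3 := sumReg_nonneg (s := s) (w := w) j
    have b4 := abs_nonneg (w j)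
    have c1 : |(j : ℤ) + 2| ≤ 2 ^ bd := by rw [abs_of_nonneg (by positivity)]; omega
    have c2 : |w j| ≤ 2 ^ bd := by omega
    have c3 : |sumReg s w j + (|w j|)| ≤ 2 ^ bd := by rw [abs_of_nonneg (by positivity)]; omega
    have c4 : |sumReg s w (j + 1)| ≤ 2 ^ bd := by
      rw [abs_of_nonneg (sumReg_nonneg _)]; exact b2
    have c5 : |(n : ℤ) ^ (j + 1 + 1)| ≤ 2 ^ bd := by
      rw [abs_of_nonneg (by positivity)]
      exact (pow_le_pow_right₀ (by exact_mod_cast hn1) (by omega)).trans hn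
    have c6 : |((j + 1 : ℕ) : ℤ)| ≤ 2 ^ bd := by
      rw [abs_of_nonneg (by positivity)]; push_cast; omega
    refine ⟨u', w', ?_⟩
    have r1 : Runs O bd (.ite (cst 0) (rg 12) (.arith .add (.reg 22) (rg 22) (rg 12))
        (.arith .sub (.reg 22) (rg 22) (rg 12))) (mem k E {st with u := j + 2, w := w j})
        (mem k E {st with u := j + 2, w := w j, S := sumReg s w j + |w j|}) 2 := by
      by_cases h0 : 0 ≤ w j
      · exact Runs.ite_true (by simpa using h0) (Runs.op c3 (upd_S k E _ _)
          (by simp [hSs, abs_of_nonneg h0]))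
      · exact Runs.ite_false (by simpa using h0) (Runs.op c3 (upd_S k E _ _)
          (by simp [hSs, abs_of_neg (not_le.1 h0), sub_eq_add_neg]))
    have r2 : Runs O bd coeffBody (mem k E st) (mem k E {st with
        u := j + 2, w := w j, S := sumReg s w (j + 1), N := (n : ℤ) ^ (j + 1 + 1)
        j := (j + 1 : ℕ)}) 7 := by
      apply Runs.cast
      · apply Runs.seq (Runs.op c1 (upd_u k E _ _) (by simp [hjs]))
        apply Runs.seq (Runs.query (i := j + 2) (q := q) c2 hq (upd_w k E _ _) (by simp)
          (by simp [hqs]) (hw j (by omega)))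
        apply Runs.seq r1
        apply Runs.seq (Runs.op c4 (upd_S k E _ _) (by simp [b1]))
        apply Runs.seq (Runs.op c5 (upd_N k E _ _) (by simp [hNs, hns, pow_succ]))
        exact Runs.op c6 (upd_j k E _ _) (by simp [hjs])
      · norm_num
      · simp
    exact (Runs.loop_step (by simp [hjs, hks]; omega) r2 r).mono (by omega)

theorem coeffProg_runs (hw : ∀ l < k, O (l + 2) q = w l) (hS : sumReg s w k ≤ 2 ^ bd)
    (hn : (n : ℤ) ^ (k + 1) ≤ 2 ^ bd) (hn1 : 1 ≤ n) (hsb : s ≤ bd) (hk : (k + 2 : ℤ) ≤ 2 ^ bd)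
    (hqs : q + 1 = s) (ham : O 0 q = am) (had : O 1 q = ad) (hamb : |am| ≤ 2 ^ bd)
    (hadb : |ad| ≤ 2 ^ bd) (st : St) (hs : st.s + st.s = s) (hns : st.n = n) (hks : st.k = k) :
    ∃ u' w' : ℤ, Runs O bd coeffProg (mem k E st) (mem k E {st with
      s := s, q := q, am := am, ad := ad
      u := u', w := w', S := sumReg s w k, N := (n : ℤ) ^ (k + 1), j := k}) (8 * k + 8) := by
  obtain ⟨u', w', r⟩ := coeffLoop_runs (E := E) hw hS hn hn1 (by omega) hk k 0 {st with
    s := s, q := q, am := am, ad := ad, S := sumReg s w 0, N := (n : ℤ) ^ (0 + 1), j := (0 : ℕ)}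
    (by omega) rfl hns hks rfl rfl rfl
  refine ⟨u', w', ?_⟩
  have hp : ∀ a ≤ bd, |(a : ℤ)| ≤ 2 ^ bd := fun a ha => by
    rw [abs_of_nonneg (by positivity)]
    have : a < 2 ^ a := Nat.lt_two_pow_self
    have : a ≤ 2 ^ bd := this.le.trans (Nat.pow_le_pow_right (by norm_num) ha)
    exact_mod_cast this
  have b1 : sumReg s w 0 = 2 ^ s := by simp [sumReg]
  have c1 : |sumReg s w 0| ≤ 2 ^ bd := by
    rw [abs_of_nonneg (sumReg_nonneg _)]; exact (sumReg_mono (Nat.zero_le k)).trans hS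
  have c2 : |(n : ℤ) ^ (0 + 1)| ≤ 2 ^ bd := by
    rw [abs_of_nonneg (by positivity)]
    exact (pow_le_pow_right₀ (by exact_mod_cast hn1) (by omega)).trans hn
  apply Runs.cast
  · apply Runs.seq (Runs.op (hp s hsb) (upd_s k E _ _) (by simpa using hs))
    apply Runs.seq (Runs.op (hp q (by omega)) (upd_q k E _ _) (by simp [← hqs]))
    apply Runs.seq (Runs.query (i := 0) (q := q) hamb (by omega) (upd_am k E _ _) (by simp)
        (by simp) ham)
    apply Runs.seq (Runs.query (i := 1) (q := q) hadb (by omega) (upd_ad k E _ _) (by simp)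
        (by simp) had)
    apply Runs.seq (Runs.op c1 (upd_S k E _ _) (by simp [b1]))
    apply Runs.seq (Runs.op c2 (upd_N k E _ _) (by simp [hns]))
    apply Runs.seq (Runs.op (v := (0 : ℕ)) (by simp) (upd_j k E _ _) (by simp))
    exact r
  · omega
  · rfl

/-- Bounds for the numbers of a round outside the evaluation. -/
structure RoundBound (n k s t bd : ℕ) (am ad : ℤ) (w : ℕ → ℤ) : Prop where
  am_le : |am| ≤ 2 ^ bd
  ad_le : |ad| ≤ 2 ^ bd
  t_le : ((t + 1) * 4 : ℤ) ≤ 2 ^ bd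
  lin_le : ∀ i ≤ 2 * t, |((i : ℤ) - t) * ad| ≤ 2 ^ bd
  lin_le' : ∀ i ≤ 2 * t, |((i : ℤ) - t) * ad + am| ≤ 2 ^ bd
  lin_le'' : |am + t * ad + (t + 1) * 4| ≤ 2 ^ bd
  z_le : |zReg s t am ad| ≤ 2 ^ bd
  thr_le : ∀ y : ℤ, 0 ≤ y → (y : ℝ) ≤ zVal s t am ad ^ n * 2 ^ s →
    sumReg s w k * (n : ℤ) ^ (k + 1) * y * t * 20 ≤ 2 ^ bd

theorem maxReg_runs (st : St) (hh : |st.y| ≤ 2 ^ bd) :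
    Runs O bd (.ite (rg 9) (rg 24) .skip (setReg 24 (rg 9)))
      (mem k E st) (mem k E {st with z := max st.y st.z}) 2 := by
  by_cases h1 : st.y ≤ st.z
  · rw [max_eq_right h1]
    exact Runs.ite_true (by simpa using h1) Runs.skip
  · rw [max_eq_left (by omega)]
    exact Runs.ite_false (by simpa using h1) (Runs.op hh (upd_z _ _ _ _) (by simp))

theorem clamp_runs (st : St) :
    Runs O bd (.ite (cst 0) (rg 8) .skip (setReg 8 (cst 0)))
      (mem k E st) (mem k E {st with x := max 0 st.x}) 2 := by
  by_cases h1 : 0 ≤ st.x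
  · rw [max_eq_right h1]
    exact Runs.ite_true (by simpa using h1) Runs.skip
  · rw [max_eq_left (by omega)]
    exact Runs.ite_false (by simpa using h1) (Runs.op (by simp) (upd_x _ _ _ _) (by simp))

theorem thresholdProg_runs (R : RoundBound n k s t bd am ad w) (hn : (n : ℤ) ≤ 2 ^ bd)
    (ht : 1 ≤ t) (hn1 : 1 ≤ n)
    (hpow : zVal s t am ad ^ (2 * n) * 2 ^ (2 * s) ≤ (2 : ℝ) ^ bd) (hsb : s ≤ bd)
    (st : St) (hs : st.s = s) (hns : st.n = n) (hts : st.t = t)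
    (ham : st.am = am) (had : st.ad = ad) (hS : st.S = sumReg s w k)
    (hN : st.N = (n : ℤ) ^ (k + 1)) :
    ∃ y' b' u' v' : ℤ, Runs O bd thresholdProg (mem k E st) (mem k E {st with
      y := y', b := b', u := u', v := v', g := 0, z := zReg s t am ad
      S := sumReg s w k * (n : ℤ) ^ (k + 1) * y' * t * 20}) (9 * n.size + 20) ∧
      Apx s (zVal s t am ad) (zVal s t am ad) n n y' := by
  have hs2 : (2 : ℤ) ^ s ≤ 2 ^ bd := pow_le_pow_right₀ (by norm_num) hsb
  obtain ⟨y', b', u', v', r, hy⟩ := powProg_runs (O := O) (bd := bd) (K := k) (E := E) (s := s)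
    (x := zVal s t am ad) (Z := zVal s t am ad) one_le_zVal n {st with
      u := (t + 1) * 4, z := zReg s t am ad, y := 2 ^ s, b := zReg s t am ad, g := n} hs rfl hn
    (by exact_mod_cast hs2)
    (by
      have : (2 : ℤ) ^ s ≤ zReg s t am ad := le_max_left _ _
      exact le_trans (by positivity) this)
    zVal_mul.symm le_rfl hpow
  refine ⟨y', b', u', v', ?_, hy⟩
  have hthr := R.thr_le y' hy.1 hy.2.1
  have h1 := sumReg_nonneg (s := s) (w := w) k
  have h2 := hy.1
  have h1t : (1 : ℤ) ≤ t := by exact_mod_cast ht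
  have h1n : (1 : ℤ) ≤ (n : ℤ) ^ (k + 1) := one_le_pow₀ (by exact_mod_cast hn1)
  have d1 : sumReg s w k * (n : ℤ) ^ (k + 1) * y' * t
      ≤ sumReg s w k * (n : ℤ) ^ (k + 1) * y' * t * 20 :=
    le_mul_of_one_le_right (by positivity) (by norm_num)
  have d2 : sumReg s w k * (n : ℤ) ^ (k + 1) * y' ≤ sumReg s w k * (n : ℤ) ^ (k + 1) * y' * t :=
    le_mul_of_one_le_right (by positivity) h1t
  have hz1 : (1 : ℝ) ≤ zVal s t am ad := one_le_zVal
  have d3 : sumReg s w k * (n : ℤ) ^ (k + 1) ≤ 2 ^ bd := by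
    have h3 := R.thr_le 1 (by norm_num) (by
      push_cast
      exact one_le_mul_of_one_le_of_one_le (one_le_pow₀ hz1) (one_le_pow₀ (by norm_num)))
    have h4 : (1 : ℤ) ≤ t * 20 := by omega
    calc sumReg s w k * (n : ℤ) ^ (k + 1) ≤ sumReg s w k * (n : ℤ) ^ (k + 1) * (t * 20) :=
          le_mul_of_one_le_right (by positivity) h4
      _ ≤ 2 ^ bd := by rw [mul_one] at h3; rw [← mul_assoc]; exact h3
  have c0 : |(t : ℤ) * ad| ≤ 2 ^ bd := by
    have := R.lin_le (2 * t) le_rfl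
    have h3 : (((2 * t : ℕ) : ℤ) - t) = t := by push_cast; ring
    rwa [h3] at this
  have c1 : |am + t * ad| ≤ 2 ^ bd := by
    have := R.lin_le' (2 * t) le_rfl
    have h3 : (((2 * t : ℕ) : ℤ) - t) = t := by push_cast; ring
    rw [h3] at this
    rwa [add_comm]
  have ht4 := R.t_le
  have c2 : |(t : ℤ) + 1| ≤ 2 ^ bd := by rw [abs_of_nonneg (by positivity)]; omega
  have c3 : |((t : ℤ) + 1) * 4| ≤ 2 ^ bd := by rw [abs_of_nonneg (by positivity)]; omega
  have c4 : |(2 : ℤ) ^ s| ≤ 2 ^ bd := by rw [abs_of_nonneg (by positivity)]; exact hs2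
  apply Runs.cast
  · apply Runs.seq (Runs.op c0 (upd_u k E _ _) (by simp [hts, had]))
    apply Runs.seq (Runs.op c1 (upd_z k E _ _) (by simp [ham]))
    apply Runs.seq (Runs.op c2 (upd_u k E _ _) (by simp [hts]))
    apply Runs.seq (Runs.op c3 (upd_u k E _ _) (by simp))
    apply Runs.seq (Runs.op R.lin_le'' (upd_z k E _ _) (by simp))
    apply Runs.seq (Runs.op c4 (upd_y k E _ _) (by simp [hs]))
    apply Runs.seq (M' := mem k E {st with
      u := (t + 1) * 4, z := zReg s t am ad, y := 2 ^ s})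
      (Runs.cast (maxReg_runs _ (by simpa using c4)) le_rfl (by simp [zReg]))
    apply Runs.seq (Runs.op R.z_le (upd_b k E _ _) (by simp))
    apply Runs.seq (Runs.op (v := n) (by rw [abs_of_nonneg (by positivity)]; exact hn)
      (upd_g k E _ _) (by simp [hns]))
    apply Runs.seq r
    apply Runs.seq (Runs.op (v := sumReg s w k * (n : ℤ) ^ (k + 1))
      (by rw [abs_of_nonneg (by positivity)]; exact d3)
      (upd_S k E _ _) (by simp [hS, hN]))
    apply Runs.seq (Runs.op (v := sumReg s w k * (n : ℤ) ^ (k + 1) * y')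
      (by rw [abs_of_nonneg (by positivity)]; omega)
      (upd_S k E _ _) (by simp))
    apply Runs.seq (Runs.op (v := sumReg s w k * (n : ℤ) ^ (k + 1) * y' * t)
      (by rw [abs_of_nonneg (by positivity)]; omega)
      (upd_S k E _ _) (by simp [hts]))
    exact Runs.op (v := sumReg s w k * (n : ℤ) ^ (k + 1) * y' * t * 20)
      (by rw [abs_of_nonneg (by positivity)]; omega)
      (upd_S k E _ _) (by simp)
  · omega
  · rfl

end Round

section Search

open Finset

variable {O : ℕ → ℕ → ℤ} {n k lam t s q bd : ℕ} {e : ℕ → ℕ} {c : ℕ → ℝ} {E : ℕ → ℤ}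
  {m δ A : ℝ} {am ad : ℤ} {w : ℕ → ℤ}

theorem Instance.A_le (P : Instance n k lam t e c m δ A) : A ≤ 2 ^ lam :=
  (le_self_pow₀ P.one_le_A (by have := P.one_le; omega)).trans P.A_pow_le

theorem Instance.center_le (P : Instance n k lam t e c m δ A) : |m| ≤ 2 ^ lam := by
  have h1 := P.pos t (by omega)
  have h2 := P.le t (by omega)
  simp only [multiPt, sub_self, zero_mul, add_zero] at h1 h2
  rw [abs_of_pos h1]
  exact h2.trans P.A_le

theorem Instance.t_step_le (P : Instance n k lam t e c m δ A) : t * δ ≤ 2 ^ lam := by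
  have h1 := P.pos t (by omega)
  have h2 := P.le (2 * t) le_rfl
  have h3 : ((2 * t : ℕ) : ℝ) - t = t := by push_cast; ring
  simp only [multiPt, sub_self, zero_mul, add_zero] at h1
  rw [multiPt, h3] at h2
  linarith [P.A_le]

theorem Instance.n_le (P : Instance n k lam t e c m δ A) : (n : ℝ) ≤ 2 ^ lam :=
  (le_self_pow₀ (by exact_mod_cast P.one_le) (by have := P.two_le; omega)).trans P.pow_le

theorem Instance.roundBound (P : Instance n k lam t e c m δ A) (Q : Answers k s c m δ am ad w)
    (hs : (12 * n * (t + 1) : ℝ) ≤ 2 ^ s) (hs4 : (4 : ℝ) ≤ 2 ^ s)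
    (hbd : 3 * s + 8 * lam + 16 ≤ bd) : RoundBound n k s t bd am ad w := by
  have h0 : (0 : ℝ) < 2 ^ s := by positivity
  have hl : (1 : ℝ) ≤ 2 ^ lam := one_le_pow₀ (by norm_num)
  have ht := P.t_le
  have ht0 : (0 : ℝ) ≤ t := Nat.cast_nonneg t
  have hA := P.A_le
  have big : 2 ^ lam * 2 ^ s + 16 * 2 ^ lam ≤ (2 : ℝ) ^ bd := by
    have h1 : (2 : ℝ) ^ (lam + s + 4) ≤ 2 ^ bd := pow_le_pow_right₀ (by norm_num) (by omega)
    rw [pow_add, pow_add] at h1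
    have h2 : (2 : ℝ) ^ lam * 4 ≤ 2 ^ lam * 2 ^ s := by gcongr
    linarith
  have hx : ∀ i ≤ 2 * t, |multiPt m t δ i * 2 ^ s| ≤ 2 ^ lam * 2 ^ s := fun i hi => by
    have h1 := P.pos i hi
    have h2 := (P.le i hi).trans hA
    rw [abs_of_pos (by positivity)]
    gcongr
  refine ⟨?_, ?_, ?_, ?_, ?_, ?_, ?_, ?_⟩
  · have h1 := abs_sub_abs_le_abs_sub (am : ℝ) (m * 2 ^ s)
    rw [abs_mul, abs_of_pos h0] at h1
    have h2 : |m| * 2 ^ s ≤ 2 ^ lam * 2 ^ s := by have := P.center_le; gcongr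
    exact int_abs_le_of_real (r := 2 ^ lam * 2 ^ s + 16 * 2 ^ lam) (by linarith [Q.center]) big
  · have h1 := abs_sub_abs_le_abs_sub (ad : ℝ) (δ * 2 ^ s)
    have hδ := P.step_pos
    rw [abs_of_pos (by positivity : 0 < δ * 2 ^ s)] at h1
    have h3 : δ ≤ 2 ^ lam := by
      have h4 : (1 : ℝ) ≤ t := by exact_mod_cast (by have := P.four_le; omega : 1 ≤ t)
      exact (le_mul_of_one_le_left hδ.le h4).trans P.t_step_le
    have h2 : δ * 2 ^ s ≤ 2 ^ lam * 2 ^ s := by gcongr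
    exact int_abs_le_of_real (r := 2 ^ lam * 2 ^ s + 16 * 2 ^ lam) (by linarith [Q.step]) big
  · have h1 : ((t : ℝ) + 1) * 4 ≤ 2 ^ bd := by
      have : (0 : ℝ) ≤ 2 ^ lam * 2 ^ s := by positivity
      linarith
    exact_mod_cast h1
  · intro i hi
    refine int_abs_le_of_real (r := 2 ^ lam * 2 ^ s + 16 * 2 ^ lam) ?_ big
    have h2 : |(i : ℝ) - t| ≤ t := by
      have : (i : ℝ) ≤ 2 * t := by exact_mod_cast hi
      rw [abs_le]; constructor <;> linarith [(Nat.cast_nonneg i : (0 : ℝ) ≤ i)]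
    push_cast
    rw [abs_mul]
    have h1 := abs_sub_abs_le_abs_sub (ad : ℝ) (δ * 2 ^ s)
    have hδ := P.step_pos
    rw [abs_of_pos (by positivity : 0 < δ * 2 ^ s)] at h1
    have h3 : |(ad : ℝ)| ≤ δ * 2 ^ s + 2 := by linarith [Q.step]
    calc |(i : ℝ) - t| * |(ad : ℝ)| ≤ t * (δ * 2 ^ s + 2) := by gcongr
      _ = (t * δ) * 2 ^ s + 2 * t := by ring
      _ ≤ 2 ^ lam * 2 ^ s + 16 * 2 ^ lam := by
        have := P.t_step_le
        gcongr
        norm_num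
  · intro i hi
    have h1 := abs_linear_le (t := t) Q hi
    have h2 := abs_sub_abs_le_abs_sub ((((i : ℤ) - t) * ad + am : ℤ) : ℝ)
      (multiPt m t δ i * 2 ^ s)
    exact int_abs_le_of_real (r := 2 ^ lam * 2 ^ s + 16 * 2 ^ lam) (by linarith [hx i hi]) big
  · have h1 := abs_linear_le (t := t) Q (le_refl (2 * t))
    have h2 := hx (2 * t) le_rfl
    refine int_abs_le_of_real (r := 2 ^ lam * 2 ^ s + 16 * 2 ^ lam) ?_ big
    push_cast at h1 ⊢
    rw [abs_le] at h1 h2 ⊢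
    constructor <;> linarith
  · have h1 := P.zReg_le Q
    have h2 : A * 2 ^ s ≤ 2 ^ lam * 2 ^ s := by gcongr
    refine abs_le_pow_of_real ?_ (r := 2 ^ lam * 2 ^ s + 16 * 2 ^ lam) (by linarith) big
    exact le_trans (by positivity) (le_max_left _ _)
  · intro y hy0 hy
    have h1 := P.sumVal_le Q hs4
    have h2 := P.n_pow_succ_le
    have h3 := P.zVal_pow_le Q hs
    have hS : 0 ≤ sumVal s w k := le_trans zero_le_one one_le_sumVal
    have hy0' : (0 : ℝ) ≤ y := by exact_mod_cast hy0
    have hy' : (y : ℝ) ≤ 2 ^ (lam + 1) * 2 ^ s := hy.trans (by gcongr)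
    have key : ((sumReg s w k * (n : ℤ) ^ (k + 1) * y * t * 20 : ℤ) : ℝ) ≤ 2 ^ bd := by
      push_cast
      rw [← sumVal_mul]
      calc sumVal s w k * 2 ^ s * (n : ℝ) ^ (k + 1) * y * t * 20
          ≤ 2 ^ (2 * lam + 2) * 2 ^ s * 2 ^ (2 * lam) * (2 ^ (lam + 1) * 2 ^ s) * 2 ^ lam * 2 ^ 5 := by
            gcongr
            norm_num
        _ = 2 ^ (2 * s + 6 * lam + 8) := by
            simp only [← pow_add]; congr 1; ring
        _ ≤ _ := pow_le_pow_right₀ (by norm_num) (by omega)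
    exact_mod_cast key

/-- The registers that the search leaves alone. -/
structure Keeps (st st' : St) : Prop where
  n : st'.n = st.n
  k : st'.k = st.k
  t : st'.t = st.t
  s : st'.s = st.s
  q : st'.q = st.q
  am : st'.am = st.am
  ad : st'.ad = st.ad
  S : st'.S = st.S
  z : st'.z = st.z
  flag : st'.flag = st.flag

theorem Keeps.trans {st st' st'' : St} (h : Keeps st st') (h' : Keeps st' st'') : Keeps st st'' :=
  ⟨h'.n.trans h.n, h'.k.trans h.k, h'.t.trans h.t, h'.s.trans h.s, h'.q.trans h.q,
    h'.am.trans h.am, h'.ad.trans h.ad, h'.S.trans h.S, h'.z.trans h.z, h'.flag.trans h.flag⟩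

/-- The invariant of the search: `best` is the largest computed value among the first `i` points,
and it is attained at the point of index `bi`. -/
structure SearchInv (k s : ℕ) (e : ℕ → ℕ) (c : ℕ → ℝ) (pt : ℕ → ℝ) (R V : ℝ) (i : ℕ)
    (best bi : ℤ) : Prop where
  neg_one_le : -1 ≤ best
  start : i = 0 → best = -1
  le : (best : ℝ) ≤ V
  arg : 0 < i → ∃ b < i, bi = b ∧ ∀ a < k, (best : ℝ) ≤ |fracVal e c k a (pt b)| * 2 ^ s + R
  max : ∀ i' < i, ∃ a < k, |fracVal e c k a (pt i')| * 2 ^ s - R ≤ best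

theorem pointBody_runs (P : Instance n k lam t e c m δ A) (Q : Answers k s c m δ am ad w)
    (T : ExpTable k e E) (hs : (12 * n * (t + 1) : ℝ) ≤ 2 ^ s) (hs4 : (4 : ℝ) ≤ 2 ^ s)
    (hbd : 3 * s + 8 * lam + 16 ≤ bd) (hqs : q + 1 = s) (hO : ∀ l < k, O (l + 2) q = w l)
    (st : St) (i : ℕ) (hi : i ≤ 2 * t) (hss : st.s = s) (hsq : st.q = q) (hsk : st.k = k)
    (hst : st.t = t) (ham : st.am = am) (had : st.ad = ad) (hsi : st.i = i)
    (I : SearchInv k s e c (multiPt m t δ) (errVal n k s t am ad w) (2 ^ (s + 6 * lam + 7)) i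
      st.best st.bi) :
    ∃ st' : St, Runs O bd pointBody (mem k E st) (mem k E st')
      ((13 * k + 9 * n.size + 21) * k + 13) ∧ Keeps st st' ∧ st'.i = (i + 1 : ℕ) ∧
      SearchInv k s e c (multiPt m t δ) (errVal n k s t am ad w) (2 ^ (s + 6 * lam + 7)) (i + 1)
        st'.best st'.bi := by
  have RB := P.roundBound Q hs hs4 hbd
  have B := P.bitBound Q hs hs4 hbd
  have d := P.evalData Q hi
  obtain ⟨y', b', u', v', p', a', w', h', mn', g', H', r, f0, ⟨a₁, ha₁, f1⟩, f2⟩ :=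
    evalProg_runs (O := O) (E := E) d P.toSized B T P.exp_zero hqs
      (fun J hJ => by rw [hO J hJ]; exact Q.coeff J hJ) {st with x := ptReg t am ad i}
      hss hsq hsk rfl
  dsimp only at r
  have hk := P.two_le
  have ht4 := RB.t_le
  have hmnV : (mn' : ℝ) ≤ 2 ^ (s + 6 * lam + 7) := by
    refine le_trans ?_ (P.horner_bound Q hs hs4)
    have h1 := f2 0 (by omega)
    have h3 := abs_hornerTail_le P.toSized (a := 0) (j := 0) d.x_nonneg d.x_le d.one_le
      (d.sum_le 0 0 le_rfl (Nat.zero_le k))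
    rw [hornerTail_self] at h3
    have hZ : zVal s t am ad ^ (e (k - 1) - e 0) ≤ zVal s t am ad ^ n :=
      pow_le_pow_right₀ d.one_le ((Nat.sub_le _ _).trans (P.exp_le _ (by omega)))
    have hS := d.S_nonneg
    have h4 : |fracVal e c k 0 (multiPt m t δ i)| * 2 ^ s
        ≤ sumVal s w k * (n : ℝ) ^ k * zVal s t am ad ^ n * 2 ^ s := by
      gcongr
      exact h3.trans (by gcongr)
    linarith
  have hVb : (2 : ℝ) ^ (s + 6 * lam + 7) ≤ 2 ^ bd := pow_le_pow_right₀ (by norm_num) (by omega)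
  have cmn : |mn'| ≤ 2 ^ bd := abs_le_pow_of_real f0 hmnV hVb
  have hi' : (i : ℤ) ≤ 2 * t := by exact_mod_cast hi
  have ci : |(i : ℤ)| ≤ 2 ^ bd := by rw [abs_of_nonneg (by positivity)]; omega
  have ci1 : |((i + 1 : ℕ) : ℤ)| ≤ 2 ^ bd := by
    rw [abs_of_nonneg (by positivity)]; push_cast; omega
  have cit : |(i : ℤ) - t| ≤ 2 ^ bd := by
    rw [abs_le]; constructor <;> omega
  obtain ⟨st1, r1, K1, hi1, I1⟩ : ∃ st1 : St, Runs O bd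
      (.ite (rg 10) (rg 20) .skip (.seq (setReg 20 (rg 10)) (setReg 21 (rg 7))))
      (mem k E {st with
        x := ptReg t am ad i, y := y', b := b', u := u', v := v', p := p', a := a', w := w', h := h'
        mn := mn', H := H', g := g', j := 0}) (mem k E st1) 3 ∧ Keeps st st1 ∧ st1.i = i ∧
      SearchInv k s e c (multiPt m t δ) (errVal n k s t am ad w) (2 ^ (s + 6 * lam + 7)) (i + 1)
        st1.best st1.bi := by
    by_cases hb : mn' ≤ st.best
    · refine ⟨{st with
        x := ptReg t am ad i, y := y', b := b', u := u', v := v', p := p', a := a', w := w', h := h'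
        mn := mn', H := H', g := g', j := 0},
        (Runs.ite_true (by simpa using hb) Runs.skip).mono (by norm_num),
        ⟨rfl, rfl, rfl, rfl, rfl, rfl, rfl, rfl, rfl, rfl⟩, hsi, I.neg_one_le, fun h => absurd h (by omega), I.le, fun _ => ?_,
        fun i' hi' => ?_⟩
      · have hi0 : 0 < i := by
          by_contra h0
          have := I.start (by omega)
          omega
        obtain ⟨b, hb1, hb2, hb3⟩ := I.arg hi0
        exact ⟨b, by omega, hb2, hb3⟩
      · rcases Nat.eq_or_lt_of_le (Nat.lt_succ_iff.1 hi') with rfl | hi'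
        · have : (mn' : ℝ) ≤ st.best := by exact_mod_cast hb
          exact ⟨a₁, ha₁, by simpa using f1.trans this⟩
        · exact I.max i' hi'
    · refine ⟨({st with
        x := ptReg t am ad i, y := y', b := b', u := u', v := v', p := p', a := a', w := w', h := h'
        mn := mn', H := H', g := g', j := 0}.set_best mn').set_bi i,
        Runs.ite_false (by simpa using hb) (Runs.seq (Runs.op cmn (upd_best k E _ _)
        (by simp)) (Runs.op ci (upd_bi k E _ _) (by simp [hsi]))),
        ⟨rfl, rfl, rfl, rfl, rfl, rfl, rfl, rfl, rfl, rfl⟩, hsi, ?_, fun h => absurd h (by omega), ?_, fun _ => ?_,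
        fun i' hi' => ?_⟩
      · change -1 ≤ mn'; omega
      · exact hmnV
      · exact ⟨i, by omega, rfl, f2⟩
      · rcases Nat.eq_or_lt_of_le (Nat.lt_succ_iff.1 hi') with rfl | hi'
        · exact ⟨a₁, ha₁, f1⟩
        · obtain ⟨a, ha, h1⟩ := I.max i' hi'
          have h2 : (st.best : ℝ) ≤ mn' := by exact_mod_cast (not_le.1 hb).le
          exact ⟨a, ha, h1.trans h2⟩
  refine ⟨{st1 with i := (i + 1 : ℕ)}, ?_, ⟨K1.n, K1.k, K1.t, K1.s, K1.q, K1.am, K1.ad, K1.S, K1.z,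
    K1.flag⟩, rfl, I1⟩
  apply Runs.cast
  · apply Runs.seq (Runs.op cit (upd_x k E _ _) (by simp [hsi, hst]))
    apply Runs.seq (Runs.op (RB.lin_le i hi) (upd_x k E _ _) (by simp [had]))
    apply Runs.seq (Runs.op (RB.lin_le' i hi) (upd_x k E _ _) (by simp [ham]))
    apply Runs.seq (M' := mem k E {st with x := ptReg t am ad i})
      (Runs.cast (clamp_runs _) le_rfl (by simp [ptReg]))
    apply Runs.seq r
    apply Runs.seq r1
    exact Runs.op ci1 (upd_i k E _ _) (by simp [hi1])
  · omega
  · simp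

end Search

section RoundCorrect

open Finset

variable {O : ℕ → ℕ → ℤ} {n k lam t s q bd : ℕ} {e : ℕ → ℕ} {c : ℕ → ℝ} {E : ℕ → ℤ}
  {m δ A : ℝ} {am ad : ℤ} {w : ℕ → ℤ}

theorem searchLoop_runs (P : Instance n k lam t e c m δ A) (Q : Answers k s c m δ am ad w)
    (T : ExpTable k e E) (hs : (12 * n * (t + 1) : ℝ) ≤ 2 ^ s) (hs4 : (4 : ℝ) ≤ 2 ^ s)
    (hbd : 3 * s + 8 * lam + 16 ≤ bd) (hqs : q + 1 = s) (hO : ∀ l < k, O (l + 2) q = w l)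
    (r : ℕ) : ∀ (st : St) (i : ℕ), i + r = 2 * t + 1 → st.s = s → st.q = q → st.k = k →
    st.t = t → st.am = am → st.ad = ad → st.i = i → st.z = 2 * t + 1 →
    SearchInv k s e c (multiPt m t δ) (errVal n k s t am ad w) (2 ^ (s + 6 * lam + 7)) i
      st.best st.bi →
    ∃ st' : St, Runs O bd (.loop (rg 7) (rg 24) pointBody) (mem k E st) (mem k E st')
      (((13 * k + 9 * n.size + 21) * k + 14) * r + 1) ∧ Keeps st st' ∧
      SearchInv k s e c (multiPt m t δ) (errVal n k s t am ad w) (2 ^ (s + 6 * lam + 7)) (2 * t + 1)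
        st'.best st'.bi := by
  induction r with
  | zero =>
    intro st i hi hss hsq hsk hst ham had hsi hsz I
    obtain rfl : i = 2 * t + 1 := by omega
    exact ⟨st, (Runs.loop_done (by simp [hsi, hsz])).mono (by omega),
      ⟨rfl, rfl, rfl, rfl, rfl, rfl, rfl, rfl, rfl, rfl⟩, I⟩
  | succ r ih =>
    intro st i hi hss hsq hsk hst ham had hsi hsz I
    obtain ⟨st1, r1, K1, hi1, I1⟩ := pointBody_runs P Q T hs hs4 hbd hqs hO st i (by omega) hss hsq
      hsk hst ham had hsi I
    obtain ⟨st2, r2, K2, I2⟩ := ih st1 (i + 1) (by omega) (K1.s.trans hss) (K1.q.trans hsq)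
      (K1.k.trans hsk) (K1.t.trans hst) (K1.am.trans ham) (K1.ad.trans had) hi1 (K1.z.trans hsz) I1
    refine ⟨st2, (Runs.loop_step ?_ r1 r2).mono ?_, K1.trans K2, I2⟩
    · have : (i : ℤ) + r + 1 = 2 * t + 1 := by exact_mod_cast hi
      simp only [Operand.val, mem_i, mem_z, hsi, hsz]; omega
    · rw [mul_add]; omega

/-- The admissible index found by a successful round. -/
def Good (k t : ℕ) (e : ℕ → ℕ) (c : ℕ → ℝ) (m δ : ℝ) (b : ℕ) : Prop :=
  b ≤ 2 * t ∧ ∀ i ≤ 2 * t, ∃ a < k, ∀ a' < k,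
    1 / 8 * |fracVal e c k a (multiPt m t δ i)| ≤ |fracVal e c k a' (multiPt m t δ b)|

theorem SearchInv.good {best bi : ℤ} {R V : ℝ}
    (I : SearchInv k s e c (multiPt m t δ) R V (2 * t + 1) best bi) (hR : 0 ≤ R)
    (hbest : 2 * R < best) : ∃ b : ℕ, bi = b ∧ Good k t e c m δ b := by
  obtain ⟨b, hb, hbi, h1⟩ := I.arg (by omega)
  have h0 : (0 : ℝ) < 2 ^ s := by positivity
  refine ⟨b, hbi, by omega, fun i hi => ?_⟩
  obtain ⟨a, ha, h2⟩ := I.max i (by omega)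
  refine ⟨a, ha, fun a' ha' => ?_⟩
  have h3 := h1 a' ha'
  refine le_of_mul_le_mul_right ?_ h0
  linarith

theorem searchProg_runs (P : Instance n k lam t e c m δ A) (Q : Answers k s c m δ am ad w)
    (T : ExpTable k e E) (hs : (12 * n * (t + 1) : ℝ) ≤ 2 ^ s) (hs4 : (4 : ℝ) ≤ 2 ^ s)
    (hbd : 3 * s + 8 * lam + 16 ≤ bd) (hqs : q + 1 = s) (hO : ∀ l < k, O (l + 2) q = w l)
    (st : St) (hss : st.s = s) (hsq : st.q = q) (hsk : st.k = k)
    (hst : st.t = t) (ham : st.am = am) (had : st.ad = ad) (hf : st.flag = 0) :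
    ∃ st' : St, Runs O bd searchProg (mem k E st) (mem k E st')
      (((13 * k + 9 * n.size + 21) * k + 14) * (2 * t + 1) + 9) ∧
      st'.n = st.n ∧ st'.k = st.k ∧ st'.t = st.t ∧ st'.s = st.s ∧
      SearchInv k s e c (multiPt m t δ) (errVal n k s t am ad w) (2 ^ (s + 6 * lam + 7)) (2 * t + 1)
        st'.best st'.bi ∧
      (st'.flag = 0 ∧ st'.best * 2 ^ s * 2 ^ s ≤ st.S ∨
        st'.flag = 1 ∧ st.S < st'.best * 2 ^ s * 2 ^ s) := by
  have RB := P.roundBound Q hs hs4 hbd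
  have ht4 := RB.t_le
  obtain ⟨st1, r1, K, I⟩ := searchLoop_runs (E := E) (O := O) P Q T hs hs4 hbd hqs hO (2 * t + 1)
    {st with z := 2 * t + 1, best := -1, i := (0 : ℕ)} 0 (by omega) hss hsq hsk hst ham had rfl rfl
    ⟨le_rfl, fun _ => rfl, by
      have : (0 : ℝ) ≤ 2 ^ (s + 6 * lam + 7) := by positivity
      push_cast; linarith, fun h => absurd h (by omega), fun i' h => absurd h (by omega)⟩
  have c0 : |(t : ℤ) + t| ≤ 2 ^ bd := by rw [abs_of_nonneg (by positivity)]; omega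
  have c1 : |2 * (t : ℤ) + 1| ≤ 2 ^ bd := by rw [abs_of_nonneg (by positivity)]; omega
  have c2 : |(-1 : ℤ)| ≤ 2 ^ bd := by rw [abs_neg, abs_one]; exact one_le_pow₀ (by norm_num)
  have hV : |(st1.best : ℝ)| ≤ 2 ^ (s + 6 * lam + 7) := by
    have h1 : (-1 : ℝ) ≤ st1.best := by exact_mod_cast I.neg_one_le
    have h2 : (1 : ℝ) ≤ 2 ^ (s + 6 * lam + 7) := one_le_pow₀ (by norm_num)
    rw [abs_le]
    exact ⟨by linarith, I.le⟩
  have c4 : |st1.best * 2 ^ s * 2 ^ s| ≤ 2 ^ bd := by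
    refine int_abs_le_of_real (r := 2 ^ (s + 6 * lam + 7) * 2 ^ s * 2 ^ s) ?_ ?_
    · push_cast
      rw [abs_mul, abs_mul, abs_of_pos (by positivity : (0 : ℝ) < 2 ^ s)]
      gcongr
    · rw [← pow_add, ← pow_add]
      exact pow_le_pow_right₀ (by norm_num) (by omega)
  have c3 : |st1.best * 2 ^ s| ≤ 2 ^ bd := by
    refine le_trans ?_ c4
    rw [abs_mul (st1.best * 2 ^ s)]
    exact le_mul_of_one_le_right (abs_nonneg _) (by
      rw [abs_of_pos (by positivity)]; exact one_le_pow₀ (by norm_num))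
  have hs1 : st1.s = s := K.s.trans hss
  have pre : ∀ {M' N}, Runs O bd (.ite (rg 18) (rg 22) .skip (setReg 25 (cst 1)))
      (mem k E {st1 with u := st1.best * 2 ^ s * 2 ^ s}) M' N →
      Runs O bd searchProg (mem k E st) M'
        (((13 * k + 9 * n.size + 21) * k + 14) * (2 * t + 1) + 7 + N) := by
    intro M' N hM
    apply Runs.cast
    · apply Runs.seq (Runs.op c0 (upd_z k E _ _) (by simp [hst]))
      apply Runs.seq (Runs.op c1 (upd_z k E _ _) (by simp; ring))
      apply Runs.seq (Runs.op c2 (upd_best k E _ _) (by simp))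
      apply Runs.seq (Runs.op (v := (0 : ℕ)) (by simp) (upd_i k E _ _) (by simp))
      apply Runs.seq r1
      apply Runs.seq (Runs.op c3 (upd_u k E _ _) (by simp [hs1]))
      apply Runs.seq (M' := mem k E {st1 with u := st1.best * 2 ^ s * 2 ^ s})
        (Runs.cast (Runs.op c4 (upd_u k E _ _) (by simp [hs1])) le_rfl (by simp))
      exact hM
    · omega
    · rfl
  by_cases hb : st1.best * 2 ^ s * 2 ^ s ≤ st.S
  · refine ⟨{st1 with u := st1.best * 2 ^ s * 2 ^ s}, (pre (Runs.ite_true ?_ Runs.skip)).mono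
      (by omega), K.n, K.k, K.t, K.s, I, Or.inl ⟨K.flag.trans hf, hb⟩⟩
    have := K.S
    dsimp only at this
    simpa [this] using hb
  · refine ⟨({st1 with u := st1.best * 2 ^ s * 2 ^ s} : St).set_flag 1, (pre (Runs.ite_false ?_
      (Runs.op (by rw [abs_one]; exact one_le_pow₀ (by norm_num)) (upd_flag k E _ _)
        (by simp)))).mono (by omega), K.n, K.k, K.t, K.s, I, Or.inr ⟨rfl, not_le.1 hb⟩⟩
    have := K.S
    dsimp only at this
    simpa [this] using hb

/-- The number of instructions in a round. -/
def roundSteps (n k t : ℕ) : ℕ :=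
  8 * k + 8 + (9 * n.size + 20 + (((13 * k + 9 * n.size + 21) * k + 14) * (2 * t + 1) + 9))

theorem Instance.errVal_nonneg : 0 ≤ errVal n k s t am ad w := by
  have hZ : 0 ≤ zVal s t am ad := le_trans zero_le_one one_le_zVal
  have hS : 0 ≤ sumVal s w k := le_trans zero_le_one one_le_sumVal
  unfold errVal
  positivity

/-- The stopping threshold lies between twice and four times the error bound. -/
theorem threshold_bounds {y : ℤ}
    (hs : (12 * n * (t + 1) : ℝ) ≤ 2 ^ s) (hy : Apx s (zVal s t am ad) (zVal s t am ad) n n y) :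
    2 * errVal n k s t am ad w * (2 ^ s * 2 ^ s)
      ≤ (sumReg s w k * (n : ℤ) ^ (k + 1) * y * t * 20 : ℤ) ∧
    ((sumReg s w k * (n : ℤ) ^ (k + 1) * y * t * 20 : ℤ) : ℝ)
      ≤ 4 * errVal n k s t am ad w * (2 ^ s * 2 ^ s) := by
  have h0 : (0 : ℝ) < 2 ^ s := by positivity
  have hZ1 : 1 ≤ zVal s t am ad := one_le_zVal
  have hZ : 1 ≤ zVal s t am ad ^ n := one_le_pow₀ hZ1
  have hS : 0 ≤ sumVal s w k := le_trans zero_le_one one_le_sumVal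
  have ht : (0 : ℝ) ≤ t := Nat.cast_nonneg t
  have hn : (0 : ℝ) ≤ n := Nat.cast_nonneg n
  have h1 : zVal s t am ad ^ n * 2 ^ s ≤ 2 * y := by
    have h2 := hy.2.2
    have h3 : 2 * (n : ℝ) ≤ 2 ^ s := by nlinarith
    have h4 : 2 * n * zVal s t am ad ^ n ≤ 2 ^ s * zVal s t am ad ^ n := by gcongr
    linarith
  have h2 := hy.2.1
  push_cast
  rw [← sumVal_mul]
  unfold errVal
  set Z := zVal s t am ad ^ n
  set a := sumVal s w k * (n : ℝ) ^ (k + 1) * t with ha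
  have ha0 : 0 ≤ a := by positivity
  constructor
  · calc 2 * (5 * t * sumVal s w k * (n : ℝ) ^ (k + 1) * Z) * (2 ^ s * 2 ^ s)
        = 10 * a * 2 ^ s * (Z * 2 ^ s) := by rw [ha]; ring
      _ ≤ 10 * a * 2 ^ s * (2 * y) := by gcongr
      _ = _ := by rw [ha]; ring
  · calc sumVal s w k * 2 ^ s * (n : ℝ) ^ (k + 1) * y * t * 20 = 20 * a * 2 ^ s * y := by
          rw [ha]; ring
      _ ≤ 20 * a * 2 ^ s * (Z * 2 ^ s) := by gcongr
      _ = _ := by rw [ha]; ring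

/-- The precision at which the algorithm stops at the latest. -/
def lastScale (k lam : ℕ) : ℕ := k * (7 * lam + 4) + 6 * lam + 9

theorem roundProg_runs (P : Instance n k lam t e c m δ A)
    (hans : ∀ s, 2 ≤ s → Answers k s c m δ (O 0 (s - 1)) (O 1 (s - 1)) fun l => O (l + 2) (s - 1))
    (T : ExpTable k e E) (hs1 : 1 ≤ s) (hs : (12 * n * (t + 1) : ℝ) ≤ 2 ^ (s + s))
    (hbd : 3 * (s + s) + 8 * lam + 16 ≤ bd) (st : St) (hss : st.s = s) (hsn : st.n = n)
    (hsk : st.k = k) (hst : st.t = t) (hf : st.flag = 0) :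
    ∃ st' : St, Runs O bd roundProg (mem k E st) (mem k E st') (roundSteps n k t) ∧
      st'.n = n ∧ st'.k = k ∧ st'.t = t ∧ st'.s = (s + s : ℕ) ∧
      (st'.flag = 0 ∧ s + s ≤ lastScale k lam ∨
        st'.flag = 1 ∧ ∃ b : ℕ, st'.bi = b ∧ Good k t e c m δ b) := by
  have Q := hans (s + s) (by omega)
  set q := s + s - 1 with hq
  have hqs : q + 1 = s + s := by omega
  set am := O 0 q with ham
  set ad := O 1 q with had
  set w : ℕ → ℤ := fun l => O (l + 2) q with hw
  have hs4 : (4 : ℝ) ≤ 2 ^ (s + s) := by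
    calc (4 : ℝ) = 2 ^ 2 := by norm_num
      _ ≤ _ := pow_le_pow_right₀ (by norm_num) (by omega)
  have RB := P.roundBound Q hs hs4 hbd
  have B := P.bitBound Q hs hs4 hbd
  have hidx := B.index
  have ht1 : 1 ≤ t := by have := P.four_le; omega
  have ht1' : (1 : ℤ) ≤ t := by exact_mod_cast ht1
  have hthr1 := RB.thr_le 1 (by norm_num) (by
    push_cast
    exact one_le_mul_of_one_le_of_one_le (one_le_pow₀ one_le_zVal) (one_le_pow₀ (by norm_num)))
  have h1n : (1 : ℤ) ≤ (n : ℤ) ^ (k + 1) := one_le_pow₀ (by exact_mod_cast P.one_le)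
  have hS1 : (1 : ℤ) ≤ sumReg (s + s) w k := by
    have h1 := sumReg_mono (s := s + s) (w := w) (Nat.zero_le k)
    have h2 : sumReg (s + s) w 0 = 2 ^ (s + s) := by simp [sumReg]
    have h3 : (1 : ℤ) ≤ 2 ^ (s + s) := one_le_pow₀ (by norm_num)
    omega
  have hprod : sumReg (s + s) w k * (n : ℤ) ^ (k + 1) ≤ 2 ^ bd := by
    refine le_trans ?_ hthr1
    rw [mul_one, mul_assoc _ (t : ℤ)]
    exact le_mul_of_one_le_right (by positivity) (by omega)
  obtain ⟨u1, w1, r1⟩ := coeffProg_runs (O := O) (E := E) (w := w) (s := s + s) (q := q)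
    (am := am) (ad := ad) (fun _ _ => rfl)
    (le_trans (le_mul_of_one_le_right (by omega) h1n) hprod)
    (le_trans (le_mul_of_one_le_left (by omega) hS1) hprod) P.one_le B.scale (by omega) hqs rfl rfl
    RB.am_le RB.ad_le st (by rw [hss]; push_cast; rfl) hsn hsk
  obtain ⟨y2, b2, u2, v2, r2, hy⟩ := thresholdProg_runs (O := O) (E := E) RB (by omega) ht1 P.one_le
    B.power B.scale {st with
      s := (s + s : ℕ), q := q, am := am, ad := ad
      u := u1, w := w1, S := sumReg (s + s) w k, N := (n : ℤ) ^ (k + 1), j := k}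
    rfl hsn hst rfl rfl rfl rfl
  dsimp only at r2
  obtain ⟨st3, r3, e1, e2, e3, e4, I, hor⟩ := searchProg_runs (O := O) (E := E) P Q T hs hs4 hbd
    hqs (fun _ _ => rfl) {st with
      s := (s + s : ℕ), q := q, am := am, ad := ad, w := w1, N := (n : ℤ) ^ (k + 1), j := k
      y := y2, b := b2, u := u2, v := v2, g := 0, z := zReg (s + s) t am ad
      S := sumReg (s + s) w k * (n : ℤ) ^ (k + 1) * y2 * t * 20}
    rfl rfl hsk hst rfl rfl hf
  dsimp only at e1 e2 e3 e4 hor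
  obtain ⟨th1, th2⟩ := threshold_bounds (k := k) (w := w) hs hy
  have h0 : (0 : ℝ) < 2 ^ (s + s) := by positivity
  refine ⟨st3, Runs.seq r1 (Runs.seq r2 r3), e1.trans hsn, e2.trans hsk, e3.trans hst, e4, ?_⟩
  rcases hor with ⟨hfl, hle⟩ | ⟨hfl, hlt⟩
  · refine Or.inl ⟨hfl, ?_⟩
    obtain ⟨i, hi, hbig⟩ := P.exists_large P.sq_le (x₀ := multiPt m t δ 0) P.step_pos
      (P.pos 0 (by omega)) P.le_step
    have hpt : multiPt m t δ 0 + i * δ = multiPt m t δ i := by simp only [multiPt]; push_cast; ring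
    rw [hpt] at hbig
    obtain ⟨a, ha, h1⟩ := I.max i (by omega)
    have h2 := hbig a ha
    have h3 : (st3.best : ℝ) ≤ 4 * errVal n k (s + s) t am ad w := by
      have h4 : ((st3.best * 2 ^ (s + s) * 2 ^ (s + s) : ℤ) : ℝ)
          ≤ 4 * errVal n k (s + s) t am ad w * (2 ^ (s + s) * 2 ^ (s + s)) :=
        le_trans (by exact_mod_cast hle) th2
      push_cast at h4
      rw [mul_assoc] at h4
      exact le_of_mul_le_mul_right h4 (by positivity)
    have h5 := P.errVal_le Q hs hs4
    have h6 : ((2 : ℝ) ^ (k * (7 * lam + 4)))⁻¹ * 2 ^ (s + s) ≤ 8 * 2 ^ (6 * lam + 6) := by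
      have : ((2 : ℝ) ^ (k * (7 * lam + 4)))⁻¹ * 2 ^ (s + s)
          ≤ |fracVal e c k a (multiPt m t δ i)| * 2 ^ (s + s) := by gcongr
      have : (0 : ℝ) < 2 ^ (6 * lam + 6) := by positivity
      linarith
    rw [inv_mul_le_iff₀ (by positivity)] at h6
    have h7 : (2 : ℝ) ^ (k * (7 * lam + 4)) * (8 * 2 ^ (6 * lam + 6)) = 2 ^ lastScale k lam := by
      rw [show (8 : ℝ) = 2 ^ 3 by norm_num, ← pow_add, ← pow_add, lastScale]; congr 1; ring
    rw [h7] at h6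
    exact (pow_le_pow_iff_right₀ (by norm_num : (1 : ℝ) < 2)).1 h6
  · refine Or.inr ⟨hfl, I.good Instance.errVal_nonneg ?_⟩
    have h4 : 2 * errVal n k (s + s) t am ad w * (2 ^ (s + s) * 2 ^ (s + s))
        < ((st3.best * 2 ^ (s + s) * 2 ^ (s + s) : ℤ) : ℝ) :=
      lt_of_le_of_lt th1 (by exact_mod_cast hlt)
    push_cast at h4
    rw [mul_assoc (st3.best : ℝ)] at h4
    exact lt_of_mul_lt_mul_right h4 (by positivity)

end RoundCorrect

/-! ## The whole program -/

/-- Moves one exponent, adding `k` to it. -/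
def moveBody : Prog :=
  .seq (.arith .add (.reg 1) (rg 1) (.ind 3)) <|
  .seq (.arith .add (.reg 3) (rg 3) (cst 24)) <|
  .seq (.arith .add (.ind 3) (rg 1) (cst 0)) <|
  .seq (.arith .sub (.reg 3) (rg 3) (cst 24)) <|
  .seq (.arith .sub (.reg 1) (rg 1) (.ind 3)) <|
  .arith .sub (.reg 3) (rg 3) (cst 1)

/-- Moves the exponents, to make room for the named registers. -/
def moveProg : Prog :=
  .seq (.arith .add (.reg 3) (rg 1) (cst 2)) <|
  .seq (.loop (cst 3) (rg 3) moveBody) <|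
  .seq (setReg 27 (rg 1)) (setReg 26 (rg 1))

/-- Finds the initial precision. -/
def startProg : Prog :=
  .seq (setReg 25 (cst 0)) <|
  .seq (setReg 3 (cst 1)) <|
  .seq (setReg 9 (cst 2)) <|
  .seq (.arith .add (.reg 18) (rg 2) (cst 1)) <|
  .seq (.arith .mul (.reg 18) (rg 18) (rg 0)) <|
  .seq (.arith .mul (.reg 18) (rg 18) (cst 16)) <|
  .loop (rg 9) (rg 18)
    (.seq (.arith .add (.reg 9) (rg 9) (rg 9)) (.arith .add (.reg 3) (rg 3) (cst 1)))

/-- The program: rounds of doubled precision until the test succeeds. -/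
def admissibleProg : Prog :=
  .seq moveProg (.seq startProg (.seq (.loop (rg 25) (cst 1) roundProg) (setReg 0 (rg 21))))

section Main

open Finset

variable {O : ℕ → ℕ → ℤ} {n k lam t s bd : ℕ} {e : ℕ → ℕ} {c : ℕ → ℝ} {E : ℕ → ℤ}
  {m δ A : ℝ}

theorem moveBody_runs {M : Mem} {p : ℕ} {v κ : ℤ} (hp : 4 ≤ p) (h1 : M 1 = κ) (h3 : M 3 = p)
    (hv : M p = v) (hκ : |κ| ≤ 2 ^ bd) (hκv : |κ + v| ≤ 2 ^ bd) (hpb : (p + 24 : ℤ) ≤ 2 ^ bd) :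
    Runs O bd moveBody M (Function.update (Function.update M (p + 24) (κ + v)) 3 (p - 1)) 6 := by
  have c1 : |(p : ℤ) + 24| ≤ 2 ^ bd := by rw [abs_of_nonneg (by positivity)]; exact hpb
  have c2 : |(p : ℤ)| ≤ 2 ^ bd := by rw [abs_of_nonneg (by positivity)]; omega
  have c3 : |(p : ℤ) - 1| ≤ 2 ^ bd := by rw [abs_of_nonneg (by omega)]; omega
  have t1 : ((p : ℤ) + 24).toNat = p + 24 := by omega
  have p1 : p ≠ 1 := by omega
  have p3 : p ≠ 3 := by omega
  have p24 : p ≠ p + 24 := by omega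
  apply Runs.cast
  · apply Runs.seq (Runs.op hκv rfl (by simp [h1, h3, hv]))
    apply Runs.seq (Runs.op c1 rfl (by simp [h3]))
    apply Runs.seq (Runs.op hκv rfl (by simp))
    apply Runs.seq (Runs.op c2 rfl (by simp [t1]))
    apply Runs.seq (Runs.op (v := κ) hκ rfl (by simp [t1, p1, p3, hv]))
    exact Runs.op c3 rfl (by simp [t1])
  · norm_num
  · funext a
    simp only [Dest.addr, Function.update_self, t1, Function.update_apply]
    by_cases a3 : a = 3
    · simp [a3]
    · by_cases a1 : a = 1
      · subst a1
        rw [if_neg a3, if_pos rfl, if_neg a3, if_neg (by omega), h1]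
      · simp [a3, a1]

theorem moveLoop_runs (hn : ∀ i < k, (k + e i : ℤ) ≤ 2 ^ bd) (hk : (k + 26 : ℤ) ≤ 2 ^ bd) (d : ℕ) :
    ∀ (M : Mem) (p : ℕ), p = d + 3 → p ≤ k + 2 → M 0 = n → M 1 = k → M 2 = t → M 3 = p →
      (∀ a, 4 ≤ a → a ≤ p → M a = e (a - 3)) →
      (∀ a, p < a → a ≤ k + 2 → M (a + 24) = k + e (a - 3)) →
    ∃ M' : Mem, Runs O bd (.loop (cst 3) (rg 3) moveBody) M M' (7 * d + 1) ∧ M' 0 = n ∧ M' 1 = k ∧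
      M' 2 = t ∧ ∀ a, 3 < a → a ≤ k + 2 → M' (a + 24) = k + e (a - 3) := by
  induction d with
  | zero =>
    intro M p hp hpk h0 h1 h2 h3 hlo hhi
    refine ⟨M, (Runs.loop_done ?_).mono (by omega), h0, h1, h2, fun a ha => hhi a (by omega)⟩
    simp [h3, hp]
  | succ d ih =>
    intro M p hp hpk h0 h1 h2 h3 hlo hhi
    have hkb : |(k : ℤ)| ≤ 2 ^ bd := by rw [abs_of_nonneg (by positivity)]; omega
    have r1 := moveBody_runs (O := O) (bd := bd) (by omega : 4 ≤ p) h1 h3 (hlo p (by omega) le_rfl)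
      hkb (by rw [abs_of_nonneg (by positivity)]; exact hn _ (by omega)) (by omega)
    obtain ⟨M', r2, q⟩ := ih (Function.update (Function.update M (p + 24) (k + e (p - 3))) 3 (p - 1))
      (p - 1) (by omega) (by omega)
      (by rw [Function.update_of_ne (by norm_num), Function.update_of_ne (by omega), h0])
      (by rw [Function.update_of_ne (by norm_num), Function.update_of_ne (by omega), h1])
      (by rw [Function.update_of_ne (by norm_num), Function.update_of_ne (by omega), h2])
      (by rw [Function.update_self]; omega)
      (by
        intro a ha1 ha2
        rw [Function.update_of_ne (by omega), Function.update_of_ne (by omega)]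
        exact hlo a ha1 (by omega))
      (by
        intro a ha1 ha2
        rw [Function.update_of_ne (by omega)]
        by_cases hap : a = p
        · rw [hap, Function.update_self]
        · rw [Function.update_of_ne (by omega)]
          exact hhi a (by omega) ha2)
    refine ⟨M', (Runs.loop_step ?_ r1 r2).mono (by omega), q⟩
    simp [h3]; omega

theorem exists_mem (K : ℕ) (E : ℕ → ℤ) (M : Mem) (h : ∀ a ≤ K, M (a + 26) = E a) :
    ∃ st : St, M = mem K E st ∧ st.n = M 0 ∧ st.k = M 1 ∧ st.t = M 2 := by
  refine ⟨⟨M 0, M 1, M 2, M 3, M 4, M 5, M 6, M 7, M 8, M 9, M 10, M 11, M 12, M 13, M 14, M 15,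
    M 16, M 17, M 18, M 19, M 20, M 21, M 22, M 23, M 24, M 25, fun a => M (a + K + 27)⟩, ?_, rfl,
    rfl, rfl⟩
  funext a
  unfold mem
  split <;> try rfl
  rename_i a
  split_ifs with ha
  · exact h a ha
  · change M (a + 26) = M (a - (K + 1) + K + 27)
    congr 1; omega

/-- The table of exponents after the move. -/
def expTable (k : ℕ) (e : ℕ → ℕ) (i : ℕ) : ℤ := if i = 0 then k else k + e (i - 1)

theorem expTable_isExpTable : ExpTable k e (expTable k e) where
  zero := by simp [expTable]
  succ i _ := by simp [expTable]

theorem moveProg_runs (hk2 : 2 ≤ k) (h0e : e 0 = 0) (hn : ∀ i < k, (k + e i : ℤ) ≤ 2 ^ bd)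
    (hk : (k + 26 : ℤ) ≤ 2 ^ bd) {M : Mem} (h0 : M 0 = n) (h1 : M 1 = k) (h2 : M 2 = t)
    (he : ∀ i < k, M (i + 3) = e i) :
    ∃ st : St, Runs O bd moveProg M (mem k (expTable k e) st) (7 * k + 4) ∧
      st.n = n ∧ st.k = k ∧ st.t = t := by
  have hkb : |(k : ℤ)| ≤ 2 ^ bd := by rw [abs_of_nonneg (by positivity)]; omega
  have hkb2 : |(k : ℤ) + 2| ≤ 2 ^ bd := by rw [abs_of_nonneg (by positivity)]; omega
  obtain ⟨M1, r1, q0, q1, q2, q3⟩ := moveLoop_runs (O := O) (bd := bd) (n := n) (t := t) hn hk (k - 1)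
    (Function.update M 3 (k + 2)) (k + 2) (by omega) le_rfl (by simp [h0]) (by simp [h1])
    (by simp [h2]) (by simp) (by
      intro a ha1 ha2
      rw [Function.update_of_ne (by omega)]
      have := he (a - 3) (by omega)
      rwa [show a - 3 + 3 = a by omega] at this) (by intro a ha1 ha2; omega)
  obtain ⟨st, hst, s0, s1, s2⟩ := exists_mem k (expTable k e)
    (Function.update (Function.update M1 27 k) 26 k) (by
      intro a ha
      rcases Nat.lt_or_ge a 2 with h | h
      · interval_cases a <;> simp [expTable, h0e]
      · rw [Function.update_of_ne (by omega), Function.update_of_ne (by omega)]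
        have := q3 (a + 2) (by omega) (by omega)
        rw [show a + 26 = a + 2 + 24 by omega, this, expTable, if_neg (by omega),
          show a + 2 - 3 = a - 1 by omega])
  refine ⟨st, ?_, by simp [s0, q0], by simp [s1, q1], by simp [s2, q2]⟩
  rw [← hst]
  apply Runs.cast
  · apply Runs.seq (Runs.op hkb2 rfl (by simp [h1]))
    apply Runs.seq r1
    apply Runs.seq (Runs.op hkb rfl (by simp [q1]))
    exact Runs.op hkb rfl (by simp [q1])
  · omega
  · rfl

theorem startLoop_runs {u D : ℕ} (hu : u ≤ 2 ^ D) (hD : (D : ℕ) ≤ bd) (d : ℕ) :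
    ∀ (st : St) (s : ℕ), s + d = D → st.s = s → st.y = 2 ^ s → st.u = u →
    ∃ s' : ℕ, s ≤ s' ∧ s' ≤ D ∧ u ≤ 2 ^ s' ∧ Runs O bd
      (.loop (rg 9) (rg 18)
        (.seq (.arith .add (.reg 9) (rg 9) (rg 9)) (.arith .add (.reg 3) (rg 3) (cst 1))))
      (mem k E st) (mem k E {st with s := s', y := 2 ^ s'}) (3 * d + 1) := by
  induction d with
  | zero =>
    intro st s hs hss hsy hsu
    obtain rfl : s = D := by omega
    refine ⟨s, le_rfl, le_rfl, hu, ?_⟩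
    apply Runs.cast
    · refine Runs.loop_done ?_
      simp only [Operand.val, mem_y, mem_u, hsy, hsu]
      exact not_lt.2 (by exact_mod_cast hu)
    · omega
    · congr 1
      rw [← hss, ← hsy]
  | succ d ih =>
    intro st s hs hss hsy hsu
    by_cases hlt : 2 ^ s < u
    · obtain ⟨s', h1, h2, h3, r⟩ := ih {st with s := (s + 1 : ℕ), y := 2 ^ (s + 1)} (s + 1)
        (by omega) rfl rfl hsu
      refine ⟨s', by omega, h2, h3, ?_⟩
      have c1 : |(2 : ℤ) ^ (s + 1)| ≤ 2 ^ bd := by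
        rw [abs_of_nonneg (by positivity)]; exact pow_le_pow_right₀ (by norm_num) (by omega)
      have c2 : |((s + 1 : ℕ) : ℤ)| ≤ 2 ^ bd := by
        rw [abs_of_nonneg (by positivity)] at c1 ⊢
        have : s + 1 < 2 ^ (s + 1) := Nat.lt_two_pow_self
        exact le_trans (by exact_mod_cast this.le) c1
      have r1 : Runs O bd (.seq (.arith .add (.reg 9) (rg 9) (rg 9))
          (.arith .add (.reg 3) (rg 3) (cst 1))) (mem k E st)
          (mem k E {st with s := (s + 1 : ℕ), y := 2 ^ (s + 1)}) (1 + 1) := by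
        apply Runs.cast
        · apply Runs.seq (Runs.op c1 (upd_y k E _ _) (by simp [hsy]; ring))
          exact Runs.op c2 (upd_s k E _ _) (by simp [hss])
        · exact le_rfl
        · simp
      refine (Runs.loop_step ?_ r1 r).mono (by omega)
      simp only [Operand.val, mem_y, mem_u, hsy, hsu]
      exact_mod_cast hlt
    · refine ⟨s, le_rfl, by omega, by omega, ?_⟩
      apply Runs.cast
      · refine Runs.loop_done ?_
        simp only [Operand.val, mem_y, mem_u, hsy, hsu]
        exact_mod_cast hlt
      · omega
      · congr 1
        rw [← hss, ← hsy]

theorem startProg_runs {D : ℕ} (hD1 : 1 ≤ D) (hu : (t + 1) * n * 16 ≤ 2 ^ D) (hD : D ≤ bd)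
    (hn1 : 1 ≤ n) (st : St) (hsn : st.n = n) (hst : st.t = t) :
    ∃ (s' : ℕ) (u' : ℤ), 1 ≤ s' ∧ s' ≤ D ∧ (t + 1) * n * 16 ≤ 2 ^ s' ∧
      Runs O bd startProg (mem k E st)
        (mem k E {st with s := s', y := 2 ^ s', u := u', flag := 0}) (3 * D + 7) := by
  obtain ⟨s', h1, h2, h3, r⟩ := startLoop_runs (O := O) (k := k) (E := E) hu hD (D - 1)
    {st with flag := 0, s := (1 : ℕ), y := 2 ^ 1, u := ((t + 1) * n * 16 : ℕ)} 1 (by omega) rfl rfl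
    rfl
  have hb : ((t + 1) * n * 16 : ℕ) ≤ 2 ^ bd := hu.trans (Nat.pow_le_pow_right (by norm_num) hD)
  have hb2 : ∀ a : ℕ, a ≤ (t + 1) * n * 16 → |(a : ℤ)| ≤ 2 ^ bd := fun a ha => by
    rw [abs_of_nonneg (by positivity)]; exact_mod_cast ha.trans hb
  have l1 : (t + 1) ≤ (t + 1) * n := Nat.le_mul_of_pos_right _ hn1
  refine ⟨s', ((t + 1) * n * 16 : ℕ), h1, h2, h3, ?_⟩
  apply Runs.cast
  · apply Runs.seq (Runs.op (v := 0) (by simp) (upd_flag k E _ _) (by simp))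
    apply Runs.seq (Runs.op (v := (1 : ℕ)) (hb2 1 (by omega)) (upd_s k E _ _) (by simp))
    apply Runs.seq (Runs.op (v := 2 ^ 1) (hb2 2 (by omega)) (upd_y k E _ _) (by simp))
    apply Runs.seq (Runs.op (v := (t + 1 : ℕ)) (hb2 _ (by omega)) (upd_u k E _ _) (by simp [hst]))
    apply Runs.seq (Runs.op (v := ((t + 1) * n : ℕ)) (hb2 _ (by omega)) (upd_u k E _ _)
      (by simp [hsn]))
    apply Runs.seq (M' := mem k E {st with
        flag := 0, s := (1 : ℕ), y := 2 ^ 1, u := ((t + 1) * n * 16 : ℕ)})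
      (Runs.cast (Runs.op (v := ((t + 1) * n * 16 : ℕ)) (hb2 _ le_rfl) (upd_u k E _ _)
        (by simp)) le_rfl (by simp))
    exact r
  · omega
  · rfl

theorem roundLoop_runs (P : Instance n k lam t e c m δ A)
    (hans : ∀ s, 2 ≤ s → Answers k s c m δ (O 0 (s - 1)) (O 1 (s - 1)) fun l => O (l + 2) (s - 1))
    (T : ExpTable k e E) (hbd : 6 * lastScale k lam + 8 * lam + 16 ≤ bd) (d : ℕ) :
    ∀ (st : St) (s : ℕ), 1 ≤ s → s ≤ lastScale k lam → (12 * n * (t + 1) : ℝ) ≤ 2 ^ s →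
      lastScale k lam < 2 ^ d * s → st.s = s → st.n = n → st.k = k → st.t = t → st.flag = 0 →
    ∃ st' : St, Runs O bd (.loop (rg 25) (cst 1) roundProg) (mem k E st) (mem k E st')
      ((roundSteps n k t + 1) * d + 1) ∧ ∃ b : ℕ, st'.bi = b ∧ Good k t e c m δ b := by
  induction d with
  | zero => intro st s _ h1 _ h2; omega
  | succ d ih =>
    intro st s hs1 hs2 hs hd hss hsn hsk hst hf
    obtain ⟨st1, r1, e1, e2, e3, e4, hor⟩ := roundProg_runs (E := E) P hans T hs1
      (hs.trans (pow_le_pow_right₀ (by norm_num) (by omega))) (by omega : _ ≤ bd) st hss hsn hsk hst hf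
    have hlt : (rg 25).val (mem k E st) < (cst 1).val (mem k E st) := by simp [hf]
    rcases hor with ⟨hfl, hle⟩ | ⟨hfl, hgood⟩
    · obtain ⟨st2, r2, hgood⟩ := ih st1 (s + s) (by omega) hle
        (hs.trans (pow_le_pow_right₀ (by norm_num) (by omega)))
        (by rw [← two_mul, ← mul_assoc, ← pow_succ]; exact hd) e4 e1 e2 e3 hfl
      exact ⟨st2, (Runs.loop_step hlt r1 r2).mono (by rw [mul_add]; omega), hgood⟩
    · refine ⟨st1, (Runs.loop_step hlt r1 (Runs.loop_done (by simp [hfl]))).mono ?_, hgood⟩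
      rw [mul_add]; omega

/-- The number of instructions of the program. -/
def totalSteps (n k t lam : ℕ) : ℕ :=
  7 * k + 4 + (3 * (n.size + (t + 1).size + 4) + 7
    + ((roundSteps n k t + 1) * (lastScale k lam).size + 1 + 1))

/-- Bound for the bit lengths of the registers. -/
def totalBits (k lam : ℕ) : ℕ := 6 * lastScale k lam + 8 * lam + 16

theorem admissibleProg_runs (P : Instance n k lam t e c m δ A)
    (hans : ∀ s, 2 ≤ s → Answers k s c m δ (O 0 (s - 1)) (O 1 (s - 1)) fun l => O (l + 2) (s - 1))
    {M : Mem} (h0 : M 0 = n) (h1 : M 1 = k) (h2 : M 2 = t) (he : ∀ i < k, M (i + 3) = e i) :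
    ∃ (M' : Mem) (b : ℕ), Runs O (totalBits k lam) admissibleProg M M' (totalSteps n k t lam) ∧
      M' 0 = b ∧ Good k t e c m δ b := by
  obtain ⟨bd, hbd⟩ : ∃ bd, bd = totalBits k lam := ⟨_, rfl⟩
  rw [← hbd]
  have hbl : bd = 6 * lastScale k lam + 8 * lam + 16 := hbd
  have hls : lastScale k lam = k * (7 * lam + 4) + 6 * lam + 9 := rfl
  have hkn : (k : ℝ) + n + 26 ≤ 2 ^ bd := by
    have h3 := P.k_le
    have h4 := P.n_le
    have h5 : (1 : ℝ) ≤ 2 ^ lam := one_le_pow₀ (by norm_num)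
    have h6 : (2 : ℝ) ^ (lam + 5) ≤ 2 ^ bd := pow_le_pow_right₀ (by norm_num) (by omega)
    rw [pow_add] at h6
    linarith
  have hkn' : (k : ℤ) + n + 26 ≤ 2 ^ bd := by exact_mod_cast hkn
  obtain ⟨st1, r1, a1, a2, a3⟩ := moveProg_runs (O := O) (bd := bd) P.two_le P.exp_zero
    (fun i hi => by have := P.exp_le i hi; omega) (by omega) h0 h1 h2 he
  obtain ⟨D, hD⟩ : ∃ D, D = n.size + (t + 1).size + 4 := ⟨_, rfl⟩
  have hu : (t + 1) * n * 16 ≤ 2 ^ D := by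
    have h3 := Nat.lt_size_self n
    have h4 := Nat.lt_size_self (t + 1)
    calc (t + 1) * n * 16 ≤ 2 ^ (t + 1).size * 2 ^ n.size * 2 ^ 4 := by gcongr; norm_num
      _ = 2 ^ D := by rw [← pow_add, ← pow_add]; congr 1; omega
  have hns : n.size ≤ lam + 1 := by
    rw [Nat.size_le, pow_succ]
    have h3 : n ≤ 2 ^ lam := by exact_mod_cast P.n_le
    have := P.one_le
    omega
  have hts : (t + 1).size ≤ lam + 2 := by
    rw [Nat.size_le, pow_add]
    have h3 : t ≤ 2 ^ lam := by exact_mod_cast P.t_le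
    have := P.four_le
    omega
  obtain ⟨s', u', b1, b2, b3, r2⟩ := startProg_runs (O := O) (bd := bd) (k := k)
    (E := expTable k e) (by omega : 1 ≤ D) hu (by omega) P.one_le st1 a1 a3
  have hs12 : (12 * n * (t + 1) : ℝ) ≤ 2 ^ s' := by
    have h3 : (((t + 1) * n * 16 : ℕ) : ℝ) ≤ 2 ^ s' := by exact_mod_cast b3
    push_cast at h3
    have : (0 : ℝ) ≤ n * (t + 1) := by positivity
    linarith
  obtain ⟨st3, r3, b, hb, hgood⟩ := roundLoop_runs (O := O) (bd := bd) P hans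
    (expTable_isExpTable (k := k) (e := e)) hbl.ge (lastScale k lam).size
    {st1 with s := s', y := 2 ^ s', u := u', flag := 0} s' b1 (by omega) hs12
    (lt_of_lt_of_le (Nat.lt_size_self _) (Nat.le_mul_of_pos_right _ b1)) rfl a1 a2 a3 rfl
  have cb : |(b : ℤ)| ≤ 2 ^ bd := by
    have h3 : (b : ℝ) ≤ 2 ^ bd := by
      have h4 : (b : ℝ) ≤ 2 * t := by exact_mod_cast hgood.1
      have h5 := P.t_le
      have h6 : (2 : ℝ) ^ (lam + 1) ≤ 2 ^ bd := pow_le_pow_right₀ (by norm_num) (by omega)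
      rw [pow_succ] at h6
      linarith
    rw [abs_of_nonneg (by positivity)]; exact_mod_cast h3
  have r4 : Runs O bd (setReg 0 (rg 21)) (mem k (expTable k e) st3)
      (mem k (expTable k e) {st3 with n := b}) 1 :=
    Runs.op cb (upd_n _ _ _ _) (by simp [hb])
  refine ⟨_, b, Runs.mono (Runs.seq r1 (Runs.seq r2 (Runs.seq r3 r4))) ?_, ?_, hgood⟩
  · rw [totalSteps, hD]
  · exact mem_n _ _ _

end Main

/-! ## The algorithm -/

section Algorithm

/-- Extends a tuple by zeros. -/
def extend {β : Type*} [Zero β] {k : ℕ} (f : Fin k → β) (i : ℕ) : β :=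
  if h : i < k then f ⟨i, h⟩ else 0

theorem extend_of_lt {β : Type*} [Zero β] {k : ℕ} (f : Fin k → β) {i : ℕ} (h : i < k) :
    extend f i = f ⟨i, h⟩ := dif_pos h

theorem extend_coe {β : Type*} [Zero β] {k : ℕ} (f : Fin k → β) (i : Fin k) :
    extend f i = f i := extend_of_lt f i.2

theorem size_le_logb {n : ℕ} (hn : 1 ≤ n) : (n.size : ℝ) ≤ Real.logb 2 n + 1 := by
  have h1 : 2 ^ (n.size - 1) ≤ n := by
    rw [← Nat.lt_size]
    have := Nat.size_pos.2 hn
    omega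
  have h2 : ((n.size - 1 : ℕ) : ℝ) ≤ Real.logb 2 n := by
    rw [Real.le_logb_iff_rpow_le (by norm_num) (by exact_mod_cast hn), Real.rpow_natCast]
    exact_mod_cast h1
  have h3 := Nat.size_pos.2 hn
  rw [Nat.cast_sub h3, Nat.cast_one] at h2
  linarith

theorem totalSteps_le {n k t lam : ℕ} (hn : 1 ≤ n) (hk : 2 ≤ k) (ht : 4 ≤ t) :
    totalSteps n k t lam ≤ 80 * ((k + n.size) * k * t) * (lastScale k lam).size := by
  have hS := Nat.size_pos.2 hn
  have hZ : 1 ≤ (lastScale k lam).size := Nat.size_pos.2 (by unfold lastScale; omega)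
  have hT : (t + 1).size ≤ t + 1 := Nat.size_le.2 Nat.lt_two_pow_self
  unfold totalSteps roundSteps
  generalize n.size = S at *
  generalize (lastScale k lam).size = Z at *
  generalize (t + 1).size = U at *
  obtain ⟨K, hK⟩ : ∃ K, K = k + S := ⟨_, rfl⟩
  rw [← hK]
  have h1 : 3 * k ≤ K * k := Nat.mul_le_mul_right _ (by omega)
  have h2 : K * 2 ≤ K * k := Nat.mul_le_mul_left _ hk
  have h3 : (13 * k + 9 * S + 21) * k + 14 ≤ 24 * (K * k) := by
    have : (13 * k + 9 * S + 21) * k ≤ 20 * K * k := Nat.mul_le_mul_right _ (by omega)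
    rw [mul_assoc] at this
    omega
  generalize K * k = X at *
  have h4 : X * 4 ≤ X * t := Nat.mul_le_mul_left _ ht
  have h5 : 6 * t ≤ X * t := Nat.mul_le_mul_right _ (by omega)
  have h6 : ((13 * k + 9 * S + 21) * k + 14) * (2 * t + 1) ≤ 24 * X * (2 * t + 1) :=
    Nat.mul_le_mul_right _ h3
  have h7 : 24 * X * (2 * t + 1) = 48 * (X * t) + 24 * X := by ring
  generalize X * t = Y at *
  generalize ((13 * k + 9 * S + 21) * k + 14) * (2 * t + 1) = R at *
  have h8 : (8 * k + 8 + (9 * S + 20 + (R + 9)) + 1) * Z ≤ 60 * Y * Z :=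
    Nat.mul_le_mul_right _ (by omega)
  have h9 : Y * 1 ≤ Y * Z := Nat.mul_le_mul_left _ hZ
  rw [mul_assoc] at h8 ⊢
  generalize Y * Z = V at *
  omega

theorem lastScale_le {k lam : ℕ} (hk : 2 ≤ k) (hl : 3 ≤ lam) : lastScale k lam ≤ 14 * (k * lam) := by
  unfold lastScale
  have h1 : 2 * lam ≤ k * lam := Nat.mul_le_mul_right _ hk
  have h2 : k * 3 ≤ k * lam := Nat.mul_le_mul_left _ hl
  have h3 : k * (7 * lam + 4) = 7 * (k * lam) + 4 * k := by ring
  omega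

theorem unitCost_le {k lam : ℕ} (hk : 2 ≤ k) (hl : 3 ≤ lam) :
    unitCost (totalBits k lam) ≤ 1300 * (k * lam) * (200 * (k * lam)).size ^ 2 := by
  have h1 : 2 * lam ≤ k * lam := Nat.mul_le_mul_right _ hk
  have hb : totalBits k lam + 2 ≤ 100 * (k * lam) := by
    have := lastScale_le hk hl
    unfold totalBits
    omega
  unfold unitCost
  generalize totalBits k lam + 2 = b at *
  have h2 : (2 * b).size ≤ (200 * (k * lam)).size := Nat.size_le_size (by omega)
  have h3 : 1 ≤ (200 * (k * lam)).size ^ 2 := Nat.one_le_pow _ _ (Nat.size_pos.2 (by omega))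
  calc 1 + 10 * b + 2 * b * (2 * b).size ^ 2
      ≤ (1 + 10 * (100 * (k * lam))) * 1
        + 2 * (100 * (k * lam)) * (200 * (k * lam)).size ^ 2 := by
        rw [mul_one]; gcongr
    _ ≤ (1100 * (k * lam)) * (200 * (k * lam)).size ^ 2
        + 2 * (100 * (k * lam)) * (200 * (k * lam)).size ^ 2 := by gcongr; omega
    _ = _ := by ring

theorem cost_le {n k t lam : ℕ} {L B : ℝ} (hn : 1 ≤ n) (hk : 2 ≤ k) (ht : 4 ≤ t) (hl : 3 ≤ lam)
    (hL : lam ≤ 2 * L) (hB : B = t * (k : ℝ) ^ 2 * (k + Real.logb 2 n) * L) {T : ℕ}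
    (hT : T ≤ totalSteps n k t lam * unitCost (totalBits k lam)) :
    (T : ℝ) ≤ 10 ^ 9 * B * Real.logb 2 (2 + B) ^ 3 := by
  obtain ⟨x, hx⟩ : ∃ x, x = k * lam := ⟨_, rfl⟩
  obtain ⟨Q, hQ⟩ : ∃ Q, Q = (200 * x).size := ⟨_, rfl⟩
  have hx6 : 2 * lam ≤ x := hx ▸ Nat.mul_le_mul_right _ hk
  have hlog : 0 ≤ Real.logb 2 n := Real.logb_nonneg (by norm_num) (by exact_mod_cast hn)
  have hkR : (2 : ℝ) ≤ k := by exact_mod_cast hk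
  have htR : (4 : ℝ) ≤ t := by exact_mod_cast ht
  have hlR : (3 : ℝ) ≤ lam := by exact_mod_cast hl
  have h1 : T ≤ 104000 * ((k + n.size) * k ^ 2 * t * lam) * Q ^ 3 := by
    have h2 : (lastScale k lam).size ≤ Q := by
      rw [hQ, hx]
      exact Nat.size_le_size ((lastScale_le hk hl).trans (by omega))
    calc T ≤ _ := hT
      _ ≤ (80 * ((k + n.size) * k * t) * Q) * (1300 * x * Q ^ 2) :=
          Nat.mul_le_mul ((totalSteps_le hn hk ht).trans (Nat.mul_le_mul_left _ h2))
            (by rw [hQ, hx]; exact unitCost_le hk hl)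
      _ = _ := by rw [hx]; ring
  have h2 : (T : ℝ) ≤ 104000 * ((k + n.size) * k ^ 2 * t * lam) * Q ^ 3 := by exact_mod_cast h1
  have h3 : (k : ℝ) + n.size ≤ 2 * (k + Real.logb 2 n) := by
    have := size_le_logb hn
    linarith
  have hL0 : 0 ≤ L := by linarith
  have h4 : ((k : ℝ) + n.size) * k ^ 2 * t * lam ≤ 4 * B := by
    calc ((k : ℝ) + n.size) * k ^ 2 * t * lam
        ≤ (2 * (k + Real.logb 2 n)) * k ^ 2 * t * (2 * L) := by gcongr
      _ = 4 * B := by rw [hB]; ring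
  have h5 : (x : ℝ) ≤ B := by
    have h6 : (1 : ℝ) ≤ k + Real.logb 2 n := by linarith
    have h7 : (1 : ℝ) ≤ k := by linarith
    calc (x : ℝ) = k * lam := by rw [hx]; push_cast; rfl
      _ ≤ k * (2 * L) := by gcongr
      _ = 2 * (k * 1) * 1 * L := by ring
      _ ≤ t * (k * k) * (k + Real.logb 2 n) * L := by gcongr; linarith
      _ = B := by rw [hB]; ring
  have hB0 : (6 : ℝ) ≤ B := le_trans (by exact_mod_cast (by omega : 6 ≤ x)) h5
  have h6 : (Q : ℝ) ≤ 10 * Real.logb 2 (2 + B) := by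
    have h7 := size_le_logb (n := 200 * x) (by omega)
    rw [← hQ] at h7
    have h8 : Real.logb 2 ((200 * x : ℕ) : ℝ) ≤ Real.logb 2 (2 ^ 8 * (2 + B)) := by
      apply Real.logb_le_logb_of_le (by norm_num) (by exact_mod_cast (by omega))
      push_cast
      linarith
    rw [Real.logb_mul (by norm_num) (by linarith), Real.logb_pow, Real.logb_self_eq_one
      (by norm_num)] at h8
    have h9 : (1 : ℝ) ≤ Real.logb 2 (2 + B) := by
      rw [Real.le_logb_iff_rpow_le (by norm_num) (by linarith), Real.rpow_one]
      linarith
    push_cast at h7 h8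
    linarith
  calc (T : ℝ) ≤ _ := h2
    _ ≤ 104000 * (4 * B) * (10 * Real.logb 2 (2 + B)) ^ 3 := by gcongr
    _ = 416000000 * (B * Real.logb 2 (2 + B) ^ 3) := by ring
    _ ≤ 10 ^ 9 * (B * Real.logb 2 (2 + B) ^ 3) := by
        apply mul_le_mul_of_nonneg_right (by norm_num)
        have := Real.logb_nonneg (b := 2) (x := 2 + B) (by norm_num) (by linarith)
        positivity
    _ = _ := by ring

theorem sparsePoly_eq {k : ℕ} (e : Fin k → ℕ) (c : Fin k → ℝ) (hk : 0 < k) (h0 : e ⟨0, hk⟩ = 0) :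
    sparsePoly e c = fracPoly (extend e) (extend c) k 0 := by
  rw [sparsePoly, fracPoly, ← Finset.range_eq_Ico,
    ← Fin.sum_univ_eq_sum_range (fun l => Polynomial.C (fracCoeff (extend e) (extend c) 0 l)
      * Polynomial.X ^ (extend e l - extend e 0))]
  refine Finset.sum_congr rfl fun i _ => ?_
  rw [extend_of_lt e hk, h0, extend_coe, Nat.sub_zero]
  simp [fracCoeff, extend_coe]

theorem fracDerivs_eq {n k : ℕ} {τ : ℝ} {e : Fin k → ℕ} {c : Fin k → ℝ} (hk : 0 < k)
    (h : IsNomial n k τ e c) (h0 : e ⟨0, hk⟩ = 0) (i : Fin k) (x : ℝ) :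
    fracDerivs k (sparsePoly e c) i x = fracVal (extend e) (extend c) k i x := by
  rw [fracDerivs, sparsePoly_eq e c hk h0, iterate_fracDeriv _ _ _ i.2, eval_fracPoly]
  · intro i j hij hj
    rw [extend_of_lt e (hij.trans hj), extend_of_lt e hj]
    exact h.strictMono hij
  · intro l hl h1
    have h2 := h.le_abs ⟨l, hl⟩
    rw [← extend_of_lt c hl, h1, abs_zero] at h2
    exact absurd h2 (not_le.2 (by positivity))

theorem Good.isAdmissible {k t b : ℕ} {e : ℕ → ℕ} {c : ℕ → ℝ} {m δ : ℝ} {G : Fin k → ℝ → ℝ}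
    (hk : 0 < k) (hG : ∀ i x, G i x = fracVal e c k i x) (h : Good k t e c m δ b) :
    IsAdmissible (minAbs G) (multipoint m t δ) (multiPt m t δ b) := by
  have : Nonempty (Fin k) := ⟨⟨0, hk⟩⟩
  have hn : ∀ x, 0 ≤ minAbs G x := fun x => le_ciInf fun i => abs_nonneg _
  refine ⟨⟨b, h.1, rfl⟩, ?_⟩
  rintro _ ⟨i, hi, rfl⟩
  obtain ⟨a, ha, h1⟩ := h.2 i hi
  rw [abs_of_nonneg (hn _), abs_of_nonneg (hn _)]
  refine le_ciInf fun a' => ?_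
  have h2 : minAbs G (multiPt m t δ i) ≤ |G ⟨a, ha⟩ (multiPt m t δ i)| :=
    ciInf_le ⟨0, by rintro _ ⟨j, rfl⟩; exact abs_nonneg _⟩ _
  rw [hG] at h2 ⊢
  have := h1 a' a'.2
  linarith

theorem IsApproxOracle.abs_sub_le {v : ℝ} {a : ℕ → ℤ} (h : IsApproxOracle v a) {s : ℕ}
    (hs : 2 ≤ s) : |(a (s - 1) : ℝ) - v * 2 ^ s| ≤ 2 := by
  have h1 := h (s - 1) (by omega)
  rw [Nat.sub_add_cancel (by omega : 1 ≤ s)] at h1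
  have h2 : (0 : ℝ) < 2 ^ s := by positivity
  have h3 : (2 : ℝ) ^ s = 2 ^ (s - 1) * 2 := by
    rw [← pow_succ, Nat.sub_add_cancel (by omega)]
  have h4 : (a (s - 1) : ℝ) - v * 2 ^ s = -(v - a (s - 1) / 2 ^ s) * 2 ^ s := by
    field_simp
    ring
  rw [h4, abs_mul, abs_neg, abs_of_pos h2]
  calc |v - a (s - 1) / 2 ^ s| * 2 ^ s ≤ 1 / 2 ^ (s - 1) * 2 ^ s := by gcongr
    _ = 2 := by rw [h3]; field_simp

theorem IsInputOracle.answers {k : ℕ} {c : Fin k → ℝ} {m δ : ℝ} {O : ℕ → ℕ → ℤ}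
    (h : IsInputOracle c m δ O) (s : ℕ) (hs : 2 ≤ s) :
    Answers k s (extend c) m δ (O 0 (s - 1)) (O 1 (s - 1)) fun l => O (l + 2) (s - 1) where
  center := h.center.abs_sub_le hs
  step := h.step.abs_sub_le hs
  coeff l hl := by
    rw [extend_of_lt c hl]
    exact (h.coeff ⟨l, hl⟩).abs_sub_le hs

/-- Two to the power of the bit length of the input. -/
noncomputable def inputMagnitude (n k : ℕ) (τ δ α : ℝ) : ℝ :=
  (n : ℝ) ^ k * 2 ^ τ * max 1 (1 / δ) * max 1 α ^ n

theorem logb_inputMagnitude {n k : ℕ} (hn : 1 ≤ n) (τ δ α : ℝ) :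
    Real.logb 2 (inputMagnitude n k τ δ α) = (k : ℝ) * Real.logb 2 n + τ
      + Real.logb 2 (max 1 (1 / δ)) + (n : ℝ) * Real.logb 2 (max 1 α) := by
  have h1 : (n : ℝ) ≠ 0 := by positivity
  have h2 : max 1 (1 / δ) ≠ 0 := (lt_of_lt_of_le one_pos (le_max_left _ _)).ne'
  have h3 : max 1 α ≠ 0 := (lt_of_lt_of_le one_pos (le_max_left _ _)).ne'
  have h4 : (2 : ℝ) ^ τ ≠ 0 := (Real.rpow_pos_of_pos (by norm_num) _).ne'
  rw [inputMagnitude, Real.logb_mul (by positivity) (by positivity),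
    Real.logb_mul (by positivity) h2, Real.logb_mul (by positivity) h4, Real.logb_pow,
    Real.logb_pow, Real.logb_rpow (by norm_num) (by norm_num)]

theorem factors_le {a b c d : ℝ} (ha : 1 ≤ a) (hb : 1 ≤ b) (hc : 1 ≤ c) (hd : 1 ≤ d) :
    a ≤ a * b * c * d ∧ b ≤ a * b * c * d ∧ c * d ≤ a * b * c * d := by
  have hab : 1 ≤ a * b := one_le_mul_of_one_le_of_one_le ha hb
  have hcd : 1 ≤ c * d := one_le_mul_of_one_le_of_one_le hc hd
  have h1 : a * b ≤ a * b * (c * d) := le_mul_of_one_le_right (by positivity) hcd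
  rw [mul_assoc (a * b)]
  refine ⟨le_trans (le_mul_of_one_le_right (by positivity) hb) h1,
    le_trans (le_mul_of_one_le_left (by positivity) ha) h1,
    le_mul_of_one_le_left (by positivity) hab⟩

theorem exists_instance {n k t : ℕ} {τ m δ α : ℝ} {e : Fin k → ℕ} {c : Fin k → ℝ} (hk : 2 ≤ k)
    (hk0 : 0 < k) (h : IsNomial n k τ e c) (h0 : e ⟨0, hk0⟩ = 0) (hδ : 0 < δ) (ht : k ^ 2 ≤ t)
    (hS : multipoint m t δ ⊆ Set.Ioo 0 α) :
    ∃ lam : ℕ, 3 ≤ lam ∧ (lam : ℝ) ≤ 2 * Real.logb 2 (inputMagnitude n k τ δ α) ∧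
      Instance n k lam t (extend e) (extend c) m δ (max 1 α) := by
  have hn : 1 ≤ n := by
    have h1 := h.strictMono (a := ⟨0, hk0⟩) (b := ⟨1, by omega⟩) (by simp)
    have h2 := h.exp_le ⟨1, by omega⟩
    omega
  have hτ : 0 ≤ τ := by
    have h1 := (h.le_abs ⟨0, hk0⟩).trans (h.abs_le ⟨0, hk0⟩)
    rw [Real.rpow_le_rpow_left_iff (by norm_num)] at h1
    linarith
  have f1 : (1 : ℝ) ≤ (n : ℝ) ^ k := one_le_pow₀ (by exact_mod_cast hn)
  have f2 : (1 : ℝ) ≤ 2 ^ τ := Real.one_le_rpow (by norm_num) hτ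
  have f3 : 1 ≤ max 1 (1 / δ) := le_max_left _ _
  have f4 : 1 ≤ max 1 α := le_max_left _ _
  have f5 : 1 ≤ max 1 α ^ n := one_le_pow₀ f4
  obtain ⟨g1, g2, g3⟩ := factors_le f1 f2 f3 f5
  have g4 : max 1 (1 / δ) ≤ max 1 (1 / δ) * max 1 α ^ n := le_mul_of_one_le_right (by positivity) f5
  have g5 : max 1 α ^ n ≤ max 1 (1 / δ) * max 1 α ^ n := le_mul_of_one_le_left (by positivity) f3
  have hpt : ∀ i ≤ 2 * t, 0 < multiPt m t δ i ∧ multiPt m t δ i < α :=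
    fun i hi => hS ⟨i, hi, rfl⟩
  have htW : 2 * (t : ℝ) ≤ max 1 (1 / δ) * max 1 α ^ n := by
    have h1 := (hpt 0 (by omega)).1
    have h2 := (hpt (2 * t) le_rfl).2
    simp only [multiPt] at h1 h2
    push_cast at h1 h2
    have h3 : 2 * t * δ ≤ max 1 α := le_trans (by linarith) (le_max_right 1 α)
    calc 2 * (t : ℝ) = 1 / δ * (2 * t * δ) := by field_simp
      _ ≤ max 1 (1 / δ) * max 1 α := by
          gcongr
          exact le_max_right _ _
      _ ≤ _ := by
          gcongr
          exact le_self_pow₀ f4 (by omega)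
  have hk4 : k * 2 ≤ t := le_trans (by rw [pow_two]; exact Nat.mul_le_mul_left _ hk) ht
  obtain ⟨W, hW⟩ : ∃ W, W = inputMagnitude n k τ δ α := ⟨_, rfl⟩
  have hW' : (n : ℝ) ^ k * 2 ^ τ * max 1 (1 / δ) * max 1 α ^ n = W := hW.symm
  rw [hW'] at g1 g2 g3
  have hW8 : (8 : ℝ) ≤ W := by
    have : (4 : ℝ) ≤ t := by exact_mod_cast (by omega : 4 ≤ t)
    linarith
  have hL3 : 3 ≤ Real.logb 2 W := by
    rw [Real.le_logb_iff_rpow_le (by norm_num) (by linarith)]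
    norm_num
    exact hW8
  have hlam : W ≤ 2 ^ ⌈Real.logb 2 W⌉₊ := by
    have h1 := Nat.le_ceil (Real.logb 2 W)
    rw [Real.logb_le_iff_le_rpow (by norm_num) (by linarith), Real.rpow_natCast] at h1
    exact h1
  rw [← hW]
  refine ⟨⌈Real.logb 2 W⌉₊, ?_, ?_, ?_⟩
  · exact_mod_cast hL3.trans (Nat.le_ceil _)
  · have := Nat.ceil_lt_add_one (a := Real.logb 2 W) (by linarith)
    linarith
  generalize ⌈Real.logb 2 W⌉₊ = lam at *
  have hp : (0 : ℝ) < 2 ^ lam := by positivity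
  refine
    { two_le := hk, lt := ?_, exp_le := ?_, one_le := hn, pow_le := g1.trans hlam, le_abs := ?_,
      abs_le := ?_, k_le := ?_, exp_zero := (extend_of_lt e hk0).trans h0, sq_le := ht,
      t_le := ?_, step_pos := hδ, le_step := ?_, pos := fun i hi => (hpt i hi).1,
      le := fun i hi => (hpt i hi).2.le.trans (le_max_right _ _), one_le_A := f4,
      A_pow_le := (g5.trans g3).trans hlam }
  · intro i j hij hj
    rw [extend_of_lt e (hij.trans hj), extend_of_lt e hj]
    exact h.strictMono hij
  · intro l hl
    rw [extend_of_lt e hl]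
    exact h.exp_le _
  · intro l hl
    rw [extend_of_lt c hl]
    refine le_trans ?_ (h.le_abs _)
    rw [Real.rpow_neg (by norm_num)]
    exact inv_anti₀ (by positivity) (g2.trans hlam)
  · intro l hl
    rw [extend_of_lt c hl]
    exact (h.abs_le _).trans (g2.trans hlam)
  · have : (k : ℝ) * 2 ≤ t := by exact_mod_cast hk4
    have : (0 : ℝ) ≤ k := by positivity
    linarith
  · have : (0 : ℝ) ≤ t := by positivity
    linarith
  · have h1 : δ⁻¹ ≤ 2 ^ lam := by
      have := le_max_right 1 (1 / δ)
      rw [one_div] at this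
      rw [one_div] at g4 g3
      linarith
    exact inv_le_of_inv_le₀ hδ h1

theorem bdd_initMem {n k t lam : ℕ} {m δ A : ℝ} {e : Fin k → ℕ} {c : ℕ → ℝ}
    (P : Instance n k lam t (extend e) c m δ A) :
    Bdd (totalBits k lam) (initMem n k t e) := by
  have hN : ∀ x : ℕ, (x : ℝ) ≤ 2 ^ lam → |(x : ℤ)| ≤ 2 ^ totalBits k lam := by
    intro x hx
    have h1 : x ≤ 2 ^ lam := by exact_mod_cast hx
    have h2 : x ≤ 2 ^ totalBits k lam :=
      h1.trans (Nat.pow_le_pow_right (by norm_num) (by unfold totalBits; omega))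
    rw [abs_of_nonneg (by positivity)]
    exact_mod_cast h2
  intro a
  match a with
  | 0 => exact hN n P.n_le
  | 1 => exact hN k P.k_le
  | 2 => exact hN t P.t_le
  | a + 3 =>
    rw [initMem]
    split_ifs with h
    · refine hN _ (le_trans ?_ P.n_le)
      have := P.exp_le a h
      rw [extend_of_lt e h] at this
      exact_mod_cast this
    · simp

end Algorithm

theorem mainTheorem11 :
    ∃ (P : Prog) (C : ℝ) (p : ℕ),
      ∀ (n k : ℕ) (τ : ℝ) (e : Fin k → ℕ) (c : Fin k → ℝ) (hk : 2 ≤ k),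
        IsNomial n k τ e c → e ⟨0, by omega⟩ = 0 →
      ∀ (m δ α : ℝ) (t : ℕ), 0 < δ → k ^ 2 ≤ t → multipoint m t δ ⊆ Set.Ioo 0 α →
      ∀ O : ℕ → ℕ → ℤ, IsInputOracle c m δ O →
        ∃ (M : Mem) (T i : ℕ), Exec O P (initMem n k t e) M T ∧
          i ≤ 2 * t ∧ M 0 = (i : ℤ) ∧
          IsAdmissible (minAbs (fracDerivs k (sparsePoly e c))) (multipoint m t δ)
            (multiPt m t δ i) ∧
          ∀ B : ℝ, B = (t : ℝ) * (k : ℝ) ^ 2 * ((k : ℝ) + Real.logb 2 n) *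
              ((k : ℝ) * Real.logb 2 n + τ + Real.logb 2 (max 1 (1 / δ))
                + (n : ℝ) * Real.logb 2 (max 1 α)) →
            (T : ℝ) ≤ C * B * Real.logb 2 (2 + B) ^ p := by
  refine ⟨admissibleProg, 10 ^ 9, 3, ?_⟩
  intro n k τ e c hk h h0 m δ α t hδ ht hS O hO
  obtain ⟨lam, hl3, hL, P⟩ := exists_instance hk (by omega) h h0 hδ ht hS
  obtain ⟨M', b, hrun, hb, hgood⟩ := admissibleProg_runs (M := initMem n k t e) P hO.answers rfl
    rfl rfl fun i hi => by rw [initMem, dif_pos hi, extend_of_lt e hi]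
  obtain ⟨-, T, hT, hexec⟩ := hrun (by unfold totalBits; omega) (bdd_initMem P)
  refine ⟨M', T, b, hexec, hgood.1, hb,
    hgood.isAdmissible (by omega) (fracDerivs_eq (by omega) h h0), fun B hB => ?_⟩
  rw [← logb_inputMagnitude P.one_le] at hB
  exact cost_le P.one_le hk P.four_le hl3 hL hB hT
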